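/- **Setting.** Let $(\mathcal G_\kappa)_{\kappa\in\mathbb N}$ be a family of cyclic groups of prime order $q=q_\kappa$ with fixed generators $g=g_\kappa$, whose elements are encoded injectively as strings. The public parameters are $\kappa$, $q$, $g$ and a description of the group; given these, multiplication and membership can be computed in time polynomial in $\kappa$ (for membership, in $\kappa$ and the length of the input). All algorithms receive the public parameters. **GDH assumption.** For every probabilistic polynomial-time (PPT) algorithm $\mathcal B$ with access to an oracle that decides whether a quadruple of group elements is of the form $(h,h^a,h^b,h^{ab})$, the probability that $\mathcal B$ on input $(g,g^{x_1},g^{x_2})$, with $x_1,x_2$ uniform in $\mathbb Z_q^*$, outputs $g^{x_1x_2}$ is negligible in $\kappa$. **Sphinx RO-KEM.** Let $h_*:\mathcal G\to\{0,1\}^{3\kappa}$ and $h_b:\mathcal G\times\mathcal G\to\mathbb Z_q^*$ be random oracles. - $\mathrm{KeyGen}(1^\kappa)$ returns $(PK,SK)=(g^x,x)$ for a uniform $x\in\mathbb Z_q^*$. - $\mathrm{Encap}(1^\kappa,PK)$ returns the keys $\big(h_*(PK^{x'}),h_b(g^{x'},PK^{x'})\big)$ and the encapsulation $g^{x'}$,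 for a uniform $x'\in\mathbb Z_q^*$. - $\mathrm{Decap}(1^\kappa,x,\alpha)$ returns $\big(h_*(\alpha^{x}),h_b(\alpha,\alpha^{x})\big)$. **Sphinx-KEM-IND-CCA game** (with maximal path length parameter $N\in\mathbb N$). 1. The challenger generates $(PK,SK)=(g^x,x)$ with $\mathrm{KeyGen}$ and gives $PK$ to the adversary. 2. The adversary may query $h_*$, $h_b$ and the decapsulation oracle $\mathcal O(\alpha)=\mathrm{Decap}(1^\kappa,SK,\alpha)$ for $\alpha\in\mathcal G$. 3. The adversary submits a position $j$ and $n-1$ public keys $y_0,\dots,y_{j-1},y_{j+1},\dots,y_{n-1}$ with $0\le j<n<N$. The challenger checks that the submitted keys are distinct and lie in $\mathcal G\setminus\{1\}$ (otherwise the submission is refused and nothing is disclosed). Put $y_j=PK$. 4. The challenger draws uniform $x'\in\mathbb Z_q^*$, $b\in\{0,1\}$, and computes, for $i=0,\dots,n-1$ in turn, $$\alpha_i=g^{x'b_0\cdots b_{i-1}},\qquad s_i=y_i^{x'b_0\cdots b_{i-1}},\qquad k_i=h_*(s_i),\qquad b_i=h_b(\alpha_i,s_i),$$ except that for $b=1$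 the values $k_j\in\{0,1\}^{3\kappa}$ and $b_j\in\mathbb Z_q^*$ are instead drawn uniformly and independently of everything else (and this $b_j$ is used in the layers after $j$). It sends $\alpha_0$, $\alpha_j$ and all $k_0,\dots,k_{n-1}$ and $b_0,\dots,b_{n-1}$ to the adversary. 5. The adversary may again query $h_*$, $h_b$ and $\mathcal O$, except for $\mathcal O(\alpha_j)$. Finally it outputs a guess $b'$. The KEM *satisfies Sphinx-KEM-IND-CCA* if for every PPT adversary there is a negligible function $\nu$ with $\Pr[b'=b]\le\frac12+\nu(\kappa)$ for all $\kappa$. **Theorem.** If the GDH assumption holds for $(\mathcal G_\kappa)$, then, in the random oracle model and for every $N$, the Sphinx RO-KEM over $(\mathcal G_\kappa)$ satisfies Sphinx-KEM-IND-CCA. -/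

import Mathlib

/-! ## Machine model: interactive probabilistic programs with a step count -/

/-- Data: finite binary trees with natural numbers at the leaves. -/
inductive Val : Type
  | nat (n : ℕ) : Val
  | pair (a b : Val) : Val
deriving DecidableEq

namespace Val

/-- The size of a value: number of nodes, plus the bit length of every number in it. -/
def size : Val → ℕ
  | nat n => 1 + Nat.size n
  | pair a b => 1 + a.size + b.size

/-- A list as a right-nested chain of pairs ended by `nat 0`. -/
def ofList : List Val → Val
  | [] => nat 0
  | a :: l => pair a (ofList l)

def toList : Val → Option (List Val)
  | nat n => if n = 0 then some [] else none
  | pair a b => (toList b).map (fun l => a :: l)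

end Val

/-- Elementary operations. -/
inductive Op : Type
  | id
  | const (c : Val)
  | fst
  | snd
  | isNat
  | eq
  | add
  | sub
  | mul
  | div
  | mod

namespace Op

/-- The value of an elementary operation; operations applied to a value of the wrong shape
return `nat 0`. -/
def eval : Op → Val → Val
  | id, v => v
  | const c, _ => c
  | fst, .pair a _ => a
  | snd, .pair _ b => b
  | isNat, .nat _ => .nat 1
  | eq, .pair a b => if a = b then .nat 1 else .nat 0
  | add, .pair (.nat m) (.nat n) => .nat (m + n)
  | sub, .pair (.nat m) (.nat n) => .nat (m - n)
  | mul, .pair (.nat m) (.nat n) => .nat (m * n)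
  | div, .pair (.nat m) (.nat n) => .nat (m / n)
  | mod, .pair (.nat m) (.nat n) => .nat (m % n)
  | _, _ => .nat 0

end Op

/-- Programs. Each transforms an input value into an output value; `rand` draws a random number and
`query` sends the input as a message to the environment and returns the reply. -/
inductive Prog : Type
  | op (f : Op)
  | comp (p q : Prog)
  | both (p q : Prog)
  | ite (c p q : Prog)
  | loop (c p : Prog)
  | rand
  | query

/-- The other party of an interaction (challenger and oracles) with internal state in `σ`: it
receives a message and returns a reply, possibly at random, while updating its state. -/
def Env (σ : Type) : Type := σ → Val → PMF (Val × σ)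

/-- Probabilistic computations with state the remaining step budget and the state of the
environment; the outcome `none` means that the step budget was exceeded. -/
def Exec (σ α : Type) : Type := ℕ × σ → PMF (Option (α × ℕ × σ))

namespace Exec

variable {σ : Type}

/-- Do nothing and return `a`. -/
noncomputable def ret {α : Type} (a : α) : Exec σ α := fun s => PMF.pure (some (a, s))

/-- Stop because the budget is exceeded. -/
noncomputable def timeout {α : Type} : Exec σ α := fun _ => PMF.pure none

/-- Sequential composition. -/
noncomputable def andThen {α β : Type} (m : Exec σ α) (f : α → Exec σ β) : Exec σ β :=
  fun s => (m s).bind fun o =>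
    match o with
    | none => PMF.pure none
    | some (a, t) => f a t

noncomputable instance : Monad (Exec σ) where
  pure := ret
  bind := andThen

/-- Spend `c` steps. -/
noncomputable def tick (c : ℕ) : Exec σ Unit :=
  fun s => if c ≤ s.1 then PMF.pure (some ((), s.1 - c, s.2)) else PMF.pure none

/-- The remaining budget. -/
noncomputable def budget : Exec σ ℕ := fun s => PMF.pure (some (s.1, s))

/-- A random choice. -/
noncomputable def sample {α : Type} (d : PMF α) : Exec σ α := fun s => d.map fun a => some (a, s)

/-- Send the message `v` to the environment and get its reply. -/
noncomputable def send (E : Env σ) (v : Val) : Exec σ Val :=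
  fun s => (E s.2 v).map fun r => some (r.1, s.1, r.2)

/-- `while c do p`, where `nat 0` means false, with at most `n` evaluations of the condition. -/
noncomputable def whileLoop (c p : Val → Exec σ Val) : ℕ → Val → Exec σ Val
  | 0, _ => timeout
  | n + 1, v => do
      tick (1 + v.size)
      let t ← c v
      if t = .nat 0 then pure v
      else do
        let w ← p v
        whileLoop c p n w

end Exec

namespace Prog

open Exec

/-- Execution of a program against an environment. Every node of the program that is executed costs
one step plus the sizes of the values that it reads and writes. A loop may run for as long as the
budget lasts: each evaluation of its condition costs at least one step. -/
noncomputable def run {σ : Type} (E : Env σ) : Prog → Val → Exec σ Val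
  | op f, v => do
      tick (1 + v.size + (f.eval v).size)
      pure (f.eval v)
  | comp p q, v => do
      tick (1 + v.size)
      let w ← run E p v
      run E q w
  | both p q, v => do
      tick (1 + v.size)
      let a ← run E p v
      let b ← run E q v
      pure (.pair a b)
  | ite c p q, v => do
      tick (1 + v.size)
      let t ← run E c v
      if t = .nat 0 then run E q v else run E p v
  | loop c p, v => do
      tick (1 + v.size)
      let b ← budget
      whileLoop (run E c) (run E p) b v
  | rand, .nat m => do
      tick (1 + (Val.nat m).size)
      let i ← sample (PMF.uniformOfFintype (Fin (m + 1)))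
      tick (Val.nat i).size
      pure (.nat i)
  | rand, .pair a b => do
      tick (1 + (Val.pair a b).size)
      pure (.nat 0)
  | query, v => do
      tick (1 + v.size)
      let w ← send E v
      tick w.size
      pure w

/-- The output of a program that is stopped after `T` steps (`none` if it was stopped). -/
noncomputable def output {σ : Type} (E : Env σ) (s : σ) (p : Prog) (T : ℕ) (v : Val) :
    PMF (Option Val) :=
  (p.run E v (T, s)).map fun o => o.map Prod.fst

/-- `p` maps `v` to `w` within `T` steps, with certainty and without using the environment. -/
def ComputesWithin (p : Prog) (v w : Val) (T : ℕ) : Prop :=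
  ∀ (σ : Type) (E : Env σ) (s : σ), ∃ left : ℕ,
    p.run E v (T, s) = PMF.pure (some (w, left, s))

end Prog

/-- A probabilistic polynomial-time adversary: a program together with a polynomial clock, after
which it is stopped. A program that always halts in polynomial time is not affected by a suitable
clock. -/
structure PPT : Type where
  prog : Prog
  clock : Polynomial ℕ

/-- Negligible functions of the security parameter. -/
def Negligible (f : ℕ → ℝ) : Prop :=
  Asymptotics.SuperpolynomialDecay Filter.atTop (fun κ : ℕ => (κ : ℝ)) f

/-! ## Groups -/

/-- A family of finite groups of prime order, indexed by the security parameter, each with a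
generator, an encoding of its elements as data, and a public description. -/
structure GroupFamily : Type 1 where
  G : ℕ → Type
  [commGroup : ∀ κ, CommGroup (G κ)]
  [fintype : ∀ κ, Fintype (G κ)]
  prime_card : ∀ κ, (Fintype.card (G κ)).Prime
  gen : ∀ κ, G κ
  gen_generates : ∀ κ (a : G κ), a ∈ Subgroup.zpowers (gen κ)
  enc : ∀ κ, G κ ↪ Val
  desc : ℕ → Val

namespace GroupFamily

attribute [instance] commGroup fintype

variable (𝒢 : GroupFamily) (κ : ℕ)

/-- The order of the group. -/
def q : ℕ := Fintype.card (𝒢.G κ)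

instance : Fact (𝒢.q κ).Prime := ⟨𝒢.prime_card κ⟩

/-- The exponents `ℤ_q^*`. -/
abbrev Exp : Type := (ZMod (𝒢.q κ))ˣ

/-- Keys of `3κ` bits, as numbers below `2 ^ (3κ)`. -/
abbrev Key (κ : ℕ) : Type := Fin (2 ^ (3 * κ))

/-- The power of a group element by an exponent. -/
def pow {κ : ℕ} (a : 𝒢.G κ) (x : 𝒢.Exp κ) : 𝒢.G κ := a ^ (x : ZMod (𝒢.q κ)).val

/-- The public parameters: `κ`, the group order, the generator and the description of the group. -/
def pub : Val := .pair (.nat κ) (.pair (.nat (𝒢.q κ)) (.pair (𝒢.enc κ (𝒢.gen κ)) (𝒢.desc κ)))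

open Classical in
/-- The group element encoded by a value, if there is one. -/
noncomputable def dec (v : Val) : Option (𝒢.G κ) :=
  if h : ∃ a, 𝒢.enc κ a = v then some h.choose else none

def encExp {κ : ℕ} (x : 𝒢.Exp κ) : Val := .nat (x : ZMod (𝒢.q κ)).val

def encKey {κ : ℕ} (k : Key κ) : Val := .nat k

open Classical in
/-- From the public parameters, products and membership are computable in polynomial time. -/
def Efficient : Prop :=
  (∃ (P : Prog) (t : Polynomial ℕ), ∀ κ (a b : 𝒢.G κ),
    P.ComputesWithin (.pair (𝒢.pub κ) (.pair (𝒢.enc κ a) (𝒢.enc κ b))) (𝒢.enc κ (a * b))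
      (t.eval κ)) ∧
  (∃ (P : Prog) (t : Polynomial ℕ), ∀ κ (v : Val),
    P.ComputesWithin (.pair (𝒢.pub κ) v) (if ∃ a, 𝒢.enc κ a = v then .nat 1 else .nat 0)
      (t.eval (κ + v.size)))

/-! ## The gap Diffie-Hellman assumption -/

/-- `(h, a, b, c)` is of the form `(h, h ^ m, h ^ n, h ^ (m * n))`. -/
def IsDH {κ : ℕ} (h a b c : 𝒢.G κ) : Prop := ∃ m n : ℕ, a = h ^ m ∧ b = h ^ n ∧ c = h ^ (m * n)

open Classical in
/-- The reply of the DDH oracle: `nat 1` on (encodings of) Diffie-Hellman quadruples, otherwise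
`nat 0`. -/
noncomputable def ddhReply : Val → Val
  | .pair h (.pair a (.pair b c)) =>
      match 𝒢.dec κ h, 𝒢.dec κ a, 𝒢.dec κ b, 𝒢.dec κ c with
      | some h, some a, some b, some c => if 𝒢.IsDH h a b c then .nat 1 else .nat 0
      | _, _, _, _ => .nat 0
  | _ => .nat 0

noncomputable def ddhOracle : Env Unit := fun _ v => PMF.pure (𝒢.ddhReply κ v, ())

open Classical in
/-- The CDH experiment with a DDH oracle; the outcome `true` means that the adversary found the
Diffie-Hellman element. -/
noncomputable def gdhExperiment (B : PPT) : PMF Bool := do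
  let x₁ ← PMF.uniformOfFintype (𝒢.Exp κ)
  let x₂ ← PMF.uniformOfFintype (𝒢.Exp κ)
  let X₁ := 𝒢.pow (𝒢.gen κ) x₁
  let X₂ := 𝒢.pow (𝒢.gen κ) x₂
  let out ← B.prog.output (𝒢.ddhOracle κ) () (B.clock.eval κ)
    (.pair (𝒢.pub κ) (.pair (𝒢.enc κ X₁) (𝒢.enc κ X₂)))
  pure (decide (out = some (𝒢.enc κ (𝒢.pow X₁ x₂))))

/-- The GDH assumption: every PPT adversary solves CDH given a DDH oracle with negligible
probability only. -/
def GDH : Prop :=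
  ∀ B : PPT, Negligible fun κ => (𝒢.gdhExperiment κ B true).toReal

/-! ## The Sphinx RO-KEM -/

/-- The random oracle `h_*` (the concatenation of the three key-deriving oracles). -/
abbrev HStar : Type := 𝒢.G κ → Key κ

/-- The random oracle `h_b` for blinding factors. -/
abbrev HBlind : Type := 𝒢.G κ × 𝒢.G κ → 𝒢.Exp κ

noncomputable instance : Fintype (𝒢.HStar κ) := Fintype.ofFinite _

noncomputable instance : Fintype (𝒢.HBlind κ) := Fintype.ofFinite _

/-- Key generation with the random choice `x`: public key and secret key. -/
def keyGen {κ : ℕ} (x : 𝒢.Exp κ) : 𝒢.G κ × 𝒢.Exp κ := (𝒢.pow (𝒢.gen κ) x, x)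

/-- Encapsulation with the random choice `x'`: the symmetric keys and the blinding factor, and the
encapsulation `α`. -/
def encap {κ : ℕ} (hs : 𝒢.HStar κ) (hb : 𝒢.HBlind κ) (pk : 𝒢.G κ) (x' : 𝒢.Exp κ) :
    (Key κ × 𝒢.Exp κ) × 𝒢.G κ :=
  ((hs (𝒢.pow pk x'), hb (𝒢.pow (𝒢.gen κ) x', 𝒢.pow pk x')), 𝒢.pow (𝒢.gen κ) x')

/-- Decapsulation. -/
def decap {κ : ℕ} (hs : 𝒢.HStar κ) (hb : 𝒢.HBlind κ) (sk : 𝒢.Exp κ) (α : 𝒢.G κ) :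
    Key κ × 𝒢.Exp κ :=
  (hs (𝒢.pow α sk), hb (α, 𝒢.pow α sk))

/-! ## The Sphinx-KEM-IND-CCA game -/

/-- The random choices of the challenger. -/
structure Coins where
  /-- the secret key of the honest relay -/
  x : 𝒢.Exp κ
  /-- the random oracles -/
  hs : 𝒢.HStar κ
  hb : 𝒢.HBlind κ
  /-- the secret exponent of the challenge header -/
  x' : 𝒢.Exp κ
  /-- the challenge bit: `false` is `b = 0` (real), `true` is `b = 1` (random) -/
  bit : Bool
  /-- the random keys and the random blinding factor of layer `j`, used if `b = 1` -/
  r : Key κ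
  bj : 𝒢.Exp κ

/-- The layers of a header: for the public keys of the remaining path, the index `i` of the first of
them and the exponent `e = x' * b_0 * ⋯ * b_{i-1}`, the list of all `(α_i, h_*(s_i), b_i)`. If the
challenge bit is set, the keys and the blinding factor in layer `j` are the random ones. -/
def layers {κ : ℕ} (c : 𝒢.Coins κ) (j : ℕ) :
    List (𝒢.G κ) → ℕ → 𝒢.Exp κ → List (𝒢.G κ × Key κ × 𝒢.Exp κ)
  | [], _, _ => []
  | y :: ys, i, e =>
      let t := 𝒢.encap c.hs c.hb y e
      let kb := if i = j ∧ c.bit = true then (c.r, c.bj) else t.1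
      (t.2, kb) :: layers c j ys (i + 1) (e * kb.2)

open Classical in
/-- The challenge for position `j` and the public keys `ys` of the other relays. If the keys are
valid and distinct, `j` is a position on the path of length `n = |ys| + 1` and `n < N`, the result is
`α_j` and the reply `(α_0, α_j, [(h_*(s_0), b_0), …, (h_*(s_{n-1}), b_{n-1})])`. -/
noncomputable def challenge {κ : ℕ} (N : ℕ) (c : 𝒢.Coins κ) (j : ℕ) (ys : List (𝒢.G κ)) :
    Option (𝒢.G κ × Val) :=
  if ys.Nodup ∧ (∀ y ∈ ys, y ≠ 1) ∧ j < ys.length + 1 ∧ ys.length + 1 < N then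
    let path := ys.insertIdx j (𝒢.keyGen c.x).1
    let L := 𝒢.layers c j path 0 c.x'
    match L[0]?, L[j]? with
    | some l₀, some l =>
        some (l.1, .pair (𝒢.enc κ l₀.1) (.pair (𝒢.enc κ l.1)
          (Val.ofList (L.map fun t => .pair (encKey t.2.1) (𝒢.encExp t.2.2)))))
    | _, _ => none
  else none

open Classical in
/-- The challenger's reply and new state. The state is `none` before the challenge was given and
`some α_j` afterwards. Messages are tagged: `0` for decapsulation, `1` for `h_*`, `2` for `h_b`, and
`3` for the submission of `j` and the public keys. The reply `nat 0` means that a request is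
refused: an ill-formed one, the decapsulation of `α_j` after the challenge, an invalid submission,
or a second one. -/
noncomputable def kemReply {κ : ℕ} (N : ℕ) (c : 𝒢.Coins κ) (st : Option (𝒢.G κ)) :
    Val → Val × Option (𝒢.G κ)
  | .pair (.nat 0) a =>
      match 𝒢.dec κ a with
      | some α =>
          if st = some α then (.nat 0, st)
          else
            let kb := 𝒢.decap c.hs c.hb (𝒢.keyGen c.x).2 α
            (.pair (encKey kb.1) (𝒢.encExp kb.2), st)
      | none => (.nat 0, st)
  | .pair (.nat 1) a =>
      match 𝒢.dec κ a with
      | some s => (encKey (c.hs s), st)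
      | none => (.nat 0, st)
  | .pair (.nat 2) (.pair a b) =>
      match 𝒢.dec κ a, 𝒢.dec κ b with
      | some α, some s => (𝒢.encExp (c.hb (α, s)), st)
      | _, _ => (.nat 0, st)
  | .pair (.nat 3) (.pair (.nat j) l) =>
      match st, (Val.toList l).bind (fun vs => vs.mapM (𝒢.dec κ)) with
      | none, some ys =>
          match 𝒢.challenge N c j ys with
          | some (α, v) => (v, some α)
          | none => (.nat 0, none)
      | st, _ => (.nat 0, st)
  | _ => (.nat 0, st)

noncomputable def kemChallenger {κ : ℕ} (N : ℕ) (c : 𝒢.Coins κ) : Env (Option (𝒢.G κ)) :=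
  fun st v => PMF.pure (𝒢.kemReply N c st v)

noncomputable def coins : PMF (𝒢.Coins κ) := do
  let x ← PMF.uniformOfFintype (𝒢.Exp κ)
  let hs ← PMF.uniformOfFintype (𝒢.HStar κ)
  let hb ← PMF.uniformOfFintype (𝒢.HBlind κ)
  let x' ← PMF.uniformOfFintype (𝒢.Exp κ)
  let bit ← PMF.uniformOfFintype Bool
  let r ← PMF.uniformOfFintype (Key κ)
  let bj ← PMF.uniformOfFintype (𝒢.Exp κ)
  pure ⟨x, hs, hb, x', bit, r, bj⟩

open Classical in
/-- The Sphinx-KEM-IND-CCA experiment; the outcome `true` means that the adversary's final output is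
the challenge bit. -/
noncomputable def kemExperiment (N : ℕ) (A : PPT) : PMF Bool := do
  let c ← 𝒢.coins κ
  let out ← A.prog.output (𝒢.kemChallenger N c) none (A.clock.eval κ)
    (.pair (𝒢.pub κ) (𝒢.enc κ (𝒢.keyGen c.x).1))
  pure (decide (out = some (.nat c.bit.toNat)))

/-- Sphinx-KEM-IND-CCA security of the Sphinx RO-KEM, for paths of length less than `N`: no PPT
adversary guesses the challenge bit with probability non-negligibly better than `1 / 2`. -/
def SphinxKemIndCca (N : ℕ) : Prop :=
  ∀ A : PPT, ∃ ν : ℕ → ℝ, Negligible ν ∧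
    ∀ κ, (𝒢.kemExperiment κ N A true).toReal ≤ 1 / 2 + ν κ

end GroupFamily

/-! The proof reduces to the gap Diffie-Hellman problem with a single simulator that serves for both
values of the challenge bit. Given `P = g^x₁` and `X = g^x₂`, the simulator plays the challenger
with public key `P` and challenge header `α_0 = X^ρ` for a uniform `ρ`. Implicitly `x' = x₂ ρ`, and
every `α_i` is a power of `X` with known exponent. The random oracles are sampled lazily. The
simulator cannot compute the points at which they are evaluated in a decapsulation or in the layers
of the challenge. It therefore records a point as the Diffie-Hellman element (`cdh`) of two group
elements: of `P` and `α` in a decapsulation, of `y_i` and `α_i` in a layer, of `g` and `s` if `s` is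
given explicitly. Whether two such points coincide is a question for the decision oracle
(`isDH_iff`), so all answers can be kept consistent.

The simulated challenge always uses the real keys. Given the simulator's state, the challenger's
coins have an explicit conditional distribution, and one checks message by message that it is
preserved. For `b = 0` this holds exactly (`simulator_posterior`), so the simulation is perfect. For
`b = 1` it holds as an inequality on good states (`simulator_posteriorRandom_le`): the adversary has
not asked an oracle at `s_j` after the challenge, and the points `s_i` were different from each
other and from all points logged before. On that event the oracle values at `(α_j, s_j)` can be
exchanged with an independent random pair without changing the layers (`mean_challenge_le`).
Decapsulation never reaches `s_j`, because exponentiation by the secret key is injective and `α_j`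
is refused.

Hence the probability of output 0 in the real game is at most that in the random game, plus the
probability that `s_j` is found, plus that of a coincidence. Outputs 0 and 1 in the random game have
total probability at most 1, which bounds the success probability (`kemExperiment_le`). A found
`s_j` is `cdh P (X^c)` with known `c`, and its `c`-th root solves the Diffie-Hellman problem
(`exists_gdh_adversary`). A coincidence has probability at most a polynomial divided by `q - 1`,
since until it happens each point has a fresh uniform exponent (`wp_bad_le`). Finally `1 / (q - 1)`
is negligible by the assumption itself, because the solution can be guessed with that probability
(`exists_gdh_guesser`).

The passage from single messages to whole runs is an induction over programs (`run_rel`), used for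
kernels between state spaces (`wp_run_kernel`) and for potentials (`wp_run_potential`). As
adversaries are concrete programs with a step count, the reduction must be one too: the simulator's
replies are shown to be computable in polynomial time (`PolyTime`, `PolyRand`), and the queries of a
program are replaced by a program that answers them (`Handles.simulates`). -/

open scoped ENNReal

/-! ### Expected values of computations -/

namespace Exec

variable {σ τ α β γ : Type}

/-- The expected value of a function of the result, the remaining budget and the final state
(zero if the budget is exceeded). -/
noncomputable def wp (m : Exec σ α) (T : ℕ) (s : σ) (φ : α → ℕ → σ → ℝ≥0∞) : ℝ≥0∞ :=
  ∑' o, m (T, s) o * o.elim 0 fun r => φ r.1 r.2.1 r.2.2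

theorem tsum_pure_mul (a : α) (f : α → ℝ≥0∞) : ∑' o, PMF.pure a o * f o = f a := by
  rw [tsum_eq_single a]
  · simp
  · intro b hb
    simp [PMF.pure_apply, hb]

theorem tsum_bind_mul (d : PMF α) (g : α → PMF β) (f : β → ℝ≥0∞) :
    ∑' b, d.bind g b * f b = ∑' a, d a * ∑' b, g a b * f b := by
  simp_rw [PMF.bind_apply, ← ENNReal.tsum_mul_right, ← ENNReal.tsum_mul_left]
  rw [ENNReal.tsum_comm]
  simp_rw [mul_assoc]

theorem tsum_map_mul (d : PMF α) (g : α → β) (f : β → ℝ≥0∞) :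
    ∑' b, d.map g b * f b = ∑' a, d a * f (g a) := by
  rw [← PMF.bind_pure_comp, tsum_bind_mul]
  simp_rw [Function.comp_apply, tsum_pure_mul]

theorem wp_pure (a : α) (T : ℕ) (s : σ) (φ : α → ℕ → σ → ℝ≥0∞) :
    wp (pure a : Exec σ α) T s φ = φ a T s :=
  tsum_pure_mul (α := Option (α × ℕ × σ)) _ _

theorem wp_timeout (T : ℕ) (s : σ) (φ : α → ℕ → σ → ℝ≥0∞) :
    wp (timeout : Exec σ α) T s φ = 0 :=
  tsum_pure_mul (α := Option (α × ℕ × σ)) _ _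

theorem wp_bind (m : Exec σ α) (f : α → Exec σ β) (T : ℕ) (s : σ) (φ : β → ℕ → σ → ℝ≥0∞) :
    wp (m >>= f) T s φ = wp m T s fun a l t => wp (f a) l t φ := by
  refine (tsum_bind_mul _ _ _).trans (tsum_congr fun o => ?_)
  congr 1
  rcases o with _ | ⟨a, l, t⟩
  · exact tsum_pure_mul (α := Option (β × ℕ × σ)) _ _
  · rfl

theorem wp_tick (c T : ℕ) (s : σ) (φ : Unit → ℕ → σ → ℝ≥0∞) :
    wp (tick c : Exec σ Unit) T s φ = if c ≤ T then φ () (T - c) s else 0 := by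
  unfold wp tick
  by_cases h : c ≤ T
  · simp only [h, if_true]
    exact tsum_pure_mul (α := Option (Unit × ℕ × σ)) _ _
  · simp only [h, if_false]
    exact tsum_pure_mul (α := Option (Unit × ℕ × σ)) _ _

theorem wp_budget (T : ℕ) (s : σ) (φ : ℕ → ℕ → σ → ℝ≥0∞) :
    wp (budget : Exec σ ℕ) T s φ = φ T T s :=
  tsum_pure_mul (α := Option (ℕ × ℕ × σ)) _ _

theorem wp_sample (d : PMF α) (T : ℕ) (s : σ) (φ : α → ℕ → σ → ℝ≥0∞) :
    wp (sample d : Exec σ α) T s φ = ∑' a, d a * φ a T s :=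
  tsum_map_mul _ _ _

theorem wp_send (E : Env σ) (v : Val) (T : ℕ) (s : σ) (φ : Val → ℕ → σ → ℝ≥0∞) :
    wp (send E v) T s φ = ∑' r, E s v r * φ r.1 T r.2 :=
  tsum_map_mul _ _ _

theorem wp_mono (m : Exec σ α) (T : ℕ) (s : σ) {φ ψ : α → ℕ → σ → ℝ≥0∞}
    (h : ∀ a l t, m (T, s) (some (a, l, t)) ≠ 0 → φ a l t ≤ ψ a l t) :
    wp m T s φ ≤ wp m T s ψ := by
  refine ENNReal.tsum_le_tsum fun o => ?_
  rcases o with _ | ⟨a, l, t⟩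
  · simp
  · by_cases h0 : m (T, s) (some (a, l, t)) = 0
    · simp [h0]
    · exact mul_le_mul_right (h a l t h0) _

theorem wp_mono' (m : Exec σ α) (T : ℕ) (s : σ) {φ ψ : α → ℕ → σ → ℝ≥0∞}
    (h : ∀ a l t, φ a l t ≤ ψ a l t) : wp m T s φ ≤ wp m T s ψ :=
  wp_mono m T s fun a l t _ => h a l t

theorem wp_add (m : Exec σ α) (T : ℕ) (s : σ) (φ ψ : α → ℕ → σ → ℝ≥0∞) :
    wp m T s (fun a l t => φ a l t + ψ a l t) = wp m T s φ + wp m T s ψ := by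
  unfold wp
  rw [← ENNReal.tsum_add]
  refine tsum_congr fun o => ?_
  rcases o with _ | ⟨a, l, t⟩ <;> simp [mul_add]

theorem wp_le_one (m : Exec σ α) (T : ℕ) (s : σ) {φ : α → ℕ → σ → ℝ≥0∞}
    (h : ∀ a l t, φ a l t ≤ 1) : wp m T s φ ≤ 1 := by
  refine (ENNReal.tsum_le_tsum (g := fun o => m (T, s) o) fun o => ?_).trans
    (PMF.tsum_coe _).le
  rcases o with _ | ⟨a, l, t⟩
  · simp
  · exact mul_le_of_le_one_right' (h a l t)

theorem wp_congr_post {m : Exec σ α} {T : ℕ} {s : σ} {φ ψ : α → ℕ → σ → ℝ≥0∞}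
    (h : ∀ a l t, φ a l t = ψ a l t) : wp m T s φ = wp m T s ψ := by
  have : φ = ψ := by
    funext a l t
    exact h a l t
  rw [this]

theorem bind_assoc' (m : Exec σ α) (f : α → Exec σ β) (g : β → Exec σ γ) :
    (m >>= f) >>= g = m >>= fun a => f a >>= g := by
  funext s
  refine (PMF.bind_bind _ _ _).trans ?_
  refine congrArg (PMF.bind (m s)) (funext fun o => ?_)
  rcases o with _ | ⟨a, l, t⟩
  · exact PMF.pure_bind _ _
  · rfl

end Exec

/-! ### Induction over programs: kernels, potentials and budgets -/

namespace Prog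

open Exec

variable {σ τ : Type}

/-- A relation between computations with two kinds of environment that is preserved by all the
constructs of programs holds between the executions of a program. -/
theorem run_rel (R : ∀ {α : Type}, Exec σ α → Exec τ α → Prop) (E : Env σ) (F : Env τ)
    (h_pure : ∀ {α : Type} (a : α), R (pure a) (pure a))
    (h_timeout : ∀ {α : Type}, R (timeout : Exec σ α) timeout)
    (h_bind : ∀ {α β : Type} {m : Exec σ α} {n : Exec τ α} {f : α → Exec σ β}
      {g : α → Exec τ β}, R m n → (∀ a, R (f a) (g a)) → R (m >>= f) (n >>= g))
    (h_tick : ∀ c, R (tick c) (tick c)) (h_budget : R budget budget)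
    (h_sample : ∀ {α : Type} (d : PMF α), R (sample d) (sample d))
    (h_query : ∀ v : Val, R (tick (1 + v.size) >>= fun _ => send E v)
      (tick (1 + v.size) >>= fun _ => send F v)) (p : Prog) :
    ∀ v, R (p.run E v) (p.run F v) := by
  induction p with
  | op f => exact fun v => h_bind (h_tick _) fun _ => h_pure _
  | comp p q hp hq =>
    exact fun v => h_bind (h_tick _) fun _ => h_bind (hp v) fun w => hq w
  | both p q hp hq =>
    exact fun v => h_bind (h_tick _) fun _ => h_bind (hp v) fun a => h_bind (hq v) fun b =>
      h_pure _
  | ite c p q hc hp hq =>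
    intro v
    refine h_bind (h_tick _) fun _ => h_bind (hc v) fun t => ?_
    by_cases ht : t = .nat 0
    · simpa only [ht, if_true] using hq v
    · simpa only [ht, if_false] using hp v
  | loop c p hc hp =>
    intro v
    refine h_bind (h_tick _) fun _ => h_bind h_budget fun b => ?_
    -- The number of rounds allowed is the budget on entry, by now an ordinary parameter.
    induction b generalizing v with
    | zero => exact h_timeout
    | succ b ih =>
      refine h_bind (h_tick _) fun _ => h_bind (hc v) fun t => ?_
      by_cases ht : t = .nat 0
      · simpa only [ht, if_true] using h_pure v
      · simpa only [ht, if_false] using h_bind (hp v) fun w => ih w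
  | rand =>
    intro v
    cases v with
    | nat m =>
      exact h_bind (h_tick _) fun _ => h_bind (h_sample _) fun i =>
        h_bind (h_tick _) fun _ => h_pure _
    | pair a b => exact h_bind (h_tick _) fun _ => h_pure _
  | query =>
    intro v
    -- The first charge forms a unit with the message, so that a relation may use that every message
    -- costs at least one step; associativity restores the order in `run`.
    have := h_bind (h_query v) fun w => h_bind (h_tick w.size) fun _ => h_pure w
    rw [bind_assoc', bind_assoc'] at this
    exact this

/-- Transfer along a kernel `W` from the states of the environment `F` to those of `E`. -/
theorem wp_run_kernel (R : ℝ≥0∞ → ℝ≥0∞ → Prop) (R_refl : ∀ a, R a a)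
    (R_trans : ∀ {a b c}, R a b → R b c → R a c)
    (R_sum : ∀ {ι : Type} {w f g : ι → ℝ≥0∞}, (∀ i, R (f i) (g i)) →
      R (∑' i, w i * f i) (∑' i, w i * g i))
    (E : Env σ) (F : Env τ) (W : τ → σ → ℝ≥0∞)
    (h : ∀ (t : τ) (v : Val) (ψ : Val → σ → ℝ≥0∞),
      R (∑' x, F t v x * ∑' s, W x.2 s * ψ x.1 s) (∑' s, W t s * ∑' x, E s v x * ψ x.1 x.2))
    (p : Prog) (v : Val) (T : ℕ) (t : τ) (ψ : Val → ℕ → σ → ℝ≥0∞) :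
    R (wp (p.run F v) T t fun a l t' => ∑' s, W t' s * ψ a l s)
      (∑' s, W t s * wp (p.run E v) T s ψ) := by
  have R_wp : ∀ {α : Type} (m : Exec τ α) (T : ℕ) (t : τ) {φ ψ : α → ℕ → τ → ℝ≥0∞},
      (∀ a l t, R (φ a l t) (ψ a l t)) → R (wp m T t φ) (wp m T t ψ) := by
    intro α m T t φ ψ h
    refine R_sum fun o => ?_
    rcases o with _ | ⟨a, l, t⟩
    · exact R_refl _
    · exact h a l t
  refine run_rel (fun {α} m n => ∀ T t (ψ : α → ℕ → σ → ℝ≥0∞),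
    R (wp n T t fun a l t' => ∑' s, W t' s * ψ a l s) (∑' s, W t s * wp m T s ψ)) E F
    ?_ ?_ ?_ ?_ ?_ ?_ ?_ p v T t ψ
  · intro α a T t ψ
    simp only [wp_pure]
    exact R_refl _
  · intro α T t ψ
    simp only [wp_timeout, mul_zero, tsum_zero]
    exact R_refl _
  · intro α β m n f g hm hf T t ψ
    simp only [wp_bind]
    exact R_trans (R_wp _ _ _ fun a l t' => hf a l t' ψ) (hm T t _)
  · intro c T t ψ
    simp only [wp_tick]
    by_cases hc : c ≤ T
    · simp only [hc, if_true]
      exact R_refl _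
    · simp only [hc, if_false, mul_zero, tsum_zero]
      exact R_refl _
  · intro T t ψ
    simp only [wp_budget]
    exact R_refl _
  · intro α d T t ψ
    simp only [wp_sample, ← ENNReal.tsum_mul_left]
    rw [ENNReal.tsum_comm]
    simp only [mul_left_comm]
    exact R_refl _
  · intro v T t ψ
    simp only [wp_bind, wp_tick]
    by_cases hc : 1 + v.size ≤ T
    · simp only [hc, if_true, wp_send]
      exact h t v fun a s => ψ a (T - (1 + v.size)) s
    · simp only [hc, if_false, mul_zero, tsum_zero]
      exact R_refl _

/-- With an inequality the kernel may lose mass from one message to the next. In this way runs that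
leave the good states are discarded. -/
theorem wp_run_kernel_le (E : Env σ) (F : Env τ) (W : τ → σ → ℝ≥0∞)
    (h : ∀ (t : τ) (v : Val) (ψ : Val → σ → ℝ≥0∞),
      ∑' x, F t v x * ∑' s, W x.2 s * ψ x.1 s ≤ ∑' s, W t s * ∑' x, E s v x * ψ x.1 x.2)
    (p : Prog) (v : Val) (T : ℕ) (t : τ) (ψ : Val → ℕ → σ → ℝ≥0∞) :
    (wp (p.run F v) T t fun a l t' => ∑' s, W t' s * ψ a l s) ≤
      ∑' s, W t s * wp (p.run E v) T s ψ :=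
  wp_run_kernel (· ≤ ·) (fun _ => le_rfl) le_trans
    (fun h => ENNReal.tsum_le_tsum fun i => mul_le_mul_right (h i) _) E F W h p v T t ψ

theorem wp_run_kernel_eq (E : Env σ) (F : Env τ) (W : τ → σ → ℝ≥0∞)
    (h : ∀ (t : τ) (v : Val) (ψ : Val → σ → ℝ≥0∞),
      ∑' x, F t v x * ∑' s, W x.2 s * ψ x.1 s = ∑' s, W t s * ∑' x, E s v x * ψ x.1 x.2)
    (p : Prog) (v : Val) (T : ℕ) (t : τ) (ψ : Val → ℕ → σ → ℝ≥0∞) :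
    (wp (p.run F v) T t fun a l t' => ∑' s, W t' s * ψ a l s) =
      ∑' s, W t s * wp (p.run E v) T s ψ :=
  wp_run_kernel (· = ·) (fun _ => rfl) Eq.trans
    (fun h => tsum_congr fun i => by rw [h i]) E F W h p v T t ψ

/-- A potential that does not increase on average with any message bounds its expected final
value. -/
theorem wp_run_potential (E : Env σ) (f : ℕ → σ → ℝ≥0∞) (hf : ∀ s, Monotone fun l => f l s)
    (h : ∀ s v l, ∑' x, E s v x * f l x.2 ≤ f (l + 1) s) (p : Prog) (v : Val) (T : ℕ) (s : σ) :
    wp (p.run E v) T s (fun _ l t => f l t) ≤ f T s := by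
  refine run_rel (fun {α} m _ => ∀ T s, wp m T s (fun _ l t => f l t) ≤ f T s) E E
    ?_ ?_ ?_ ?_ ?_ ?_ ?_ p v T s
  · intro α a T s
    rw [wp_pure]
  · intro α T s
    rw [wp_timeout]
    exact zero_le
  · intro α β m n g _ hm hg T s
    rw [wp_bind]
    exact (wp_mono' _ _ _ fun a l t => hg a l t).trans (hm T s)
  · intro c T s
    rw [wp_tick]
    split_ifs
    · exact hf s (Nat.sub_le _ _)
    · exact zero_le
  · intro T s
    rw [wp_budget]
  · intro α d T s
    rw [wp_sample, ENNReal.tsum_mul_right, PMF.tsum_coe, one_mul]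
  · intro v T s
    rw [wp_bind, wp_tick]
    split_ifs with hc
    · rw [wp_send]
      -- A message costs `1 + v.size ≥ 1` steps, which accounts for the `l + 1` in the hypothesis.
      refine (h s v _).trans (hf s ?_)
      omega
    · exact zero_le

/-- Properties of the results that occur with positive probability, expressed with `wp`. -/
theorem wp_eq_zero_iff {α : Type} (m : Exec σ α) (T : ℕ) (s : σ) (φ : α → ℕ → σ → ℝ≥0∞) :
    wp m T s φ = 0 ↔ ∀ a l t, m (T, s) (some (a, l, t)) ≠ 0 → φ a l t = 0 := by
  unfold wp
  rw [ENNReal.tsum_eq_zero]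
  constructor
  · intro h a l t hm
    exact (mul_eq_zero.1 (h (some (a, l, t)))).resolve_left hm
  · intro h o
    rcases o with _ | ⟨a, l, t⟩
    · simp
    · by_cases hm : m (T, s) (some (a, l, t)) = 0
      · simp [hm]
      · simp [h a l t hm]

/-- The budget pays for the size of the result. -/
theorem run_size (E : Env σ) (p : Prog) : ∀ (v : Val) (T : ℕ) (s : σ),
    wp (p.run E v) T s (fun w l _ => if l + w.size ≤ T then 0 else 1) = 0 := by
  have step : ∀ {α : Type} (m : Exec σ α) (T : ℕ) (s : σ) (φ ψ : α → ℕ → σ → ℝ≥0∞),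
      wp m T s φ = 0 → (∀ a l t, φ a l t = 0 → ψ a l t = 0) → wp m T s ψ = 0 := by
    intro α m T s φ ψ h h'
    rw [wp_eq_zero_iff] at h ⊢
    exact fun a l t hm => h' a l t (h a l t hm)
  have ite0 : ∀ {P : Prop} [Decidable P], (if P then (0 : ℝ≥0∞) else 1) = 0 → P := by
    intro P _ h
    by_contra hP
    simp [hP] at h
  have weaken : ∀ {m : Exec σ Val} {T T' : ℕ} {s : σ}, T ≤ T' →
      wp m T s (fun w l _ => if l + w.size ≤ T then 0 else 1) = 0 →
      wp m T s (fun w l _ => if l + w.size ≤ T' then 0 else 1) = 0 := by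
    intro m T T' s hT h
    exact step _ _ _ _ _ h fun a l t h0 => if_pos ((ite0 h0).trans hT)
  induction p with
  | op f =>
    intro v T s
    simp only [run, wp_bind, wp_tick, wp_pure]
    split_ifs <;> first | rfl | omega
  | comp p q hp hq =>
    intro v T s
    simp only [run, wp_bind, wp_tick]
    split_ifs with h
    · exact step _ _ _ _ _ (hp v _ s) fun a l t h0 => weaken (by have := ite0 h0; omega) (hq a l t)
    · rfl
  | both p q hp hq =>
    intro v T s
    simp only [run, wp_bind, wp_tick, wp_pure]
    split_ifs with h
    · refine step _ _ _ _ _ (hp v _ s) fun a l t h0 => ?_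
      refine step _ _ _ _ _ (hq v l t) fun b l' t' h1 => if_pos ?_
      have := ite0 h0
      have := ite0 h1
      simp only [Val.size]
      omega
    · rfl
  | ite c p q hc hp hq =>
    intro v T s
    simp only [run, wp_bind, wp_tick]
    split_ifs with h
    · refine step _ _ _ _ _ (hc v _ s) fun a l t h0 => ?_
      have := ite0 h0
      split_ifs
      · exact weaken (by omega) (hq v l t)
      · exact weaken (by omega) (hp v l t)
    · rfl
  | loop c p hc hp =>
    intro v T s
    simp only [run, wp_bind, wp_tick, wp_budget]
    split_ifs with h
    · refine weaken (Nat.sub_le _ _) ?_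
      generalize T - (1 + v.size) = U
      suffices H : ∀ b U v s, wp (whileLoop (run E c) (run E p) b v) U s
          (fun w l _ => if l + w.size ≤ U then 0 else 1) = 0 from H _ _ _ _
      intro b
      induction b with
      | zero => exact fun U v s => wp_timeout _ _ _
      | succ b ih =>
        intro U v s
        simp only [whileLoop, wp_bind, wp_tick]
        split_ifs with h
        · refine step _ _ _ _ _ (hc v _ s) fun a l t h0 => ?_
          have := ite0 h0
          split_ifs
          · rw [wp_pure]
            exact if_pos (by omega)
          · rw [wp_bind]
            exact step _ _ _ _ _ (hp v l t) fun w l' t' h1 =>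
              weaken (by have := ite0 h1; omega) (ih l' w t')
        · rfl
    · rfl
  | rand =>
    intro v T s
    cases v with
    | nat m =>
      simp only [run, wp_bind, wp_tick, wp_pure, wp_sample]
      split_ifs with h
      · refine ENNReal.tsum_eq_zero.2 fun i => mul_eq_zero_of_right _ ?_
        split_ifs <;> first | rfl | omega
      · rfl
    | pair a b =>
      simp only [run, wp_bind, wp_tick, wp_pure]
      split_ifs with h h'
      · rfl
      · simp [Val.size] at h h'
        omega
      · rfl
  | query =>
    intro v T s
    simp only [run, wp_bind, wp_tick, wp_pure, wp_send]
    split_ifs with h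
    · refine ENNReal.tsum_eq_zero.2 fun i => mul_eq_zero_of_right _ ?_
      split_ifs <;> first | rfl | omega
    · rfl

theorem run_size_le (E : Env σ) (p : Prog) (v : Val) (T : ℕ) (s : σ) (w : Val) (l : ℕ) (t : σ)
    (h : p.run E v (T, s) (some (w, l, t)) ≠ 0) : l + w.size ≤ T := by
  by_contra hc
  simpa [hc] using (wp_eq_zero_iff _ _ _ _).1 (run_size E p v T s) w l t h

/-- A larger budget preserves all runs. -/
theorem run_mono (E : Env σ) (k : ℕ) (p : Prog) :
    ∀ (v : Val) (T : ℕ) (s : σ) (φ : Val → ℕ → σ → ℝ≥0∞),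
    wp (p.run E v) T s (fun a l t => φ a (l + k) t) ≤ wp (p.run E v) (T + k) s φ := by
  let R {α : Type} (m n : Exec σ α) : Prop := ∀ (T : ℕ) (s : σ) (φ : α → ℕ → σ → ℝ≥0∞),
    wp m T s (fun a l t => φ a (l + k) t) ≤ wp n (T + k) s φ
  have h_pure : ∀ {α : Type} (a : α), R (pure a) (pure a) := by
    intro α a T s φ
    simp only [wp_pure, le_refl]
  have h_bind : ∀ {α β : Type} {m n : Exec σ α} {f g : α → Exec σ β},
      R m n → (∀ a, R (f a) (g a)) → R (m >>= f) (n >>= g) := by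
    intro α β m n f g hm hf T s φ
    simp only [wp_bind]
    exact (wp_mono' _ _ _ fun a l t => hf a l t φ).trans
      (hm T s fun a l t => wp (g a) l t φ)
  have h_tick : ∀ c, R (tick c) (tick c) := by
    intro c T s φ
    simp only [wp_tick]
    split_ifs with h1 h2
    · rw [Nat.sub_add_comm h1]
    · omega
    · exact zero_le
    · exact zero_le
  have h_sample : ∀ {α : Type} (d : PMF α), R (sample d) (sample d) := by
    intro α d T s φ
    simp only [wp_sample, le_refl]
  have h_send : ∀ v, R (send E v) (send E v) := by
    intro v T s φ
    simp only [wp_send, le_refl]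
  suffices H : ∀ v, R (p.run E v) (p.run E v) from H
  induction p with
  | op f => exact fun v => h_bind (h_tick _) fun _ => h_pure _
  | comp p q hp hq =>
    exact fun v => h_bind (h_tick _) fun _ => h_bind (hp v) fun w => hq w
  | both p q hp hq =>
    exact fun v => h_bind (h_tick _) fun _ => h_bind (hp v) fun a => h_bind (hq v) fun b =>
      h_pure _
  | ite c p q hc hp hq =>
    intro v
    refine h_bind (h_tick _) fun _ => h_bind (hc v) fun t => ?_
    by_cases ht : t = .nat 0
    · simpa only [ht, if_true] using hq v
    · simpa only [ht, if_false] using hp v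
  | loop c p hc hp =>
    -- A larger budget also gives the loop more fuel, so the fuel has to vary as well.
    have hw : ∀ b b' v, b ≤ b' → R (whileLoop (run E c) (run E p) b v)
        (whileLoop (run E c) (run E p) b' v) := by
      intro b
      induction b with
      | zero =>
        intro b' v _ T s φ
        simp only [whileLoop, wp_timeout]
        exact zero_le
      | succ b ih =>
        intro b' v hb
        obtain ⟨b', rfl⟩ : ∃ c, b' = c + 1 := ⟨b' - 1, by omega⟩
        refine h_bind (h_tick _) fun _ => h_bind (hc v) fun t => ?_
        by_cases ht : t = .nat 0
        · simpa only [ht, if_true] using h_pure v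
        · simpa only [ht, if_false] using h_bind (hp v) fun w => ih b' w (by omega)
    intro v
    refine h_bind (h_tick _) fun _ => ?_
    intro T s φ
    simp only [wp_bind, wp_budget]
    exact hw T (T + k) v (Nat.le_add_right _ _) T s φ
  | rand =>
    intro v
    cases v with
    | nat m =>
      exact h_bind (h_tick _) fun _ => h_bind (h_sample _) fun i =>
        h_bind (h_tick _) fun _ => h_pure _
    | pair a b => exact h_bind (h_tick _) fun _ => h_pure _
  | query =>
    intro v
    exact h_bind (h_tick _) fun _ => h_bind (h_send v) fun w => h_bind (h_tick w.size) fun _ =>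
      h_pure w

theorem wp_run_monotone (E : Env σ) (p : Prog) (v : Val) (s : σ) {φ : Val → ℕ → σ → ℝ≥0∞}
    (hφ : ∀ a t, Monotone fun l => φ a l t) : Monotone fun T => wp (p.run E v) T s φ := by
  intro T T' h
  obtain ⟨k, rfl⟩ := Nat.exists_eq_add_of_le h
  exact (wp_mono' _ _ _ fun a l t => hφ a t (Nat.le_add_right l k)).trans
    (run_mono E k p v T s φ)

theorem output_apply (E : Env σ) (s : σ) (p : Prog) (T : ℕ) (v w : Val) [DecidableEq Val] :
    p.output E s T v (some w) = wp (p.run E v) T s fun a _ _ => if a = w then 1 else 0 := by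
  have h := tsum_map_mul (p.run E v (T, s)) (fun o => o.map Prod.fst)
    (fun o => if o = some w then (1 : ℝ≥0∞) else 0)
  have h2 : ∑' b, (p.output E s T v) b * (if b = some w then (1 : ℝ≥0∞) else 0) =
      p.output E s T v (some w) := by
    rw [tsum_eq_single (some w)]
    · simp
    · intro b hb
      simp [hb]
  rw [← h2]
  refine h.trans (tsum_congr fun o => ?_)
  rcases o with _ | ⟨a, l, t⟩
  · simp
  · simp

end Prog


/-! ### Deterministic computations with a cost bound -/

open scoped ENNReal

namespace Prog

open Exec

variable {σ : Type}

/-- With `C` steps the program turns `v` into `w`, leaving the state of the environment as it is;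
the bound also covers the size of the result. -/
def Runs (E : Env σ) (s : σ) (p : Prog) (v w : Val) (C : ℕ) : Prop :=
  w.size ≤ C ∧ ∀ φ : Val → ℕ → σ → ℝ≥0∞, (∀ a t, Monotone fun l => φ a l t) →
    ∀ n, φ w n s ≤ wp (p.run E v) (n + C) s φ

namespace Runs

variable {E : Env σ} {s : σ} {p q c : Prog} {v w x : Val} {C D : ℕ}

theorem mono (h : Runs E s p v w C) (hC : C ≤ D) : Runs E s p v w D := by
  refine ⟨h.1.trans hC, fun φ hφ n => ?_⟩
  refine (h.2 φ hφ n).trans (wp_run_monotone E p v s hφ ?_)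
  omega

theorem op (f : Op) : Runs E s (.op f) v (f.eval v) (1 + v.size + (f.eval v).size) := by
  refine ⟨by omega, fun φ _ n => ?_⟩
  simp only [run, wp_bind, wp_tick, wp_pure]
  rw [if_pos (by omega), Nat.add_sub_cancel]

theorem comp (hp : Runs E s p v w C) (hq : Runs E s q w x D) :
    Runs E s (.comp p q) v x (1 + v.size + C + D) := by
  refine ⟨hq.1.trans (by omega), fun φ hφ n => ?_⟩
  simp only [run, wp_bind, wp_tick]
  rw [if_pos (by omega)]
  refine (hq.2 φ hφ n).trans ?_
  refine (hp.2 (fun a l t => wp (q.run E a) l t φ)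
    (fun a t => wp_run_monotone E q a t hφ) (n + D)).trans (le_of_eq ?_)
  congr 1
  omega

theorem both (hp : Runs E s p v w C) (hq : Runs E s q v x D) :
    Runs E s (.both p q) v (.pair w x) (1 + v.size + C + D) := by
  refine ⟨?_, fun φ hφ n => ?_⟩
  · have := hp.1
    have := hq.1
    have : 1 ≤ v.size := by cases v <;> simp only [Val.size] <;> omega
    simp only [Val.size]
    omega
  simp only [run, wp_bind, wp_tick, wp_pure]
  rw [if_pos (by omega)]
  refine (hq.2 (fun b l t => φ (.pair w b) l t) (fun a t => hφ _ t) n).trans ?_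
  refine (hp.2 (fun a l t => wp (q.run E v) l t fun b l t => φ (.pair a b) l t)
    (fun a t => wp_run_monotone E q v t fun b t => hφ _ t) (n + D)).trans (le_of_eq ?_)
  congr 1
  omega

theorem ite_true (hc : Runs E s c v w C) (hw : w ≠ .nat 0) (hp : Runs E s p v x D) :
    Runs E s (.ite c p q) v x (1 + v.size + C + D) := by
  refine ⟨hp.1.trans (by omega), fun φ hφ n => ?_⟩
  simp only [run, wp_bind, wp_tick]
  rw [if_pos (by omega)]
  refine (hp.2 φ hφ n).trans ?_
  have h := hc.2 (fun a l t => wp (if a = .nat 0 then q.run E v else p.run E v) l t φ)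
    (fun a t => ?_) (n + D)
  · rw [if_neg hw] at h
    refine h.trans (le_of_eq ?_)
    congr 1
    omega
  · split_ifs
    · exact wp_run_monotone E q v t hφ
    · exact wp_run_monotone E p v t hφ

theorem ite_false (hc : Runs E s c v (.nat 0) C) (hq : Runs E s q v x D) :
    Runs E s (.ite c p q) v x (1 + v.size + C + D) := by
  refine ⟨hq.1.trans (by omega), fun φ hφ n => ?_⟩
  simp only [run, wp_bind, wp_tick]
  rw [if_pos (by omega)]
  refine (hq.2 φ hφ n).trans ?_
  have h := hc.2 (fun a l t => wp (if a = .nat 0 then q.run E v else p.run E v) l t φ)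
    (fun a t => ?_) (n + D)
  · rw [if_pos rfl] at h
    refine h.trans (le_of_eq ?_)
    congr 1
    omega
  · split_ifs
    · exact wp_run_monotone E q v t hφ
    · exact wp_run_monotone E p v t hφ

theorem query (h : E s v = PMF.pure (w, s)) : Runs E s .query v w (1 + v.size + w.size) := by
  refine ⟨by omega, fun φ _ n => ?_⟩
  simp only [run, wp_bind, wp_tick, wp_pure, wp_send]
  rw [if_pos (by omega), h, tsum_pure_mul (α := Val × σ), if_pos (by dsimp only; omega)]
  refine le_of_eq ?_
  congr 1
  dsimp only
  omega

/-- The value `y k` is the loop variable after `k` rounds, and `D` bounds its size and the costs of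
condition and body. A round therefore costs at most `1 + 3 * D`. The condition is evaluated `m + 1`
times, and one more such term pays for entering the loop. -/
theorem loop {y : ℕ → Val} {m : ℕ} (hs : ∀ k ≤ m, (y k).size ≤ D)
    (hc : ∀ k < m, ∃ t, t ≠ .nat 0 ∧ Runs E s c (y k) t D) (hc0 : Runs E s c (y m) (.nat 0) D)
    (hp : ∀ k < m, Runs E s p (y k) (y (k + 1)) D) :
    Runs E s (.loop c p) (y 0) (y m) ((m + 2) * (1 + 3 * D)) := by
  refine ⟨(hs m le_rfl).trans (by nlinarith), fun φ hφ n => ?_⟩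
  have hmono : ∀ (b : ℕ) (a : Val) (t : σ),
      Monotone fun l => wp (whileLoop (c.run E) (p.run E) b a) l t φ := by
    intro b
    induction b with
    | zero =>
      intro a t l l' _
      simp only [whileLoop, wp_timeout, le_refl]
    | succ b ih =>
      intro a t l l' hl
      simp only [whileLoop, wp_bind, wp_tick]
      split_ifs with h1 h2
      · refine wp_run_monotone E c a t (fun x t' => ?_) (Nat.sub_le_sub_right hl _)
        split_ifs
        · simpa only [wp_pure] using hφ _ _
        · simp only [wp_bind]
          exact wp_run_monotone E p a t' fun x t' => ih x t'
      · omega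
      · exact zero_le
      · exact zero_le
  have key : ∀ d k, k + d = m → ∀ b, d + 1 ≤ b →
      φ (y m) n s ≤ wp (whileLoop (c.run E) (p.run E) b (y k)) (n + (d + 1) * (1 + 3 * D)) s φ := by
    intro d
    induction d with
    | zero =>
      intro k hk b hb
      obtain rfl : k = m := by omega
      obtain ⟨b, rfl⟩ : ∃ e, b = e + 1 := ⟨b - 1, by omega⟩
      have := hs k le_rfl
      simp only [whileLoop, wp_bind, wp_tick]
      rw [if_pos (by omega)]
      have h := hc0.2 (fun a l t => wp (if a = .nat 0 then (pure (y k) : Exec σ Val) else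
        p.run E (y k) >>= fun w => whileLoop (c.run E) (p.run E) b w) l t φ) (fun a t => ?_)
        (n + (0 + 1) * (1 + 3 * D) - (1 + (y k).size) - D)
      · rw [if_pos rfl, wp_pure] at h
        refine (hφ _ _ ?_).trans (h.trans (le_of_eq ?_))
        · omega
        · congr 1
          omega
      · split_ifs
        · simpa only [wp_pure] using hφ _ _
        · simp only [wp_bind]
          exact wp_run_monotone E p _ t fun x t' => hmono b x t'
    | succ d ih =>
      intro k hk b hb
      obtain ⟨b, rfl⟩ : ∃ e, b = e + 1 := ⟨b - 1, by omega⟩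
      have h1 := hs k (by omega)
      obtain ⟨t, ht, hct⟩ := hc k (by omega)
      have e : (d + 1 + 1) * (1 + 3 * D) = (d + 1) * (1 + 3 * D) + (1 + 3 * D) := by ring
      simp only [whileLoop, wp_bind, wp_tick]
      rw [if_pos (by omega)]
      have h := hct.2 (fun a l t => wp (if a = .nat 0 then (pure (y k) : Exec σ Val) else
        p.run E (y k) >>= fun w => whileLoop (c.run E) (p.run E) b w) l t φ) (fun a t => ?_)
        (n + (d + 1 + 1) * (1 + 3 * D) - (1 + (y k).size) - D)
      · rw [if_neg ht, wp_bind] at h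
        have h2 := (hp k (by omega)).2 (fun a l t => wp (whileLoop (c.run E) (p.run E) b a) l t φ)
          (fun a t => hmono b a t) (n + (d + 1) * (1 + 3 * D))
        refine (ih (k + 1) (by omega) b (by omega)).trans (h2.trans ?_)
        refine (wp_run_monotone E p (y k) s (fun a t => hmono b a t) ?_).trans
          (h.trans (le_of_eq ?_))
        · omega
        · congr 1
          omega
      · split_ifs
        · simpa only [wp_pure] using hφ _ _
        · simp only [wp_bind]
          exact wp_run_monotone E p _ t fun x t' => hmono b x t'
  have h0 := hs 0 (Nat.zero_le _)
  have e : (m + 2) * (1 + 3 * D) = (m + 1) * (1 + 3 * D) + (1 + 3 * D) := by ring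
  have e' : m + 1 ≤ (m + 1) * (1 + 3 * D) := Nat.le_mul_of_pos_right _ (by omega)
  simp only [run, wp_bind, wp_tick, wp_budget]
  rw [if_pos (by omega)]
  -- The fuel is the budget left on entry; by `e'` it suffices for the `m + 1` evaluations of the
  -- condition.
  refine (key m 0 (by omega) (n + (m + 2) * (1 + 3 * D) - (1 + (y 0).size)) (by omega)).trans
    (hmono _ _ _ ?_)
  omega

/-- The bound on `v.size` holds because every program first pays for reading its input and would
otherwise time out. Size bounds for the encodings of a group will be extracted from this. -/
theorem of_computesWithin (h : p.ComputesWithin v w C) :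
    Runs E s p v w C ∧ v.size ≤ C := by
  obtain ⟨l, hl⟩ := h σ E s
  have hwp : ∀ φ : Val → ℕ → σ → ℝ≥0∞, wp (p.run E v) C s φ = φ w l s := by
    intro φ
    unfold wp
    rw [hl, tsum_pure_mul (α := Option (Val × ℕ × σ))]
    rfl
  have hne : p.run E v (C, s) (some (w, l, s)) ≠ 0 := by
    rw [hl]
    simp
  refine ⟨⟨(Nat.le_add_left _ _).trans (run_size_le E p v C s w l s hne), fun φ hφ n => ?_⟩, ?_⟩
  · have h1 := run_mono E n p v C s φ
    rw [hwp] at h1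
    rw [add_comm n C]
    exact (hφ _ _ (Nat.le_add_left _ _)).trans h1
  · by_contra hc
    have h1 := hwp fun _ _ _ => 1
    have h0 : wp (p.run E v) C s (fun _ _ _ => 1) = 0 := by
      cases p with
      | rand => cases v <;> simp only [run, wp_bind, wp_tick] <;> exact if_neg (by omega)
      | _ => simp only [run, wp_bind, wp_tick]; exact if_neg (by omega)
    simp [h0] at h1

end Runs

end Prog

/-! ### Polynomial-time computability of families of data -/

theorem Polynomial.eval_nat_mono (t : Polynomial ℕ) : Monotone fun n => t.eval n := by
  intro a b h
  simp only [Polynomial.eval_eq_sum_range]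
  exact Finset.sum_le_sum fun i _ => Nat.mul_le_mul_left _ (Nat.pow_le_pow_left h _)

theorem Val.one_le_size (v : Val) : 1 ≤ v.size := by
  cases v <;> simp only [Val.size] <;> omega

/-- Even a product has at most as many bits as its two factors together, and both are part of the
input. So one operation adds at most a constant to the size; only iteration can make values large.
-/
theorem Op.exists_size_eval_le (f : Op) : ∃ K, ∀ v, (f.eval v).size ≤ v.size + K := by
  have h1 : Nat.size 1 = 1 := Nat.size_one
  have h0 : Nat.size 0 = 0 := Nat.size_zero
  have hadd : ∀ m n, Nat.size (m + n) ≤ Nat.size m + Nat.size n + 1 := by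
    intro m n
    rw [Nat.size_le]
    have hm := Nat.lt_size_self m
    have hn := Nat.lt_size_self n
    have h1 : 2 ^ m.size ≤ 2 ^ (m.size + n.size) := Nat.pow_le_pow_right (by norm_num) (by omega)
    have h2 : 2 ^ n.size ≤ 2 ^ (m.size + n.size) := Nat.pow_le_pow_right (by norm_num) (by omega)
    rw [pow_succ]
    omega
  have hmul : ∀ m n, Nat.size (m * n) ≤ Nat.size m + Nat.size n := by
    intro m n
    rw [Nat.size_le, pow_add]
    exact Nat.mul_lt_mul'' (Nat.lt_size_self m) (Nat.lt_size_self n)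
  have hsub : ∀ m n, Nat.size (m - n) ≤ Nat.size m := fun m n => Nat.size_le_size (Nat.sub_le _ _)
  have hdiv : ∀ m n, Nat.size (m / n) ≤ Nat.size m :=
    fun m n => Nat.size_le_size (Nat.div_le_self _ _)
  have hmod : ∀ m n, Nat.size (m % n) ≤ Nat.size m :=
    fun m n => Nat.size_le_size (Nat.mod_le _ _)
  cases f with
  | const c => exact ⟨c.size, fun v => by simp [Op.eval]⟩
  | _ =>
    refine ⟨2, fun v => ?_⟩
    rcases v with k | ⟨_ | ⟨a, a'⟩, _ | ⟨b, b'⟩⟩ <;> simp only [Op.eval] <;>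
      try split_ifs
    all_goals simp only [Val.size]
    all_goals try omega
    all_goals rename_i m n
    all_goals
      have := hadd m n
      have := hmul m n
      have := hsub m n
      have := hdiv m n
      have := hmod m n
      omega

/-- The truth value of a proposition as data. -/
noncomputable def Val.ofProp (p : Prop) : Val := open Classical in if p then .nat 1 else .nat 0

theorem Val.ofProp_true {p : Prop} (h : p) : Val.ofProp p = .nat 1 := if_pos h

theorem Val.ofProp_false {p : Prop} (h : ¬p) : Val.ofProp p = .nat 0 := if_neg h

namespace GroupFamily

open Prog Val

variable {𝒢 : GroupFamily} {ι ι' : Type} {κ : ι → ℕ}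

/-- The data `g i` can be computed from the data `f i` in polynomial time with a Diffie-Hellman
oracle. -/
def PolyTime (𝒢 : GroupFamily) (κ : ι → ℕ) (f g : ι → Val) : Prop :=
  ∃ (P : Prog) (t : Polynomial ℕ), ∀ i,
    Runs (𝒢.ddhOracle (κ i)) () P (f i) (g i) (t.eval (κ i + (f i).size))

namespace PolyTime

variable {f g h : ι → Val}

theorem intro_le (P : Prog) (t : Polynomial ℕ)
    (H : ∀ i, ∃ C ≤ t.eval (κ i + (f i).size), Runs (𝒢.ddhOracle (κ i)) () P (f i) (g i) C) :
    𝒢.PolyTime κ f g :=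
  ⟨P, t, fun i => by
    obtain ⟨C, hC, hr⟩ := H i
    exact hr.mono hC⟩

theorem size_le (hg : 𝒢.PolyTime κ f g) :
    ∃ t : Polynomial ℕ, ∀ i, (g i).size ≤ t.eval (κ i + (f i).size) := by
  obtain ⟨P, t, H⟩ := hg
  exact ⟨t, fun i => (H i).1⟩

/-- The program does not change. Facts that are available only in one branch or in one round of a
loop are expressed by an index type that contains them. -/
theorem comap (r : ι' → ι) (hg : 𝒢.PolyTime κ f g) :
    𝒢.PolyTime (fun i => κ (r i)) (fun i => f (r i)) (fun i => g (r i)) := by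
  obtain ⟨P, t, H⟩ := hg
  exact ⟨P, t, fun i => H (r i)⟩

theorem congr (hg : 𝒢.PolyTime κ f g) (e : ∀ i, g i = h i) : 𝒢.PolyTime κ f h := by
  rwa [← funext e]

theorem trans (hg : 𝒢.PolyTime κ f g) (hh : 𝒢.PolyTime κ g h) : 𝒢.PolyTime κ f h := by
  obtain ⟨P, t, H⟩ := hg
  obtain ⟨P', t', H'⟩ := hh
  refine intro_le (P.comp P') (1 + .X + t + t'.comp (.X + t)) fun i => ⟨_, ?_, (H i).comp (H' i)⟩
  simp only [Polynomial.eval_add, Polynomial.eval_one, Polynomial.eval_X, Polynomial.eval_comp]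
  have := t'.eval_nat_mono (show κ i + (g i).size ≤ κ i + (f i).size + t.eval (κ i + (f i).size) by
    have := (H i).1
    omega)
  dsimp only at this
  omega

theorem op (o : Op) (hg : 𝒢.PolyTime κ f g) : 𝒢.PolyTime κ f (fun i => o.eval (g i)) := by
  refine hg.trans ?_
  obtain ⟨K, hK⟩ := o.exists_size_eval_le
  refine intro_le (.op o) (1 + .X + .X + .C K) fun i => ⟨_, ?_, Runs.op o⟩
  simp only [Polynomial.eval_add, Polynomial.eval_one, Polynomial.eval_X, Polynomial.eval_C]
  have := hK (g i)
  omega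

theorem refl : 𝒢.PolyTime κ f f := by
  refine intro_le (.op .id) (1 + .X + .X) fun i => ⟨_, ?_, Runs.op .id⟩
  simp only [Polynomial.eval_add, Polynomial.eval_one, Polynomial.eval_X, Op.eval]
  omega

theorem const (c : Val) : 𝒢.PolyTime κ f (fun _ => c) := op (.const c) refl

theorem pair (hg : 𝒢.PolyTime κ f g) (hh : 𝒢.PolyTime κ f h) :
    𝒢.PolyTime κ f (fun i => .pair (g i) (h i)) := by
  obtain ⟨P, t, H⟩ := hg
  obtain ⟨P', t', H'⟩ := hh
  refine intro_le (P.both P') (1 + .X + t + t') fun i => ⟨_, ?_, (H i).both (H' i)⟩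
  simp only [Polynomial.eval_add, Polynomial.eval_one, Polynomial.eval_X]
  omega

theorem fst (hg : 𝒢.PolyTime κ f (fun i => .pair (g i) (h i))) : 𝒢.PolyTime κ f g := hg.op .fst

theorem snd (hg : 𝒢.PolyTime κ f (fun i => .pair (g i) (h i))) : 𝒢.PolyTime κ f h := hg.op .snd

/-- Each branch needs to be correct only for the indices that lead to it. -/
theorem cases (p : ι → Prop) (hc : 𝒢.PolyTime κ f (fun i => ofProp (p i)))
    (ht : 𝒢.PolyTime (fun i : {i // p i} => κ i) (fun i => f i) (fun i => g i))
    (hf : 𝒢.PolyTime (fun i : {i // ¬p i} => κ i) (fun i => f i) (fun i => g i)) :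
    𝒢.PolyTime κ f g := by
  obtain ⟨P, t, H⟩ := hc
  obtain ⟨P₁, t₁, H₁⟩ := ht
  obtain ⟨P₂, t₂, H₂⟩ := hf
  refine intro_le (P.ite P₁ P₂) (1 + .X + t + t₁ + t₂) fun i => ?_
  simp only [Polynomial.eval_add, Polynomial.eval_one, Polynomial.eval_X]
  by_cases hi : p i
  · have h1 := H i
    dsimp only at h1
    rw [ofProp_true hi] at h1
    exact ⟨_, by dsimp only; omega, h1.ite_true (by simp) (H₁ ⟨i, hi⟩)⟩
  · have h1 := H i
    dsimp only at h1
    rw [ofProp_false hi] at h1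
    exact ⟨_, by dsimp only; omega, h1.ite_false (H₂ ⟨i, hi⟩)⟩

theorem ite {p : ι → Prop} [∀ i, Decidable (p i)] (hc : 𝒢.PolyTime κ f (fun i => ofProp (p i)))
    (hg : 𝒢.PolyTime κ f g) (hh : 𝒢.PolyTime κ f h) :
    𝒢.PolyTime κ f (fun i => if p i then g i else h i) := by
  refine cases p hc ?_ ?_
  · exact (hg.comap Subtype.val).congr fun i => (if_pos i.2).symm
  · exact (hh.comap Subtype.val).congr fun i => (if_neg i.2).symm

theorem prop_eq (hg : 𝒢.PolyTime κ f g) (hh : 𝒢.PolyTime κ f h) :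
    𝒢.PolyTime κ f (fun i => ofProp (g i = h i)) :=
  ((hg.pair hh).op .eq).congr fun i => by
    simp only [Op.eval, ofProp]
    congr

theorem and {p p' : ι → Prop} (hp : 𝒢.PolyTime κ f (fun i => ofProp (p i)))
    (hp' : 𝒢.PolyTime κ f (fun i => ofProp (p' i))) :
    𝒢.PolyTime κ f (fun i => ofProp (p i ∧ p' i)) := by
  refine cases p hp ?_ ?_
  · exact (hp'.comap Subtype.val).congr fun i => by simp [i.2]
  · exact (const (.nat 0)).congr fun i => by simp [i.2, ofProp]

theorem not {p : ι → Prop} (hp : 𝒢.PolyTime κ f (fun i => ofProp (p i))) :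
    𝒢.PolyTime κ f (fun i => ofProp (¬p i)) := by
  refine cases p hp ?_ ?_
  · exact (const (.nat 0)).congr fun i => by simp [i.2, ofProp]
  · exact (const (.nat 1)).congr fun i => by simp [i.2, ofProp]

theorem query (hg : 𝒢.PolyTime κ f g) : 𝒢.PolyTime κ f (fun i => 𝒢.ddhReply (κ i) (g i)) := by
  refine hg.trans (intro_le .query (3 + .X) fun i => ⟨_, ?_, Runs.query rfl⟩)
  simp only [Polynomial.eval_add, Polynomial.eval_ofNat, Polynomial.eval_X]
  have : (𝒢.ddhReply (κ i) (g i)).size ≤ 2 := by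
    unfold ddhReply
    have h1 : Nat.size 1 = 1 := Nat.size_one
    have h0 : Nat.size 0 = 0 := Nat.size_zero
    split
    · split
      · split_ifs <;> simp only [Val.size, h1, h0] <;> omega
      · simp only [Val.size, h0]; omega
    · simp only [Val.size, h0]; omega
  omega

/-- The number of rounds and the sizes of all intermediate states must be bounded in terms of the
initial state: iterating a polynomial-time body could otherwise lead to exponential size. -/
theorem loop (y : ι → ℕ → Val) (m : ι → ℕ) (init : 𝒢.PolyTime κ f (fun i => y i 0))
    (t : Polynomial ℕ) (hm : ∀ i, m i ≤ t.eval (κ i + (y i 0).size))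
    (hs : ∀ i, ∀ k ≤ m i, (y i k).size ≤ t.eval (κ i + (y i 0).size))
    (cond : 𝒢.PolyTime (fun x : {x : ι × ℕ // x.2 ≤ m x.1} => κ x.1.1) (fun x => y x.1.1 x.1.2)
      (fun x => ofProp (x.1.2 < m x.1.1)))
    (body : 𝒢.PolyTime (fun x : {x : ι × ℕ // x.2 < m x.1} => κ x.1.1) (fun x => y x.1.1 x.1.2)
      (fun x => y x.1.1 (x.1.2 + 1))) :
    𝒢.PolyTime κ f (fun i => y i (m i)) := by
  refine init.trans ?_
  obtain ⟨P, u, H⟩ := cond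
  obtain ⟨P', u', H'⟩ := body
  refine intro_le (.loop P P') ((t + 2) * (1 + 3 * (t + u.comp (.X + t) + u'.comp (.X + t))))
    fun i => ?_
  set n := κ i + (y i 0).size with hn
  -- The costs in round `k` are polynomial in the size of the `k`-th state, which `t` bounds in
  -- terms of the initial state; `D` covers every round.
  set D := t.eval n + u.eval (n + t.eval n) + u'.eval (n + t.eval n) with hD
  have hu : ∀ k ≤ m i, u.eval (κ i + (y i k).size) ≤ D := by
    intro k hk
    have h1 := hs i k hk
    rw [← hn] at h1
    have := u.eval_nat_mono (show κ i + (y i k).size ≤ n + t.eval n by omega)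
    dsimp only at this
    omega
  have hu' : ∀ k ≤ m i, u'.eval (κ i + (y i k).size) ≤ D := by
    intro k hk
    have h1 := hs i k hk
    rw [← hn] at h1
    have := u'.eval_nat_mono (show κ i + (y i k).size ≤ n + t.eval n by omega)
    dsimp only at this
    omega
  refine ⟨(m i + 2) * (1 + 3 * D), ?_, Runs.loop (fun k hk => ?_) (fun k hk => ?_) ?_ ?_⟩
  · simp only [Polynomial.eval_mul, Polynomial.eval_add, Polynomial.eval_comp, Polynomial.eval_X,
      Polynomial.eval_ofNat, Polynomial.eval_one]
    exact Nat.mul_le_mul (Nat.add_le_add_right (hm i) _) (le_of_eq (by rw [hD]))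
  · exact (hs i k hk).trans (by rw [← hn]; omega)
  · have := H ⟨(i, k), hk.le⟩
    dsimp only at this
    rw [ofProp_true hk] at this
    exact ⟨_, by simp, this.mono (hu k hk.le)⟩
  · have := H ⟨(i, m i), le_rfl⟩
    dsimp only at this
    rw [ofProp_false (lt_irrefl _)] at this
    exact this.mono (hu _ le_rfl)
  · exact fun k hk => (H' ⟨(i, k), hk⟩).mono (hu' k hk.le)

end PolyTime

end GroupFamily


/-! ### Group and exponent arithmetic in polynomial time -/

namespace GroupFamily

open Prog Val

variable {𝒢 : GroupFamily} {ι ι' : Type} {κ : ι → ℕ}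

/-- A common polynomial bound for the encodings of all objects of a group. -/
theorem Efficient.exists_size_bound (h : 𝒢.Efficient) : ∃ t : Polynomial ℕ, ∀ κ,
    (𝒢.pub κ).size ≤ t.eval κ ∧ (∀ a : 𝒢.G κ, (𝒢.enc κ a).size ≤ t.eval κ) ∧
    (∀ x : 𝒢.Exp κ, (𝒢.encExp x).size ≤ t.eval κ) ∧ ∀ k : Key κ, (encKey k).size ≤ t.eval κ := by
  obtain ⟨⟨P, t, hP⟩, -⟩ := h
  refine ⟨t + 3 * .X + 1, fun κ => ?_⟩
  simp only [Polynomial.eval_add, Polynomial.eval_mul, Polynomial.eval_ofNat, Polynomial.eval_X,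
    Polynomial.eval_one]
  -- The multiplication program reads `pub` and two group elements within a time that depends on `κ`
  -- only, so that time bounds their sizes. Exponents are below `q`, which is part of `pub`.
  have key : ∀ a : 𝒢.G κ, (𝒢.pub κ).size + (𝒢.enc κ a).size ≤ t.eval κ := by
    intro a
    have := (Runs.of_computesWithin (E := 𝒢.ddhOracle κ) (s := ()) (hP κ a a)).2
    simp only [Val.size] at this
    omega
  have hpub := key 1
  refine ⟨by omega, fun a => by have := key a; omega, fun x => ?_, fun k => ?_⟩
  · have : Nat.size (x : ZMod (𝒢.q κ)).val ≤ Nat.size (𝒢.q κ) :=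
      Nat.size_le_size (ZMod.val_lt _).le
    simp only [pub, encExp, Val.size] at hpub ⊢
    omega
  · have : Nat.size k ≤ 3 * κ := Nat.size_le.2 k.2
    simp only [encKey, Val.size]
    omega

namespace PolyTime

variable {f : ι → Val}

theorem mul (h : 𝒢.Efficient) {a b : ∀ i, 𝒢.G (κ i)}
    (hp : 𝒢.PolyTime κ f (fun i => 𝒢.pub (κ i)))
    (ha : 𝒢.PolyTime κ f (fun i => 𝒢.enc _ (a i))) (hb : 𝒢.PolyTime κ f (fun i => 𝒢.enc _ (b i))) :
    𝒢.PolyTime κ f (fun i => 𝒢.enc _ (a i * b i)) := by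
  refine (hp.pair (ha.pair hb)).trans ?_
  obtain ⟨⟨P, t, hP⟩, -⟩ := h
  exact intro_le P t fun i => ⟨_, t.eval_nat_mono (Nat.le_add_right _ _),
    (Runs.of_computesWithin (hP (κ i) (a i) (b i))).1⟩

theorem mem (h : 𝒢.Efficient) {v : ι → Val} (hp : 𝒢.PolyTime κ f (fun i => 𝒢.pub (κ i)))
    (hv : 𝒢.PolyTime κ f v) : 𝒢.PolyTime κ f (fun i => ofProp (∃ a, 𝒢.enc (κ i) a = v i)) := by
  refine (hp.pair hv).trans ?_
  obtain ⟨-, ⟨P, t, hP⟩⟩ := h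
  refine intro_le P t fun i => ⟨t.eval (κ i + (v i).size), t.eval_nat_mono ?_, ?_⟩
  · simp only [Val.size]
    omega
  · convert (Runs.of_computesWithin (hP (κ i) (v i))).1 using 1
    by_cases hv : ∃ a, 𝒢.enc (κ i) a = v i
    · rw [ofProp_true hv, if_pos hv]
    · rw [ofProp_false hv, if_neg hv]

theorem isPair {v : ι → Val} (hv : 𝒢.PolyTime κ f v) :
    𝒢.PolyTime κ f (fun i => ofProp (∃ a b, v i = .pair a b)) := by
  refine (prop_eq (hv.op .isNat) (const (.nat 0))).congr fun i => ?_
  cases v i <;> simp [Op.eval]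

variable {m n : ι → ℕ}

theorem nat_add (hm : 𝒢.PolyTime κ f (fun i => .nat (m i)))
    (hn : 𝒢.PolyTime κ f (fun i => .nat (n i))) : 𝒢.PolyTime κ f (fun i => .nat (m i + n i)) :=
  (hm.pair hn).op .add

theorem nat_sub (hm : 𝒢.PolyTime κ f (fun i => .nat (m i)))
    (hn : 𝒢.PolyTime κ f (fun i => .nat (n i))) : 𝒢.PolyTime κ f (fun i => .nat (m i - n i)) :=
  (hm.pair hn).op .sub

theorem nat_mul (hm : 𝒢.PolyTime κ f (fun i => .nat (m i)))
    (hn : 𝒢.PolyTime κ f (fun i => .nat (n i))) : 𝒢.PolyTime κ f (fun i => .nat (m i * n i)) :=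
  (hm.pair hn).op .mul

theorem nat_div (hm : 𝒢.PolyTime κ f (fun i => .nat (m i)))
    (hn : 𝒢.PolyTime κ f (fun i => .nat (n i))) : 𝒢.PolyTime κ f (fun i => .nat (m i / n i)) :=
  (hm.pair hn).op .div

theorem nat_mod (hm : 𝒢.PolyTime κ f (fun i => .nat (m i)))
    (hn : 𝒢.PolyTime κ f (fun i => .nat (n i))) : 𝒢.PolyTime κ f (fun i => .nat (m i % n i)) :=
  (hm.pair hn).op .mod

/-- Powers in a family of monoids with polynomial-time multiplication, by repeated squaring. -/
theorem mul_pow_of_mul {M : ι → Type} [∀ i, Monoid (M i)] (e : ∀ i, M i → Val) (ctx : ι → Val)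
    (t : Polynomial ℕ) (ht : ∀ i a, (e i a).size ≤ t.eval (κ i))
    (hmul : 𝒢.PolyTime (fun x : Σ i, M i × M i => κ x.1)
      (fun x => .pair (ctx x.1) (.pair (e _ x.2.1) (e _ x.2.2))) fun x => e _ (x.2.1 * x.2.2))
    {c a : ∀ i, M i} (hctx : 𝒢.PolyTime κ f ctx) (hc : 𝒢.PolyTime κ f (fun i => e i (c i)))
    (ha : 𝒢.PolyTime κ f (fun i => e i (a i))) (hn : 𝒢.PolyTime κ f (fun i => .nat (n i))) :
    𝒢.PolyTime κ f (fun i => e i (c i * a i ^ n i)) := by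
  -- The bits of `n i` are read from the lowest: an accumulator for the bits read so far, the
  -- current repeated square, and the bits still to come. The context travels along because
  -- multiplication needs it.
  let y : ι → ℕ → Val := fun i k => .pair (ctx i) (.pair (e i (c i * a i ^ (n i % 2 ^ k)))
    (.pair (e i (a i ^ 2 ^ k)) (.nat (n i / 2 ^ k))))
  have hy : 𝒢.PolyTime κ f (fun i => y i (n i).size) := by
    refine loop y (fun i => (n i).size) ?_ (.X + 2 * t + 5) ?_ ?_ ?_ ?_
    · refine (hctx.pair (hc.pair (ha.pair hn))).congr fun i => ?_
      simp [y, Nat.mod_one]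
    · intro i
      simp only [y, Polynomial.eval_add, Polynomial.eval_X, Val.size, pow_zero, Nat.div_one]
      omega
    · intro i k _
      have h1 := t.eval_nat_mono (Nat.le_add_right (κ i) (y i 0).size)
      have h2 := ht i (c i * a i ^ (n i % 2 ^ k))
      have h3 := ht i (a i ^ 2 ^ k)
      have h4 : Nat.size (n i / 2 ^ k) ≤ Nat.size (n i) := Nat.size_le_size (Nat.div_le_self _ _)
      have h5 : 3 + (ctx i).size + Nat.size (n i) ≤ (y i 0).size := by
        simp only [y, Val.size, pow_zero, Nat.div_one]
        omega
      simp only [Polynomial.eval_add, Polynomial.eval_X, Polynomial.eval_mul,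
        Polynomial.eval_ofNat]
      simp only [y, Val.size] at h1 h5 ⊢
      omega
    · refine (not (prop_eq (refl.snd.snd.snd) (const (.nat 0)))).congr fun x => ?_
      congr 1
      simp only [Val.nat.injEq, Nat.div_eq_zero_iff, Nat.lt_size]
      simp
    · have hr : 𝒢.PolyTime (fun x : {x : ι × ℕ // x.2 < (n x.1).size} => κ x.1.1)
          (fun x => y x.1.1 x.1.2) (fun x => y x.1.1 x.1.2) := refl
      have hctx' := hr.fst
      have hacc := hr.snd.fst
      have hbase := hr.snd.snd.fst
      have hk := hr.snd.snd.snd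
      have hsq := (hctx'.pair (hbase.pair hbase)).trans
        (hmul.comap fun x : {x : ι × ℕ // x.2 < (n x.1).size} => ⟨x.1.1, a x.1.1 ^ 2 ^ x.1.2, a x.1.1 ^ 2 ^ x.1.2⟩)
      have hm := (hctx'.pair (hacc.pair hbase)).trans
        (hmul.comap fun x : {x : ι × ℕ // x.2 < (n x.1).size} =>
          ⟨x.1.1, c x.1.1 * a x.1.1 ^ (n x.1.1 % 2 ^ x.1.2), a x.1.1 ^ 2 ^ x.1.2⟩)
      have hodd := prop_eq (nat_mod hk (const (.nat 2))) (const (.nat 1))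
      refine (hctx'.pair ((ite hodd hm hacc).pair (hsq.pair (nat_div hk (const (.nat 2)))))).congr
        fun x => ?_
      obtain ⟨⟨i, k⟩, -⟩ := x
      have e1 : n i / 2 ^ k / 2 = n i / 2 ^ (k + 1) := by rw [Nat.div_div_eq_div_mul, pow_succ]
      have e2 : a i ^ 2 ^ k * a i ^ 2 ^ k = a i ^ 2 ^ (k + 1) := by
        rw [← pow_add, pow_succ, mul_two]
      have e3 := Nat.mod_pow_succ (x := n i) (b := 2) (k := k)
      simp only [y, e1, e2]
      rcases Nat.mod_two_eq_zero_or_one (n i / 2 ^ k) with h0 | h1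
      · simp [h0, e3]
      · simp [h1, e3, pow_add (a i), mul_assoc]
  refine hy.snd.fst.congr fun i => ?_
  rw [Nat.mod_eq_of_lt (Nat.lt_size_self _)]

theorem mul_pow (h : 𝒢.Efficient) {c a : ∀ i, 𝒢.G (κ i)}
    (hp : 𝒢.PolyTime κ f (fun i => 𝒢.pub (κ i)))
    (hc : 𝒢.PolyTime κ f (fun i => 𝒢.enc _ (c i))) (ha : 𝒢.PolyTime κ f (fun i => 𝒢.enc _ (a i)))
    (hn : 𝒢.PolyTime κ f (fun i => .nat (n i))) :
    𝒢.PolyTime κ f (fun i => 𝒢.enc _ (c i * a i ^ n i)) := by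
  obtain ⟨t, ht⟩ := h.exists_size_bound
  refine mul_pow_of_mul (fun i => 𝒢.enc (κ i)) (fun i => 𝒢.pub (κ i)) t (fun i a => (ht _).2.1 a)
    ?_ hp hc ha hn
  exact mul h refl.fst refl.snd.fst refl.snd.snd

theorem gen (hp : 𝒢.PolyTime κ f (fun i => 𝒢.pub (κ i))) :
    𝒢.PolyTime κ f (fun i => 𝒢.enc _ (𝒢.gen (κ i))) := hp.snd.snd.fst

theorem order (hp : 𝒢.PolyTime κ f (fun i => 𝒢.pub (κ i))) :
    𝒢.PolyTime κ f (fun i => .nat (𝒢.q (κ i))) := hp.snd.fst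

/-- The identity is not among the public parameters, but it equals `g * g ^ (q - 1)`. This is why
`mul_pow` has an initial factor instead of starting from 1. -/
theorem one (h : 𝒢.Efficient) (hp : 𝒢.PolyTime κ f (fun i => 𝒢.pub (κ i))) :
    𝒢.PolyTime κ f (fun i => 𝒢.enc (κ i) 1) := by
  refine (mul_pow h hp (gen hp) (gen hp) (nat_sub (order hp) (const (.nat 1)))).congr fun i => ?_
  have h1 : 𝒢.q (κ i) - 1 + 1 = 𝒢.q (κ i) := Nat.sub_add_cancel (𝒢.prime_card _).one_le
  rw [← pow_succ', h1]
  exact congrArg _ pow_card_eq_one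

theorem pow (h : 𝒢.Efficient) {a : ∀ i, 𝒢.G (κ i)} {x : ∀ i, 𝒢.Exp (κ i)}
    (hp : 𝒢.PolyTime κ f (fun i => 𝒢.pub (κ i)))
    (ha : 𝒢.PolyTime κ f (fun i => 𝒢.enc _ (a i))) (hx : 𝒢.PolyTime κ f (fun i => 𝒢.encExp (x i))) :
    𝒢.PolyTime κ f (fun i => 𝒢.enc _ (𝒢.pow (a i) (x i))) := by
  refine (mul_pow h hp (one h hp) ha hx).congr fun i => ?_
  rw [one_mul]
  rfl

theorem exp_mul {x y : ∀ i, 𝒢.Exp (κ i)} (hp : 𝒢.PolyTime κ f (fun i => 𝒢.pub (κ i)))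
    (hx : 𝒢.PolyTime κ f (fun i => 𝒢.encExp (x i)))
    (hy : 𝒢.PolyTime κ f (fun i => 𝒢.encExp (y i))) :
    𝒢.PolyTime κ f (fun i => 𝒢.encExp (x i * y i)) := by
  refine (nat_mod (nat_mul hx hy) (order hp)).congr fun i => ?_
  simp only [encExp, Units.val_mul, ZMod.val_mul]

/-- By Fermat's little theorem the inverse is the power with exponent `q - 2`. -/
theorem exp_inv (h : 𝒢.Efficient) {x : ∀ i, 𝒢.Exp (κ i)}
    (hp : 𝒢.PolyTime κ f (fun i => 𝒢.pub (κ i)))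
    (hx : 𝒢.PolyTime κ f (fun i => 𝒢.encExp (x i))) :
    𝒢.PolyTime κ f (fun i => 𝒢.encExp (x i)⁻¹) := by
  obtain ⟨t, ht⟩ := h.exists_size_bound
  have h1 : 𝒢.PolyTime κ f (fun i => 𝒢.encExp (1 : 𝒢.Exp (κ i))) := by
    refine (const (.nat 1)).congr fun i => ?_
    have : Fact (1 < 𝒢.q (κ i)) := ⟨(𝒢.prime_card (κ i)).one_lt⟩
    simp [encExp, ZMod.val_one]
  refine (mul_pow_of_mul (fun i => 𝒢.encExp (κ := κ i)) (fun i => 𝒢.pub (κ i)) t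
    (fun i a => (ht _).2.2.1 a) (exp_mul refl.fst refl.snd.fst refl.snd.snd) hp h1 hx
    (nat_sub (order hp) (const (.nat 2)))).congr fun i => ?_
  congr 1
  rw [one_mul, eq_comm, inv_eq_iff_mul_eq_one, ← pow_succ']
  have h2 := (𝒢.prime_card (κ i)).two_le
  have h3 := ZMod.units_pow_card_sub_one_eq_one (𝒢.q (κ i)) (x i)
  have h4 : 𝒢.q (κ i) - 2 + 1 = 𝒢.q (κ i) - 1 := by
    change Fintype.card _ - 2 + 1 = Fintype.card _ - 1
    omega
  rwa [h4]

/-- Multiply by `8 = 2 ^ 3` in each of `κ` rounds. This is polynomial because time bounds are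
polynomials in `κ` itself, not in its bit length. -/
theorem key_card (hp : 𝒢.PolyTime κ f (fun i => 𝒢.pub (κ i))) :
    𝒢.PolyTime κ f (fun i => .nat (2 ^ (3 * κ i))) := by
  have hκ : 𝒢.PolyTime κ f (fun i => .nat (κ i)) := hp.fst
  let y : ι → ℕ → Val := fun i k => .pair (.nat (2 ^ (3 * k))) (.nat (κ i - k))
  have hy : 𝒢.PolyTime κ f (fun i => y i (κ i)) := by
    refine loop y κ ?_ (4 * .X + 4) ?_ ?_ ?_ ?_
    · exact ((const (.nat 1)).pair hκ).congr fun i => by simp [y]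
    · intro i
      simp only [Polynomial.eval_add, Polynomial.eval_X, Polynomial.eval_mul,
        Polynomial.eval_ofNat]
      omega
    · intro i k hk
      have h1 : Nat.size (κ i - k) ≤ Nat.size (κ i) := Nat.size_le_size (Nat.sub_le _ _)
      have h2 : Nat.size (2 ^ (3 * k)) ≤ 3 * k + 1 := by
        rw [Nat.size_le]
        exact Nat.pow_lt_pow_right (by norm_num) (by omega)
      have h3 : Nat.size (κ i) ≤ (y i 0).size := by
        simp only [y, Val.size, Nat.sub_zero]
        omega
      simp only [Polynomial.eval_add, Polynomial.eval_X, Polynomial.eval_mul,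
        Polynomial.eval_ofNat]
      simp only [y, Val.size] at h3 ⊢
      omega
    · refine (not (prop_eq refl.snd (const (.nat 0)))).congr fun x => ?_
      congr 1
      have := x.2
      simp only [Val.nat.injEq, eq_iff_iff]
      omega
    · have hr : 𝒢.PolyTime (fun x : {x : ι × ℕ // x.2 < κ x.1} => κ x.1.1)
          (fun x => y x.1.1 x.1.2) (fun x => y x.1.1 x.1.2) := refl
      refine ((nat_mul hr.fst (const (.nat 8))).pair (nat_sub hr.snd (const (.nat 1)))).congr
        fun x => ?_
      simp only [y, Nat.sub_sub]
      rw [mul_add, pow_add]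
      norm_num
  exact hy.fst

end PolyTime

end GroupFamily


/-! ### Discrete logarithms and implicitly given Diffie-Hellman elements -/

namespace GroupFamily

variable {𝒢 : GroupFamily} {κ : ℕ}

theorem exists_gen_pow (a : 𝒢.G κ) : ∃ n : ℕ, 𝒢.gen κ ^ n = a :=
  (Submonoid.mem_powers_iff a (𝒢.gen κ)).1
    (mem_powers_iff_mem_zpowers.2 (𝒢.gen_generates κ a))

theorem pow_q (a : 𝒢.G κ) : a ^ 𝒢.q κ = 1 := pow_card_eq_one

/-- The discrete logarithm. -/
noncomputable def dlog (a : 𝒢.G κ) : ℕ := (exists_gen_pow a).choose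

theorem gen_pow_dlog (a : 𝒢.G κ) : 𝒢.gen κ ^ dlog a = a := (exists_gen_pow a).choose_spec

/-- The Diffie-Hellman function with respect to the generator. -/
noncomputable def cdh (a b : 𝒢.G κ) : 𝒢.G κ := b ^ dlog a

/-- Every element is a power of the generator. Therefore `cdh` does not depend on which exponent
`dlog` has chosen. -/
theorem pow_congr_of_gen {m n : ℕ} (h : 𝒢.gen κ ^ m = 𝒢.gen κ ^ n) (b : 𝒢.G κ) :
    b ^ m = b ^ n := by
  rw [← gen_pow_dlog b, ← pow_mul, ← pow_mul, mul_comm, mul_comm _ n, pow_mul, pow_mul, h]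

theorem cdh_eq (a b : 𝒢.G κ) : cdh a b = 𝒢.gen κ ^ (dlog a * dlog b) := by
  rw [mul_comm, pow_mul, gen_pow_dlog, cdh]

theorem cdh_comm (a b : 𝒢.G κ) : cdh a b = cdh b a := by
  rw [cdh_eq, cdh_eq, mul_comm]

theorem cdh_pow (n : ℕ) (b : 𝒢.G κ) : cdh (𝒢.gen κ ^ n) b = b ^ n :=
  pow_congr_of_gen (gen_pow_dlog _) b

theorem cdh_gen (b : 𝒢.G κ) : cdh (𝒢.gen κ) b = b := by
  conv_lhs => rw [← pow_one (𝒢.gen κ)]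
  rw [cdh_pow, pow_one]

theorem cdh_gen_pow (x : 𝒢.Exp κ) (b : 𝒢.G κ) : cdh (𝒢.pow (𝒢.gen κ) x) b = 𝒢.pow b x :=
  cdh_pow _ b

theorem orderOf_eq {a : 𝒢.G κ} (ha : a ≠ 1) : orderOf a = 𝒢.q κ :=
  orderOf_eq_prime (pow_q a) ha

theorem pow_pow (a : 𝒢.G κ) (x y : 𝒢.Exp κ) : 𝒢.pow (𝒢.pow a x) y = 𝒢.pow a (x * y) := by
  simp only [pow, Units.val_mul, ZMod.val_mul]
  rw [← pow_mul, ← pow_eq_pow_mod _ (pow_q a)]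

theorem pow_one' (a : 𝒢.G κ) : 𝒢.pow a 1 = a := by
  have : Fact (1 < 𝒢.q κ) := ⟨(𝒢.prime_card κ).one_lt⟩
  simp [pow, ZMod.val_one]

theorem pow_injective {a : 𝒢.G κ} (ha : a ≠ 1) : Function.Injective (𝒢.pow a) := by
  intro x y h
  rw [pow, pow, pow_inj_mod, orderOf_eq ha, Nat.mod_eq_of_lt (ZMod.val_lt _),
    Nat.mod_eq_of_lt (ZMod.val_lt _)] at h
  exact Units.ext (ZMod.val_injective _ h)

theorem pow_comm (a : 𝒢.G κ) (x y : 𝒢.Exp κ) : 𝒢.pow (𝒢.pow a x) y = 𝒢.pow (𝒢.pow a y) x := by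
  rw [pow_pow, pow_pow, mul_comm]

theorem gen_ne_one : 𝒢.gen κ ≠ 1 := by
  intro h
  have h1 : ∀ a : 𝒢.G κ, a = 1 := fun a => by
    rw [← gen_pow_dlog a, h, one_pow]
  have : Fintype.card (𝒢.G κ) ≤ 1 :=
    Fintype.card_le_one_iff.2 fun a b => (h1 a).trans (h1 b).symm
  exact absurd (𝒢.prime_card κ).one_lt (by omega)

theorem pow_ne_one {a : 𝒢.G κ} (ha : a ≠ 1) (x : 𝒢.Exp κ) : 𝒢.pow a x ≠ 1 := by
  intro h
  have h1 := pow_pow a x x⁻¹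
  rw [h, mul_inv_cancel, pow_one'] at h1
  exact ha (by rw [← h1, pow, one_pow])

theorem dlog_ne_zero {a : 𝒢.G κ} (ha : a ≠ 1) : ¬ 𝒢.q κ ∣ dlog a := by
  rintro ⟨k, hk⟩
  apply ha
  rw [← gen_pow_dlog a, hk, pow_mul, pow_q, one_pow]

theorem pow_left_injective {d : ℕ} (hd : ¬ 𝒢.q κ ∣ d) {a b : 𝒢.G κ} (h : a ^ d = b ^ d) :
    a = b := by
  by_contra hab
  have h1 : (a / b) ^ d = 1 := by rw [div_pow, h, div_self']
  have h2 : a / b ≠ 1 := by rwa [Ne, div_eq_one]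
  exact hd (orderOf_eq h2 ▸ orderOf_dvd_of_pow_eq_one h1)

/-- Two implicitly given Diffie-Hellman elements can be compared by the decision oracle. -/
theorem isDH_iff {a₁ : 𝒢.G κ} (ha : a₁ ≠ 1) (a₂ b₂ b₁ : 𝒢.G κ) :
    𝒢.IsDH a₁ a₂ b₂ b₁ ↔ cdh a₁ b₁ = cdh a₂ b₂ := by
  have hpow : ∀ m, a₁ ^ m = 𝒢.gen κ ^ (dlog a₁ * m) := fun m => by
    rw [pow_mul, gen_pow_dlog]
  have key : ∀ m n, cdh (a₁ ^ m) (a₁ ^ n) = (a₁ ^ (m * n)) ^ dlog a₁ := by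
    intro m n
    rw [hpow m, cdh_pow, ← pow_mul, ← pow_mul]
    congr 1
    ring
  constructor
  · rintro ⟨m, n, rfl, rfl, rfl⟩
    rw [key, cdh]
  · intro h
    -- The order is prime, so `a₁ ≠ 1` generates the group.
    have hex : ∀ b, ∃ m : ℕ, b = a₁ ^ m := by
      intro b
      have : b ∈ Subgroup.zpowers a₁ := by
        rw [zpowers_eq_top_of_prime_card (p := 𝒢.q κ) (Nat.card_eq_fintype_card) ha]
        trivial
      obtain ⟨m, hm⟩ := (Submonoid.mem_powers_iff b a₁).1 (mem_powers_iff_mem_zpowers.2 this)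
      exact ⟨m, hm.symm⟩
    obtain ⟨m, rfl⟩ := hex a₂
    obtain ⟨n, rfl⟩ := hex b₂
    refine ⟨m, n, rfl, rfl, ?_⟩
    rw [key, cdh] at h
    exact pow_left_injective (dlog_ne_zero ha) h

theorem dec_enc (a : 𝒢.G κ) : 𝒢.dec κ (𝒢.enc κ a) = some a := by
  have h : ∃ b, 𝒢.enc κ b = 𝒢.enc κ a := ⟨a, rfl⟩
  rw [dec, dif_pos h, (𝒢.enc κ).injective h.choose_spec]

theorem dec_eq_some {v : Val} {a : 𝒢.G κ} : 𝒢.dec κ v = some a ↔ 𝒢.enc κ a = v := by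
  constructor
  · intro h
    unfold dec at h
    split_ifs at h with h'
    rw [Option.some.injEq] at h
    rw [← h]
    exact h'.choose_spec
  · rintro rfl
    exact dec_enc a

theorem ddhReply_eq {a₁ : 𝒢.G κ} (ha : a₁ ≠ 1) (a₂ b₂ b₁ : 𝒢.G κ) :
    𝒢.ddhReply κ (.pair (𝒢.enc κ a₁) (.pair (𝒢.enc κ a₂) (.pair (𝒢.enc κ b₂) (𝒢.enc κ b₁)))) =
      Val.ofProp (cdh a₁ b₁ = cdh a₂ b₂) := by
  simp only [ddhReply, dec_enc, Val.ofProp]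
  by_cases h : 𝒢.IsDH a₁ a₂ b₂ b₁
  · rw [if_pos h, if_pos ((isDH_iff ha a₂ b₂ b₁).1 h)]
  · rw [if_neg h, if_neg (mt (isDH_iff ha a₂ b₂ b₁).2 h)]

/-! ### A log of oracle values -/

variable (𝒢) in
/-- A record of the values `h_*(s)` and `h_b(α, s)`, where `s` is given implicitly as the
Diffie-Hellman element of two group elements. -/
structure Entry (κ : ℕ) where
  hdr : 𝒢.G κ
  left : 𝒢.G κ
  right : 𝒢.G κ
  key : Key κ
  bld : 𝒢.Exp κ

/-- The group element `s`. -/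
noncomputable def Entry.val (en : 𝒢.Entry κ) : 𝒢.G κ := cdh en.left en.right

variable (𝒢) in
/-- The two random oracles. -/
abbrev Oracles (κ : ℕ) : Type := 𝒢.HStar κ × 𝒢.HBlind κ

/-- The pair `(h_*(s), h_b(α, s))`. -/
def Oracles.eval (H : 𝒢.Oracles κ) (α s : 𝒢.G κ) : Key κ × 𝒢.Exp κ := (H.1 s, H.2 (α, s))

open Classical in
/-- Change the values of `h_*` at `s` and `h_b` at `(α, s)`. -/
noncomputable def Oracles.set (H : 𝒢.Oracles κ) (α s : 𝒢.G κ) (v : Key κ × 𝒢.Exp κ) :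
    𝒢.Oracles κ :=
  (Function.update H.1 s v.1, Function.update H.2 (α, s) v.2)

open Classical in
/-- The logged value of `h_*(s)`, or else `k`. -/
noncomputable def lookupKey (D : List (𝒢.Entry κ)) (s : 𝒢.G κ) (k : Key κ) : Key κ :=
  D.foldl (fun k en => if s = en.val then en.key else k) k

open Classical in
/-- The logged value of `h_b(α, s)`, or else `e`. -/
noncomputable def lookupBld (D : List (𝒢.Entry κ)) (α s : 𝒢.G κ) (e : 𝒢.Exp κ) : 𝒢.Exp κ :=
  D.foldl (fun e en => if s = en.val ∧ α = en.hdr then en.bld else e) e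

/-- The logged values of both oracles, or else `v`. -/
noncomputable def lookup (D : List (𝒢.Entry κ)) (α s : 𝒢.G κ) (v : Key κ × 𝒢.Exp κ) :
    Key κ × 𝒢.Exp κ :=
  (lookupKey D s v.1, lookupBld D α s v.2)

/-- The random oracles changed to agree with the log. -/
noncomputable def override (D : List (𝒢.Entry κ)) (H : 𝒢.Oracles κ) : 𝒢.Oracles κ :=
  (fun s => lookupKey D s (H.1 s), fun p => lookupBld D p.1 p.2 (H.2 p))

/-- Ask both oracles at `(α, s)`, where `s` is the Diffie-Hellman element of `a` and `b` and `v` are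
the values to be used if they are new. -/
noncomputable def ask (D : List (𝒢.Entry κ)) (α a b : 𝒢.G κ) (v : Key κ × 𝒢.Exp κ) :
    (Key κ × 𝒢.Exp κ) × List (𝒢.Entry κ) :=
  (lookup D α (cdh a b) v,
    ⟨α, a, b, (lookup D α (cdh a b) v).1, (lookup D α (cdh a b) v).2⟩ :: D)

/-- The last matching entry of the list decides, which is the oldest one since new entries are put
in front. If there is none, the initial value survives. -/
theorem foldl_ite_cases {A B : Type} (D : List A) (p : A → Prop) [DecidablePred p] (g : A → B) :
    (∃ c, ∀ k, D.foldl (fun k en => if p en then g en else k) k = c) ∨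
      ∀ k, D.foldl (fun k en => if p en then g en else k) k = k := by
  induction D with
  | nil => exact .inr fun k => rfl
  | cons en D ih =>
    rcases ih with ⟨c, hc⟩ | h
    · exact .inl ⟨c, fun k => hc _⟩
    · by_cases hp : p en
      · exact .inl ⟨g en, fun k => by simp only [List.foldl_cons, h, if_pos hp]⟩
      · exact .inr fun k => by simp only [List.foldl_cons, h, if_neg hp]

theorem lookupKey_idem (D : List (𝒢.Entry κ)) (s : 𝒢.G κ) (k : Key κ) :
    lookupKey D s (lookupKey D s k) = lookupKey D s k := by
  classical
  unfold lookupKey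
  rcases foldl_ite_cases D (fun en => s = en.val) (fun en => en.key) with ⟨c, hc⟩ | h
  · exact (hc _).trans (hc _).symm
  · exact h _

theorem lookupBld_idem (D : List (𝒢.Entry κ)) (α s : 𝒢.G κ) (e : 𝒢.Exp κ) :
    lookupBld D α s (lookupBld D α s e) = lookupBld D α s e := by
  classical
  unfold lookupBld
  rcases foldl_ite_cases D (fun en => s = en.val ∧ α = en.hdr) (fun en => en.bld) with ⟨c, hc⟩ | h
  · exact (hc _).trans (hc _).symm
  · exact h _

theorem lookupKey_of_notMem {D : List (𝒢.Entry κ)} {s : 𝒢.G κ} (h : s ∉ D.map Entry.val)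
    (k : Key κ) : lookupKey D s k = k := by
  induction D generalizing k with
  | nil => rfl
  | cons en D ih =>
    simp only [List.map_cons, List.mem_cons, not_or] at h
    exact (ih h.2 _).trans (if_neg h.1)

theorem lookupBld_of_notMem {D : List (𝒢.Entry κ)} {α s : 𝒢.G κ}
    (h : α ∉ D.map Entry.hdr ∨ s ∉ D.map Entry.val)
    (e : 𝒢.Exp κ) : lookupBld D α s e = e := by
  induction D generalizing e with
  | nil => rfl
  | cons en D ih =>
    simp only [List.map_cons, List.mem_cons, not_or] at h
    refine (ih (h.imp And.right And.right) _).trans (if_neg ?_)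
    tauto

theorem eval_override (D : List (𝒢.Entry κ)) (H : 𝒢.Oracles κ) (α s : 𝒢.G κ) :
    (override D H).eval α s = lookup D α s (H.eval α s) := rfl

theorem eval_set (H : 𝒢.Oracles κ) (α s : 𝒢.G κ) (v : Key κ × 𝒢.Exp κ) :
    (H.set α s v).eval α s = v := by
  simp [Oracles.eval, Oracles.set]

theorem eval_set_of_ne (H : 𝒢.Oracles κ) (α s : 𝒢.G κ) (v : Key κ × 𝒢.Exp κ) (β : 𝒢.G κ)
    {t : 𝒢.G κ} (h : t ≠ s) : (H.set α s v).eval β t = H.eval β t := by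
  classical
  simp [Oracles.eval, Oracles.set, h]

theorem set_set (H : 𝒢.Oracles κ) (α s : 𝒢.G κ) (v w : Key κ × 𝒢.Exp κ) :
    (H.set α s v).set α s w = H.set α s w := by
  simp [Oracles.set]

theorem set_eval (H : 𝒢.Oracles κ) (α s : 𝒢.G κ) : H.set α s (H.eval α s) = H := by
  simp [Oracles.set, Oracles.eval]

theorem override_set {D : List (𝒢.Entry κ)} (H : 𝒢.Oracles κ) (α : 𝒢.G κ) {s : 𝒢.G κ}
    (v : Key κ × 𝒢.Exp κ) (h : s ∉ D.map Entry.val) :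
    override D (H.set α s v) = (override D H).set α s v := by
  classical
  simp only [override, Oracles.set, Prod.mk.injEq]
  constructor
  · funext t
    by_cases ht : t = s
    · subst ht
      simp [lookupKey_of_notMem h]
    · simp [Function.update_of_ne ht]
  · funext p
    by_cases hp : p = (α, s)
    · subst hp
      simp [lookupBld_of_notMem (.inr h)]
    · simp [Function.update_of_ne hp]

/-- Answers from the log with a fresh value are answers of oracles set to that value. -/
theorem override_ask (D : List (𝒢.Entry κ)) (α a b : 𝒢.G κ) (v : Key κ × 𝒢.Exp κ)
    (H : 𝒢.Oracles κ) :
    override (ask D α a b v).2 H = override D (H.set α (cdh a b) v) := by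
  classical
  simp only [override, Oracles.set, Prod.mk.injEq, ask]
  constructor
  · funext t
    by_cases ht : t = cdh a b
    · subst ht
      simp only [Function.update_self]
      -- The new entry is folded first and replaces the initial value by the looked-up one; looking
      -- this up again in the old log changes nothing.
      exact (congrArg _ (if_pos rfl)).trans (lookupKey_idem _ _ _)
    · rw [Function.update_of_ne ht]
      exact congrArg (lookupKey D t) (if_neg ht)
  · funext p
    by_cases hp : p = (α, cdh a b)
    · subst hp
      simp only [Function.update_self]
      exact (congrArg _ (if_pos ⟨rfl, rfl⟩)).trans (lookupBld_idem _ _ _ _)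
    · rw [Function.update_of_ne hp]
      refine congrArg (lookupBld D p.1 p.2) (if_neg fun h => hp ?_)
      exact Prod.ext h.2 h.1

theorem ask_fst (D : List (𝒢.Entry κ)) (α a b : 𝒢.G κ) (v : Key κ × 𝒢.Exp κ) (H : 𝒢.Oracles κ) :
    (ask D α a b v).1 = (override D (H.set α (cdh a b) v)).eval α (cdh a b) := by
  rw [eval_override, eval_set]
  rfl

end GroupFamily


/-! ### Means with respect to uniform distributions -/

open scoped ENNReal

namespace PMF

variable {α β : Type}

/-- The mean of a function. -/
noncomputable def mean (d : PMF α) (φ : α → ℝ≥0∞) : ℝ≥0∞ := ∑' a, d a * φ a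

theorem mean_pure (a : α) (φ : α → ℝ≥0∞) : (PMF.pure a).mean φ = φ a := Exec.tsum_pure_mul a φ

theorem mean_bind (d : PMF α) (g : α → PMF β) (φ : β → ℝ≥0∞) :
    (d.bind g).mean φ = d.mean fun a => (g a).mean φ := Exec.tsum_bind_mul d g φ

theorem mean_map (d : PMF α) (g : α → β) (φ : β → ℝ≥0∞) :
    (d.map g).mean φ = d.mean fun a => φ (g a) := Exec.tsum_map_mul d g φ

theorem mean_mono (d : PMF α) {φ ψ : α → ℝ≥0∞} (h : ∀ a, φ a ≤ ψ a) : d.mean φ ≤ d.mean ψ :=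
  ENNReal.tsum_le_tsum fun a => mul_le_mul_right (h a) _

theorem mean_congr (d : PMF α) {φ ψ : α → ℝ≥0∞} (h : ∀ a, φ a = ψ a) : d.mean φ = d.mean ψ := by
  rw [funext h]

theorem mean_const (d : PMF α) (c : ℝ≥0∞) : (d.mean fun _ => c) = c := by
  rw [mean, ENNReal.tsum_mul_right, PMF.tsum_coe, one_mul]

theorem mean_add (d : PMF α) (φ ψ : α → ℝ≥0∞) :
    (d.mean fun a => φ a + ψ a) = d.mean φ + d.mean ψ := by
  simp only [mean, mul_add, ENNReal.tsum_add]

theorem mean_comm (d : PMF α) (e : PMF β) (φ : α → β → ℝ≥0∞) :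
    (d.mean fun a => e.mean fun b => φ a b) = e.mean fun b => d.mean fun a => φ a b := by
  simp only [mean, ← ENNReal.tsum_mul_left]
  rw [ENNReal.tsum_comm]
  simp only [mul_left_comm]

variable [Fintype α] [Nonempty α] [Fintype β] [Nonempty β]

theorem mean_uniform (φ : α → ℝ≥0∞) :
    (uniformOfFintype α).mean φ = (Fintype.card α : ℝ≥0∞)⁻¹ * ∑ a, φ a := by
  simp only [mean, uniformOfFintype_apply, tsum_fintype, Finset.mul_sum]

theorem mean_uniform_equiv (e : α ≃ β) (φ : β → ℝ≥0∞) :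
    ((uniformOfFintype α).mean fun a => φ (e a)) = (uniformOfFintype β).mean φ := by
  rw [mean_uniform, mean_uniform, Fintype.card_congr e, e.sum_comp]

theorem mean_uniform_prod (φ : α → β → ℝ≥0∞) :
    ((uniformOfFintype (α × β)).mean fun p => φ p.1 p.2) =
      (uniformOfFintype α).mean fun a => (uniformOfFintype β).mean fun b => φ a b := by
  simp only [mean_uniform, Fintype.card_prod, Nat.cast_mul, Fintype.sum_prod_type]
  rw [ENNReal.mul_inv (.inr (ENNReal.natCast_ne_top _)) (.inl (ENNReal.natCast_ne_top _)),
    mul_assoc, Finset.mul_sum]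

/-- An injective substitution on the event `p` compares the two sums term by term. It will be
applied to the exchange of the oracle values at the challenge with the random pair. -/
theorem mean_uniform_le_of_injOn {p : α → Prop} {r : α → α} {f g : α → ℝ≥0∞}
    (hr : Set.InjOn r {a | p a}) (h0 : ∀ a, ¬p a → f a = 0) (h : ∀ a, p a → f a ≤ g (r a)) :
    (uniformOfFintype α).mean f ≤ (uniformOfFintype α).mean g := by
  classical
  rw [mean_uniform, mean_uniform]
  refine mul_le_mul_right ?_ _
  calc ∑ a, f a = ∑ a with p a, f a := by
        rw [Finset.sum_filter_of_ne]
        intro a _ ha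
        by_contra hp
        exact ha (h0 a hp)
    _ ≤ ∑ a with p a, g (r a) := Finset.sum_le_sum fun a ha => h a (Finset.mem_filter.1 ha).2
    _ = ∑ b ∈ (Finset.univ.filter p).image r, g b := by
        rw [Finset.sum_image]
        intro a ha b hb
        exact hr (by simpa using ha) (by simpa using hb)
    _ ≤ ∑ b, g b := Finset.sum_le_sum_of_subset (Finset.subset_univ _)

end PMF

/-- Exchanging `b` with the value of `f` at `a` is an involution of `β × (α → β)`, so resampling one
value of a uniform function leaves it uniform. -/
theorem PMF.mean_uniform_update {α β : Type} [Fintype β] [Nonempty β] [DecidableEq α]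
    [Fintype (α → β)] (a : α) (φ : (α → β) → ℝ≥0∞) :
    (PMF.uniformOfFintype (α → β)).mean φ = (PMF.uniformOfFintype β).mean fun b =>
      (PMF.uniformOfFintype (α → β)).mean fun f => φ (Function.update f a b) := by
  let e : β × (α → β) ≃ β × (α → β) :=
    { toFun := fun p => (p.2 a, Function.update p.2 a p.1)
      invFun := fun p => (p.2 a, Function.update p.2 a p.1)
      left_inv := fun p => by simp
      right_inv := fun p => by simp }
  have h := PMF.mean_uniform_equiv e fun p => φ p.2
  rw [PMF.mean_uniform_prod fun b f => φ (e (b, f)).2, PMF.mean_uniform_prod fun _ f => φ f] at h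
  rw [← PMF.mean_const (PMF.uniformOfFintype β) ((PMF.uniformOfFintype (α → β)).mean φ)]
  exact h.symm


/-! ### Lazy sampling of the random oracles -/

namespace GroupFamily

open PMF

variable {𝒢 : GroupFamily} {κ : ℕ}

variable (𝒢) in
/-- Fresh values of both oracles. -/
abbrev Fresh (κ : ℕ) : Type := Key κ × 𝒢.Exp κ

variable (𝒢 κ) in
/-- A list of independent fresh values. -/
noncomputable def freshList : ℕ → PMF (List (𝒢.Fresh κ))
  | 0 => PMF.pure []
  | n + 1 => (uniformOfFintype (𝒢.Fresh κ)).bind fun v => (freshList n).map fun l => v :: l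

variable (𝒢 κ) in
/-- The random choices of the simulator for one message. -/
noncomputable def tape (n : ℕ) : PMF (𝒢.Fresh κ × List (𝒢.Fresh κ)) :=
  (uniformOfFintype (𝒢.Fresh κ)).bind fun v => (𝒢.freshList κ n).map fun l => (v, l)

theorem mean_freshList_succ (n : ℕ) (φ : List (𝒢.Fresh κ) → ℝ≥0∞) :
    (𝒢.freshList κ (n + 1)).mean φ =
      (uniformOfFintype (𝒢.Fresh κ)).mean fun v => (𝒢.freshList κ n).mean fun l => φ (v :: l) := by
  rw [freshList, mean_bind]
  simp only [mean_map]

theorem mean_tape (n : ℕ) (φ : 𝒢.Fresh κ × List (𝒢.Fresh κ) → ℝ≥0∞) :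
    (𝒢.tape κ n).mean φ =
      (uniformOfFintype (𝒢.Fresh κ)).mean fun v => (𝒢.freshList κ n).mean fun l => φ (v, l) := by
  rw [tape, mean_bind]
  simp only [mean_map]

/-- Resample each of the two independent oracles at one point. This allows the fresh values of the
simulator to be treated as values of oracles fixed in advance. -/
theorem mean_oracles_set (α s : 𝒢.G κ) (φ : 𝒢.Oracles κ → ℝ≥0∞) :
    (uniformOfFintype (𝒢.Oracles κ)).mean φ = (uniformOfFintype (𝒢.Fresh κ)).mean fun v =>
      (uniformOfFintype (𝒢.Oracles κ)).mean fun H => φ (H.set α s v) := by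
  classical
  have h1 := mean_uniform_prod fun (f : 𝒢.HStar κ) (g : 𝒢.HBlind κ) => φ (f, g)
  have h2 : ∀ v : 𝒢.Fresh κ, ((uniformOfFintype (𝒢.Oracles κ)).mean fun H => φ (H.set α s v)) =
      (uniformOfFintype (𝒢.HStar κ)).mean fun f => (uniformOfFintype (𝒢.HBlind κ)).mean fun g =>
        φ (Function.update f s v.1, Function.update g (α, s) v.2) := by
    intro v
    rw [← mean_uniform_prod fun (f : 𝒢.HStar κ) (g : 𝒢.HBlind κ) =>
      φ (Function.update f s v.1, Function.update g (α, s) v.2)]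
    refine mean_congr _ fun H => congrArg φ ?_
    simp only [Oracles.set]
  refine h1.trans ?_
  simp only [h2]
  rw [mean_uniform_prod fun (k : Key κ) (e : 𝒢.Exp κ) => (uniformOfFintype (𝒢.HStar κ)).mean
    fun f => (uniformOfFintype (𝒢.HBlind κ)).mean fun g =>
        φ (Function.update f s k, Function.update g (α, s) e),
    mean_uniform_update s]
  refine mean_congr _ fun k => ?_
  refine (mean_congr (uniformOfFintype (𝒢.HStar κ)) fun f => ?_).trans (mean_comm _ _ _)
  exact mean_uniform_update (α, s) fun g => φ (Function.update f s k, g)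

/-- Lazy sampling for one question to the oracles. -/
theorem mean_ask (D : List (𝒢.Entry κ)) (α a b : 𝒢.G κ) (φ : 𝒢.Fresh κ → 𝒢.Oracles κ → ℝ≥0∞) :
    ((uniformOfFintype (𝒢.Fresh κ)).mean fun v => (uniformOfFintype (𝒢.Oracles κ)).mean fun H =>
      φ (ask D α a b v).1 (override (ask D α a b v).2 H)) =
    (uniformOfFintype (𝒢.Oracles κ)).mean fun H =>
      φ ((override D H).eval α (cdh a b)) (override D H) := by
  rw [mean_oracles_set α (cdh a b)]
  refine mean_congr _ fun v => mean_congr _ fun H => ?_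
  rw [override_ask, ask_fst D α a b v H]

/-! ### Requests -/

variable (𝒢) in
/-- The meaning of a message of the adversary. -/
inductive Request (κ : ℕ) : Type
  | refuse
  | decap (α : 𝒢.G κ)
  | hstar (s : 𝒢.G κ)
  | hblind (α s : 𝒢.G κ)
  | submit (j : ℕ) (ys : List (𝒢.G κ))

/-- Valid submissions. -/
def Valid (N j : ℕ) (ys : List (𝒢.G κ)) : Prop :=
  ys.Nodup ∧ (∀ y ∈ ys, y ≠ 1) ∧ j < ys.length + 1 ∧ ys.length + 1 < N

open Classical in
/-- The request made by a message in a state. -/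
noncomputable def parse (N : ℕ) (st : Option (𝒢.G κ)) : Val → 𝒢.Request κ
  | .pair (.nat t) m =>
      if t = 0 then
        match 𝒢.dec κ m with
        | some α => if st = some α then .refuse else .decap α
        | none => .refuse
      else if t = 1 then
        match 𝒢.dec κ m with
        | some s => .hstar s
        | none => .refuse
      else if t = 2 then
        match m with
        | .pair a b =>
          match 𝒢.dec κ a, 𝒢.dec κ b with
          | some α, some s => .hblind α s
          | _, _ => .refuse
        | _ => .refuse
      else if t = 3 then
        match m with
        | .pair (.nat j) l =>
          match st, (Val.toList l).bind (fun vs => vs.mapM (𝒢.dec κ)) with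
          | none, some ys => if Valid N j ys then .submit j ys else .refuse
          | _, _ => .refuse
        | _ => .refuse
      else .refuse
  | _ => .refuse

/-- The challenge message. -/
def chalReply (α₀ α : 𝒢.G κ) (L : List (𝒢.G κ × Key κ × 𝒢.Exp κ)) : Val :=
  .pair (𝒢.enc κ α₀) (.pair (𝒢.enc κ α)
    (Val.ofList (L.map fun t => .pair (encKey t.2.1) (𝒢.encExp t.2.2))))

/-- The oracles among the challenger's coins. -/
def Coins.oracles (c : 𝒢.Coins κ) : 𝒢.Oracles κ := (c.hs, c.hb)

/-- The layers of the challenge. -/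
def Coins.chalLayers (c : 𝒢.Coins κ) (j : ℕ) (ys : List (𝒢.G κ)) :
    List (𝒢.G κ × Key κ × 𝒢.Exp κ) :=
  𝒢.layers c j (ys.insertIdx j (𝒢.pow (𝒢.gen κ) c.x)) 0 c.x'

/-- The reply of the challenger to a request. -/
noncomputable def answer (c : 𝒢.Coins κ) (st : Option (𝒢.G κ)) :
    𝒢.Request κ → Val × Option (𝒢.G κ)
  | .refuse => (.nat 0, st)
  | .decap α =>
      (.pair (encKey (c.oracles.eval α (𝒢.pow α c.x)).1)
        (𝒢.encExp (c.oracles.eval α (𝒢.pow α c.x)).2), st)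
  | .hstar s => (encKey (c.oracles.eval 1 s).1, st)
  | .hblind α s => (𝒢.encExp (c.oracles.eval α s).2, st)
  | .submit j ys =>
      match (c.chalLayers j ys)[0]?, (c.chalLayers j ys)[j]? with
      | some l₀, some l => (chalReply l₀.1 l.1 (c.chalLayers j ys), some l.1)
      | _, _ => (.nat 0, none)

/-- Decoding, including all reasons for refusal, is separated from answering. Game and simulator
share `parse` and have to be compared only on requests. -/
theorem kemReply_eq (N : ℕ) (c : 𝒢.Coins κ) (st : Option (𝒢.G κ)) (v : Val) :
    𝒢.kemReply N c st v = answer c st (parse N st v) := by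
  unfold kemReply
  split
  · rename_i a
    simp only [parse, if_true]
    rcases 𝒢.dec κ a with _ | α
    · rfl
    · by_cases h : st = some α
      · simp only [if_pos h]
        rfl
      · simp only [if_neg h]
        rfl
  · rename_i a
    simp only [parse, if_true, one_ne_zero, if_false]
    rcases 𝒢.dec κ a with _ | s <;> rfl
  · rename_i a b
    simp only [parse, if_true, if_false, OfNat.ofNat_ne_zero, OfNat.ofNat_ne_one]
    rcases 𝒢.dec κ a with _ | α
    · rfl
    · rcases 𝒢.dec κ b with _ | s <;> rfl
  · rename_i j l
    simp only [parse, if_true, if_false, OfNat.ofNat_ne_zero, OfNat.ofNat_ne_one,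
      show (3 : ℕ) ≠ 2 by norm_num]
    rcases st with _ | st
    · rcases (Val.toList l).bind (fun vs => vs.mapM (𝒢.dec κ)) with _ | ys
      · rfl
      · dsimp only
        by_cases h : Valid N j ys
        · have h' := h
          unfold Valid at h'
          rw [if_pos h]
          unfold challenge
          rw [if_pos h']
          change (match (match (c.chalLayers j ys)[0]?, (c.chalLayers j ys)[j]? with
            | some l₀, some l => some (l.1, chalReply l₀.1 l.1 (c.chalLayers j ys))
            | _, _ => none) with
            | some (α, v) => (v, some α)
            | none => (Val.nat 0, none)) =
            (match (c.chalLayers j ys)[0]?, (c.chalLayers j ys)[j]? with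
            | some l₀, some l => (chalReply l₀.1 l.1 (c.chalLayers j ys), some l.1)
            | _, _ => (Val.nat 0, none))
          rcases (c.chalLayers j ys)[0]? with _ | l₀
          · rfl
          · rcases (c.chalLayers j ys)[j]? with _ | l <;> rfl
        · have h' := h
          unfold Valid at h'
          rw [if_neg h]
          unfold challenge
          rw [if_neg h']
          rfl
    · rfl
  · rename_i h0 h1 h2 h3
    have : parse N st v = .refuse := by
      unfold parse
      split
      · split_ifs with e0 e1 e2 e3
        · subst e0
          exact (h0 _ rfl).elim
        · subst e1
          exact (h1 _ rfl).elim
        · subst e2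
          split
          · exact (h2 _ _ rfl).elim
          · rfl
        · subst e3
          split
          · exact (h3 _ _ rfl).elim
          · rfl
        · rfl
      · rfl
    rw [this]
    rfl

end GroupFamily


open scoped ENNReal

namespace GroupFamily

open PMF

variable {𝒢 : GroupFamily} {κ : ℕ}

/-! ### The simulator -/

variable (𝒢) in
/-- A layer of a challenge whose header elements are powers of a fixed group element. -/
structure Layer (κ : ℕ) where
  exp : 𝒢.Exp κ
  pk : 𝒢.G κ
  key : Key κ
  bld : 𝒢.Exp κ

/-- The element `α_i`. -/
def Layer.hdr (X : 𝒢.G κ) (l : 𝒢.Layer κ) : 𝒢.G κ := 𝒢.pow X l.exp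

/-- The element `s_i`. -/
noncomputable def Layer.val (X : 𝒢.G κ) (l : 𝒢.Layer κ) : 𝒢.G κ := cdh l.pk (l.hdr X)

/-- The data of a layer in the game. -/
def Layer.data (X : 𝒢.G κ) (l : 𝒢.Layer κ) : 𝒢.G κ × Key κ × 𝒢.Exp κ := (l.hdr X, l.key, l.bld)

/-- The layers of a challenge for fixed oracles. -/
noncomputable def pathLayers (X : 𝒢.G κ) (H : 𝒢.Oracles κ) :
    List (𝒢.G κ) → 𝒢.Exp κ → List (𝒢.Layer κ)
  | [], _ => []
  | y :: ys, c =>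
      let v := H.eval (𝒢.pow X c) (cdh y (𝒢.pow X c))
      ⟨c, y, v.1, v.2⟩ :: pathLayers X H ys (c * v.2)

/-- The layers of a challenge with values from the log and fresh values; also the new log. -/
noncomputable def simLayers (X : 𝒢.G κ) :
    List (𝒢.G κ) → 𝒢.Exp κ → List (𝒢.Entry κ) → List (𝒢.Fresh κ) →
      List (𝒢.Layer κ) × List (𝒢.Entry κ)
  | y :: ys, c, D, v :: vs =>
      let r := ask D (𝒢.pow X c) y (𝒢.pow X c) v
      let R := simLayers X ys (c * r.1.2) r.2 vs
      (⟨c, y, r.1.1, r.1.2⟩ :: R.1, R.2)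
  | _, _, D, _ => ([], D)

variable (𝒢) in
/-- What is remembered of the challenge: `α_j` and its exponent, the exponent of `α_0`, and the keys
and the blinding factor of layer `j`. -/
structure Chal (κ : ℕ) where
  hdr : 𝒢.G κ
  exp : 𝒢.Exp κ
  rho : 𝒢.Exp κ
  key : Key κ
  bld : 𝒢.Exp κ

variable (𝒢) in
/-- The state of the simulator: the log, the challenge, the element `s_j` if the adversary asked for
it, and whether there was a coincidence among the points of the oracles at the challenge. -/
structure SimState (κ : ℕ) where
  log : List (𝒢.Entry κ)
  chal : Option (𝒢.Chal κ)
  found : Option (𝒢.G κ)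
  bad : Prop

/-- The coincidence among the points of the oracles. -/
def Coincidence (X : 𝒢.G κ) (D : List (𝒢.Entry κ)) (L : List (𝒢.Layer κ)) : Prop :=
  ¬((L.map (Layer.val X)).Nodup ∧ ∀ s ∈ L.map (Layer.val X), s ∉ D.map Entry.val)

open Classical in
/-- Remember the solution of the Diffie-Hellman problem. -/
noncomputable def SimState.noteVal (P : 𝒢.G κ) (st : 𝒢.SimState κ) (s : 𝒢.G κ) :
    Option (𝒢.G κ) :=
  match st.chal with
  | some ch => if s = cdh P ch.hdr then some s else st.found
  | none => st.found

/-- The reply of the simulator with public key `P` and challenge element `X`. -/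
noncomputable def simAnswer (P X : 𝒢.G κ) (u : 𝒢.Fresh κ × List (𝒢.Fresh κ)) (st : 𝒢.SimState κ) :
    𝒢.Request κ → Val × 𝒢.SimState κ
  | .refuse => (.nat 0, st)
  | .decap α =>
      let r := ask st.log α P α u.1
      (.pair (encKey r.1.1) (𝒢.encExp r.1.2), { st with log := r.2 })
  | .hstar s =>
      -- Since `cdh g s = s`, an explicit point enters the log in the same form as the implicit
      -- ones. The header 1 is arbitrary: `h_b(1, s)` is sampled along with `h_*(s)` but not
      -- disclosed here.
      let r := ask st.log 1 (𝒢.gen κ) s u.1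
      (encKey r.1.1, { st with log := r.2, found := st.noteVal P s })
  | .hblind α s =>
      let r := ask st.log α (𝒢.gen κ) s u.1
      (𝒢.encExp r.1.2, { st with log := r.2, found := st.noteVal P s })
  | .submit j ys =>
      -- The blinding part of the first fresh value serves as `ρ`; the list supplies the values for
      -- the layers.
      let R := simLayers X (ys.insertIdx j P) u.1.2 st.log u.2
      match R.1[0]?, R.1[j]? with
      | some l₀, some l =>
          (chalReply (l₀.hdr X) (l.hdr X) (R.1.map (Layer.data X)),
            ⟨R.2, some ⟨l.hdr X, l.exp, u.1.2, l.key, l.bld⟩, st.found,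
              st.bad ∨ Coincidence X st.log R.1⟩)
      | _, _ => (.nat 0, st)

/-- The element `α_j` if there is a challenge. -/
def SimState.hdr (st : 𝒢.SimState κ) : Option (𝒢.G κ) := st.chal.map Chal.hdr

/-- The simulator as an environment. -/
noncomputable def simulator (N : ℕ) (P X : 𝒢.G κ) : Env (𝒢.SimState κ) := fun st v =>
  (𝒢.tape κ N).map fun u => simAnswer P X u st (parse N st.hdr v)

/-- The challenger with its coins as part of the state. -/
noncomputable def challenger (𝒢 : GroupFamily) (κ N : ℕ) : Env (𝒢.Coins κ × Option (𝒢.G κ)) :=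
  fun s v => PMF.pure ((𝒢.kemReply N s.1 s.2 v).1, s.1, (𝒢.kemReply N s.1 s.2 v).2)

/-- The coins never change, so a point mass is a kernel between the two environments. With the coins
in the state, their conditional distribution given the simulator's state can be expressed as a
kernel as well. -/
theorem wp_challenger (N : ℕ) (c : 𝒢.Coins κ) (st : Option (𝒢.G κ)) (p : Prog) (v : Val) (T : ℕ)
    (φ : Val → ℝ≥0∞) :
    Exec.wp (p.run (𝒢.challenger κ N) v) T (c, st) (fun a _ _ => φ a) =
      Exec.wp (p.run (𝒢.kemChallenger N c) v) T st (fun a _ _ => φ a) := by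
  have h := Prog.wp_run_kernel_eq (𝒢.challenger κ N) (𝒢.kemChallenger N c)
    (fun st s => PMF.pure (c, st) s) (fun st v ψ => ?_) p v T st (fun a _ _ => φ a)
  · simp only [Exec.tsum_pure_mul (α := 𝒢.Coins κ × Option (𝒢.G κ))] at h
    exact h.symm
  · simp only [challenger, kemChallenger, Exec.tsum_pure_mul (α := Val × Option (𝒢.G κ)),
      Exec.tsum_pure_mul (α := 𝒢.Coins κ × Option (𝒢.G κ)),
      Exec.tsum_pure_mul (α := Val × 𝒢.Coins κ × Option (𝒢.G κ))]

/-! ### Layers with eager and with lazy oracles -/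

/-- Lazy sampling for a path. -/
theorem mean_simLayers (X : 𝒢.G κ) (ys : List (𝒢.G κ)) (c : 𝒢.Exp κ) (D : List (𝒢.Entry κ)) (n : ℕ)
    (hn : ys.length ≤ n) (φ : List (𝒢.Layer κ) → 𝒢.Oracles κ → ℝ≥0∞) :
    ((𝒢.freshList κ n).mean fun vs => (uniformOfFintype (𝒢.Oracles κ)).mean fun H =>
      φ (simLayers X ys c D vs).1 (override (simLayers X ys c D vs).2 H)) =
    (uniformOfFintype (𝒢.Oracles κ)).mean fun H =>
      φ (pathLayers X (override D H) ys c) (override D H) := by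
  induction ys generalizing c D n φ with
  | nil =>
    simp only [simLayers, pathLayers]
    exact mean_const _ _
  | cons y ys ih =>
    obtain ⟨n, rfl⟩ : ∃ m, n = m + 1 := ⟨n - 1, by simp at hn; omega⟩
    rw [mean_freshList_succ]
    simp only [simLayers]
    have h1 : ∀ v : 𝒢.Fresh κ, _ := fun v =>
      ih (c * (ask D (𝒢.pow X c) y (𝒢.pow X c) v).1.2) (ask D (𝒢.pow X c) y (𝒢.pow X c) v).2 n
        (by simpa using hn) fun L H => φ (⟨c, y, (ask D (𝒢.pow X c) y (𝒢.pow X c) v).1.1,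
          (ask D (𝒢.pow X c) y (𝒢.pow X c) v).1.2⟩ :: L) H
    simp only [h1]
    -- What remains is one question: the later layers are a function of its answer and of the
    -- overridden oracles.
    exact mean_ask D (𝒢.pow X c) y (𝒢.pow X c) fun w H =>
      φ (⟨c, y, w.1, w.2⟩ :: pathLayers X H ys (c * w.2)) H

theorem length_pathLayers (X : 𝒢.G κ) (H : 𝒢.Oracles κ) (ys : List (𝒢.G κ)) (c : 𝒢.Exp κ) :
    (pathLayers X H ys c).length = ys.length := by
  induction ys generalizing c with
  | nil => rfl
  | cons y ys ih => simp [pathLayers, ih]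

theorem pathLayers_pk (X : 𝒢.G κ) (H : 𝒢.Oracles κ) (ys : List (𝒢.G κ)) (c : 𝒢.Exp κ) :
    (pathLayers X H ys c).map Layer.pk = ys := by
  induction ys generalizing c with
  | nil => rfl
  | cons y ys ih => simp [pathLayers, ih]

theorem pathLayers_eval (X : 𝒢.G κ) (H : 𝒢.Oracles κ) (ys : List (𝒢.G κ)) (c : 𝒢.Exp κ) :
    ∀ l ∈ pathLayers X H ys c, H.eval (l.hdr X) (l.val X) = (l.key, l.bld) := by
  induction ys generalizing c with
  | nil => simp [pathLayers]
  | cons y ys ih =>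
    intro l hl
    simp only [pathLayers, List.mem_cons] at hl
    rcases hl with rfl | hl
    · rfl
    · exact ih _ l hl

/-- The layers of the game, in terms of a path computed from possibly different oracles. -/
theorem layers_eq (x₂ : 𝒢.Exp κ) (co : 𝒢.Coins κ) (j : ℕ) (H : 𝒢.Oracles κ) (ys : List (𝒢.G κ))
    (i : ℕ) (c : 𝒢.Exp κ)
    (h : ∀ m l, (pathLayers (𝒢.pow (𝒢.gen κ) x₂) H ys c)[m]? = some l →
      (if i + m = j ∧ co.bit = true then (co.r, co.bj) else
        co.oracles.eval (l.hdr (𝒢.pow (𝒢.gen κ) x₂)) (l.val (𝒢.pow (𝒢.gen κ) x₂))) =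
          (l.key, l.bld)) :
    𝒢.layers co j ys i (x₂ * c) =
      (pathLayers (𝒢.pow (𝒢.gen κ) x₂) H ys c).map (Layer.data (𝒢.pow (𝒢.gen κ) x₂)) := by
  induction ys generalizing i c with
  | nil => rfl
  | cons y ys ih =>
    have h0 := h 0 _ rfl
    have hs : ∀ m l, (pathLayers (𝒢.pow (𝒢.gen κ) x₂) H ys (c * (H.eval (𝒢.pow (𝒢.pow (𝒢.gen κ) x₂) c)
        (cdh y (𝒢.pow (𝒢.pow (𝒢.gen κ) x₂) c))).2))[m]? = some l →
      (if i + 1 + m = j ∧ co.bit = true then (co.r, co.bj) else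
        co.oracles.eval (l.hdr (𝒢.pow (𝒢.gen κ) x₂)) (l.val (𝒢.pow (𝒢.gen κ) x₂))) =
          (l.key, l.bld) := by
      intro m l hl
      rw [add_assoc, add_comm 1 m]
      exact h (m + 1) l hl
    have e1 : 𝒢.pow (𝒢.pow (𝒢.gen κ) x₂) c = 𝒢.pow (𝒢.gen κ) (x₂ * c) := pow_pow _ _ _
    have e2 : cdh y (𝒢.pow (𝒢.pow (𝒢.gen κ) x₂) c) = 𝒢.pow y (x₂ * c) := by
      rw [e1, cdh_comm, cdh_gen_pow]
    have e3 : (if i = j ∧ co.bit = true then (co.r, co.bj)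
        else (𝒢.encap co.hs co.hb y (x₂ * c)).1) = H.eval (𝒢.pow (𝒢.pow (𝒢.gen κ) x₂) c)
        (cdh y (𝒢.pow (𝒢.pow (𝒢.gen κ) x₂) c)) := by
      refine Eq.trans ?_ (h0.trans rfl)
      simp only [add_zero]
      congr 1
      simp only [encap, Layer.hdr, Layer.val, Coins.oracles, Oracles.eval, e2]
      rw [e1]
    simp only [layers, pathLayers, List.map_cons, e3]
    rw [mul_assoc, ih (i + 1) _ hs]
    simp only [Layer.data, Layer.hdr, e1, encap]

end GroupFamily


/-! ### The conditional distribution of the coins; real keys -/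

open scoped ENNReal

namespace GroupFamily

open PMF

variable {𝒢 : GroupFamily} {κ : ℕ}

/-- The two rules of the game that the proof relies on: there is only one challenge, of valid form,
and its header at position `j` is not decapsulated afterwards. -/
theorem parse_spec (N : ℕ) (st : Option (𝒢.G κ)) (v : Val) :
    (∀ j ys, parse N st v = .submit j ys → st = none ∧ Valid N j ys) ∧
      ∀ α, parse N st v = .decap α → st ≠ some α := by
  unfold parse
  split
  · split_ifs
    · split
      · split_ifs with h
        · simp
        · refine ⟨by simp, fun α e => ?_⟩
          rw [Request.decap.injEq] at e
          rwa [← e]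
      · simp
    · split <;> simp
    · split
      · split <;> simp
      · simp
    · split
      · split
        · split_ifs with h
          · refine ⟨fun j ys e => ?_, by simp⟩
            rw [Request.submit.injEq] at e
            rw [← e.1, ← e.2]
            exact ⟨rfl, h⟩
          · simp
        · simp
      · simp
    · simp
  · simp

/-- The challenger's coins with given oracles. -/
def coinsOf (x : 𝒢.Exp κ) (H : 𝒢.Oracles κ) (x' : 𝒢.Exp κ) (bit : Bool) (rb : 𝒢.Fresh κ) :
    𝒢.Coins κ :=
  ⟨x, H.1, H.2, x', bit, rb.1, rb.2⟩

/-- The distribution of the exponent of the challenge header. -/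
noncomputable def SimState.headDist (x₂ : 𝒢.Exp κ) (st : 𝒢.SimState κ) : PMF (𝒢.Exp κ) :=
  match st.chal with
  | none => uniformOfFintype _
  | some ch => PMF.pure (x₂ * ch.rho)

/-- The distribution of the challenger's coins given the simulator's state, if the random key and
blinding factor are not used. -/
noncomputable def posterior (x x₂ : 𝒢.Exp κ) (bit : Bool) (st : 𝒢.SimState κ) :
    PMF (𝒢.Coins κ × Option (𝒢.G κ)) :=
  (st.headDist x₂).bind fun x' => (uniformOfFintype (𝒢.Oracles κ)).bind fun H =>
    (uniformOfFintype (𝒢.Fresh κ)).map fun rb =>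
      (coinsOf x (override st.log H) x' bit rb, st.hdr)

theorem mean_posterior (x x₂ : 𝒢.Exp κ) (bit : Bool) (st : 𝒢.SimState κ)
    (ψ : 𝒢.Coins κ × Option (𝒢.G κ) → ℝ≥0∞) :
    (posterior x x₂ bit st).mean ψ = (st.headDist x₂).mean fun x' =>
      (uniformOfFintype (𝒢.Oracles κ)).mean fun H => (uniformOfFintype (𝒢.Fresh κ)).mean fun rb =>
        ψ (coinsOf x (override st.log H) x' bit rb, st.hdr) := by
  simp only [posterior, mean_bind, mean_map]

/-- Bayes' rule in integrated form: averaging the updated distribution of the coins over the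
simulator's answer gives back the old distribution, with the answer read off the oracles. The
exponent of the header is independent of the log, so this is `mean_ask`. -/
theorem mean_posterior_ask (x x₂ : 𝒢.Exp κ) (bit : Bool) (st : 𝒢.SimState κ) (α a b : 𝒢.G κ)
    (f : Option (𝒢.G κ)) (ψ : 𝒢.Fresh κ → 𝒢.Coins κ × Option (𝒢.G κ) → ℝ≥0∞) :
    ((uniformOfFintype (𝒢.Fresh κ)).mean fun v =>
      (posterior x x₂ bit { st with log := (ask st.log α a b v).2, found := f }).mean
        (ψ (ask st.log α a b v).1)) =
    (posterior x x₂ bit st).mean fun s => ψ (s.1.oracles.eval α (cdh a b)) s := by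
  simp only [mean_posterior]
  change ((uniformOfFintype (𝒢.Fresh κ)).mean fun v => (st.headDist x₂).mean fun x' => _) = _
  rw [mean_comm]
  refine mean_congr _ fun x' => ?_
  exact mean_ask st.log α a b fun w H => (uniformOfFintype (𝒢.Fresh κ)).mean fun rb =>
    ψ w (coinsOf x H x' bit rb, st.hdr)

/-- The distribution of the challenger's coins given the simulator's state, if the random key and
blinding factor are used in the challenge. -/
noncomputable def posteriorRandom (x x₂ : 𝒢.Exp κ) (st : 𝒢.SimState κ) :
    PMF (𝒢.Coins κ × Option (𝒢.G κ)) :=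
  match st.chal with
  | none => posterior x x₂ true st
  | some ch => (uniformOfFintype (𝒢.Oracles κ)).bind fun H =>
      (uniformOfFintype (𝒢.Fresh κ)).map fun v =>
        (coinsOf x ((override st.log H).set ch.hdr (cdh (𝒢.pow (𝒢.gen κ) x) ch.hdr) v)
          (x₂ * ch.rho) true (ch.key, ch.bld), some ch.hdr)

theorem mean_posteriorRandom (x x₂ : 𝒢.Exp κ) (st : 𝒢.SimState κ) {ch : 𝒢.Chal κ}
    (hc : st.chal = some ch) (ψ : 𝒢.Coins κ × Option (𝒢.G κ) → ℝ≥0∞) :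
    (posteriorRandom x x₂ st).mean ψ = (uniformOfFintype (𝒢.Oracles κ)).mean fun H =>
      (uniformOfFintype (𝒢.Fresh κ)).mean fun v =>
        ψ (coinsOf x ((override st.log H).set ch.hdr (cdh (𝒢.pow (𝒢.gen κ) x) ch.hdr) v)
          (x₂ * ch.rho) true (ch.key, ch.bld), some ch.hdr) := by
  simp only [posteriorRandom, hc, mean_bind, mean_map]

/-- After the challenge the oracles of the random game agree with the overridden ones except at
`(α_j, s_j)`, where they have a fresh value that was never shown. A question at another point does
not see the difference. -/
theorem mean_posteriorRandom_ask (x x₂ : 𝒢.Exp κ) (st : 𝒢.SimState κ) (α a b : 𝒢.G κ)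
    (f : Option (𝒢.G κ)) (ψ : 𝒢.Fresh κ → 𝒢.Coins κ × Option (𝒢.G κ) → ℝ≥0∞)
    (h : ∀ ch, st.chal = some ch → cdh a b ≠ cdh (𝒢.pow (𝒢.gen κ) x) ch.hdr) :
    ((uniformOfFintype (𝒢.Fresh κ)).mean fun v =>
      (posteriorRandom x x₂ { st with log := (ask st.log α a b v).2, found := f }).mean
        (ψ (ask st.log α a b v).1)) =
    (posteriorRandom x x₂ st).mean fun s => ψ (s.1.oracles.eval α (cdh a b)) s := by
  rcases Option.eq_none_or_eq_some st.chal with hc | ⟨ch, hc⟩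
  · have := mean_posterior_ask x x₂ true st α a b f ψ
    simpa only [posteriorRandom, hc] using this
  · rw [mean_posteriorRandom x x₂ st hc]
    have h1 : ∀ v, (posteriorRandom x x₂ { st with log := (ask st.log α a b v).2, found := f }).mean
        (ψ (ask st.log α a b v).1) = _ :=
      fun v => mean_posteriorRandom x x₂ { st with log := (ask st.log α a b v).2, found := f } hc _
    simp only [h1]
    have h2 := mean_ask st.log α a b fun w H => (uniformOfFintype (𝒢.Fresh κ)).mean fun v =>
      ψ w (coinsOf x (H.set ch.hdr (cdh (𝒢.pow (𝒢.gen κ) x) ch.hdr) v) (x₂ * ch.rho) true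
        (ch.key, ch.bld), some ch.hdr)
    refine h2.trans (mean_congr _ fun H => mean_congr _ fun v => ?_)
    rw [← eval_set_of_ne _ ch.hdr _ v α (h ch hc)]
    rfl

/-- The exponents `ρ` and `x₂ ρ` are equally distributed. -/
theorem mean_exp_mul (x₂ : 𝒢.Exp κ) (φ : 𝒢.Exp κ → ℝ≥0∞) :
    ((uniformOfFintype (𝒢.Exp κ)).mean fun ρ => φ (x₂ * ρ)) =
      (uniformOfFintype (𝒢.Exp κ)).mean φ :=
  mean_uniform_equiv (Equiv.mulLeft x₂) φ

theorem mean_fresh_snd (φ : 𝒢.Exp κ → ℝ≥0∞) :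
    ((uniformOfFintype (𝒢.Fresh κ)).mean fun v => φ v.2) =
      (uniformOfFintype (𝒢.Exp κ)).mean φ := by
  rw [mean_uniform_prod fun _ e => φ e]
  exact mean_const _ _

theorem length_insertIdx_le {N j : ℕ} {ys : List (𝒢.G κ)} (h : Valid N j ys) (P : 𝒢.G κ) :
    (ys.insertIdx j P).length ≤ N ∧ j < (ys.insertIdx j P).length := by
  have h3 := h.2.2.1
  have h4 := h.2.2.2
  rw [List.length_insertIdx]
  split_ifs <;> omega

theorem exists_layers {N j : ℕ} {ys : List (𝒢.G κ)} (h : Valid N j ys) (P X : 𝒢.G κ)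
    (H : 𝒢.Oracles κ) (c : 𝒢.Exp κ) :
    ∃ l₀ l, (pathLayers X H (ys.insertIdx j P) c)[0]? = some l₀ ∧
      (pathLayers X H (ys.insertIdx j P) c)[j]? = some l ∧ l.pk = P := by
  have hlen := (length_insertIdx_le h P).2
  have hL := length_pathLayers X H (ys.insertIdx j P) c
  refine ⟨_, _, List.getElem?_eq_getElem (by omega), List.getElem?_eq_getElem (by omega), ?_⟩
  have h1 := pathLayers_pk X H (ys.insertIdx j P) c
  have h2 : (pathLayers X H (ys.insertIdx j P) c)[j].pk =
      ((pathLayers X H (ys.insertIdx j P) c).map Layer.pk)[j]'(by simp; omega) := by simp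
  rw [h2]
  simp only [h1]
  exact List.getElem_insertIdx_self (by omega)

/-- The simulator is a lazy version of the game with the real keys. -/
theorem simulator_posterior (N : ℕ) (x x₂ : 𝒢.Exp κ) (st : 𝒢.SimState κ) (v : Val)
    (ψ : Val → 𝒢.Coins κ × Option (𝒢.G κ) → ℝ≥0∞) :
    ((simulator N (𝒢.pow (𝒢.gen κ) x) (𝒢.pow (𝒢.gen κ) x₂) st v).mean fun r =>
      (posterior x x₂ false r.2).mean (ψ r.1)) =
    (posterior x x₂ false st).mean fun s => ψ (𝒢.kemReply N s.1 s.2 v).1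
      (s.1, (𝒢.kemReply N s.1 s.2 v).2) := by
  simp only [simulator, mean_map, kemReply_eq]
  have hr : (posterior x x₂ false st).mean (fun s => ψ (answer s.1 s.2 (parse N s.2 v)).1
      (s.1, (answer s.1 s.2 (parse N s.2 v)).2)) = (posterior x x₂ false st).mean
      (fun s => ψ (answer s.1 st.hdr (parse N st.hdr v)).1
        (s.1, (answer s.1 st.hdr (parse N st.hdr v)).2)) := by
    simp only [mean_posterior]
  rw [hr]
  have hspec := parse_spec N st.hdr v
  have hst : ∀ φ : Val → 𝒢.Coins κ × Option (𝒢.G κ) → ℝ≥0∞, ∀ g : 𝒢.Oracles κ → Val,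
      ((posterior x x₂ false st).mean fun s => φ (g s.1.oracles) s) =
        (posterior x x₂ false st).mean fun s => φ (g s.1.oracles) (s.1, st.hdr) := by
    intro φ g
    simp only [mean_posterior]
  rcases hp : parse N st.hdr v with _ | α | s | ⟨α, s⟩ | ⟨j, ys⟩
  · simp only [simAnswer, answer, mean_const]
    exact hst ψ fun _ => .nat 0
  · simp only [simAnswer, answer, mean_tape, mean_const]
    have h := mean_posterior_ask x x₂ false st α (𝒢.pow (𝒢.gen κ) x) α st.found fun w =>
      ψ (.pair (encKey w.1) (𝒢.encExp w.2))
    refine h.trans ?_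
    simp only [mean_posterior, cdh_gen_pow]
    rfl
  · simp only [simAnswer, answer, mean_tape, mean_const]
    have h := mean_posterior_ask x x₂ false st 1 (𝒢.gen κ) s
      (st.noteVal (𝒢.pow (𝒢.gen κ) x) s) fun w => ψ (encKey w.1)
    refine h.trans ?_
    simp only [mean_posterior, cdh_gen]
  · simp only [simAnswer, answer, mean_tape, mean_const]
    have h := mean_posterior_ask x x₂ false st α (𝒢.gen κ) s
      (st.noteVal (𝒢.pow (𝒢.gen κ) x) s) fun w => ψ (𝒢.encExp w.2)
    refine h.trans ?_
    simp only [mean_posterior, cdh_gen]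
  · obtain ⟨hnone, hval⟩ := hspec.1 j ys hp
    have hch : st.chal = none := by
      simpa [SimState.hdr] using hnone
    set P := 𝒢.pow (𝒢.gen κ) x with hP
    set X := 𝒢.pow (𝒢.gen κ) x₂ with hX
    -- Everything is written as a function of the layers and the oracles, as `mean_simLayers`
    -- requires. The fallback value is irrelevant: `exists_layers` excludes it once the layers are
    -- those of a path.
    let Φ (ρ : 𝒢.Exp κ) (L : List (𝒢.Layer κ)) (H : 𝒢.Oracles κ) : ℝ≥0∞ :=
      match L[0]?, L[j]? with
      | some l₀, some l => (uniformOfFintype (𝒢.Fresh κ)).mean fun rb =>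
          ψ (chalReply (l₀.hdr X) (l.hdr X) (L.map (Layer.data X)))
            (coinsOf x H (x₂ * ρ) false rb, some (l.hdr X))
      | _, _ => (posterior x x₂ false st).mean (ψ (.nat 0))
    have hl := length_insertIdx_le hval P
    have hΦ : ∀ (ρ : 𝒢.Exp κ) (k : Key κ) (vs : List (𝒢.Fresh κ)),
        (posterior x x₂ false (simAnswer P X ((k, ρ), vs) st (.submit j ys)).2).mean
          (ψ (simAnswer P X ((k, ρ), vs) st (.submit j ys)).1) =
        (uniformOfFintype (𝒢.Oracles κ)).mean fun H =>
          Φ ρ (simLayers X (ys.insertIdx j P) ρ st.log vs).1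
            (override (simLayers X (ys.insertIdx j P) ρ st.log vs).2 H) := by
      intro ρ k vs
      simp only [simAnswer, Φ]
      rcases (simLayers X (ys.insertIdx j P) ρ st.log vs).1[0]? with _ | l₀
      · simp only [mean_const]
      · rcases (simLayers X (ys.insertIdx j P) ρ st.log vs).1[j]? with _ | l
        · simp only [mean_const]
        · simp only [mean_posterior, SimState.headDist, mean_pure]
          rfl
    have h1 : ((𝒢.tape κ N).mean fun u =>
        (posterior x x₂ false (simAnswer P X u st (.submit j ys)).2).mean
          (ψ (simAnswer P X u st (.submit j ys)).1)) =
        (uniformOfFintype (𝒢.Exp κ)).mean fun ρ => (uniformOfFintype (𝒢.Oracles κ)).mean fun H =>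
          Φ ρ (pathLayers X (override st.log H) (ys.insertIdx j P) ρ) (override st.log H) := by
      rw [mean_tape, ← mean_fresh_snd]
      refine mean_congr _ fun v => ?_
      rw [← mean_simLayers X (ys.insertIdx j P) v.2 st.log N hl.1 (Φ v.2)]
      exact mean_congr _ fun vs => hΦ v.2 v.1 vs
    rw [h1, mean_posterior]
    simp only [SimState.headDist, hch]
    -- Substitute `x' = x₂ ρ` on the side of the challenger, whose exponent is still uniform before
    -- the challenge.
    refine Eq.trans ?_ (mean_exp_mul x₂ _)
    refine mean_congr _ fun ρ => mean_congr _ fun H => ?_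
    obtain ⟨l₀, l, h0, hj, -⟩ := exists_layers hval P X (override st.log H) ρ
    simp only [Φ, h0, hj]
    refine mean_congr _ fun rb => ?_
    have hlay : (coinsOf x (override st.log H) (x₂ * ρ) false rb).chalLayers j ys =
        (pathLayers X (override st.log H) (ys.insertIdx j P) ρ).map (Layer.data X) := by
      refine layers_eq x₂ _ j (override st.log H) _ 0 ρ fun m l hl => ?_
      rw [if_neg (by simp [coinsOf])]
      exact pathLayers_eval _ _ _ _ l (List.mem_of_getElem? hl)
    simp only [answer, hlay, List.getElem?_map, h0, hj, Option.map_some, Layer.data]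

end GroupFamily


/-! ### The game with random keys, on good states -/

open scoped ENNReal

namespace GroupFamily

open PMF

variable {𝒢 : GroupFamily} {κ : ℕ}

/-- The adversary neither asked for `s_j`, nor was there a coincidence. -/
def SimState.Good (st : 𝒢.SimState κ) : Prop := st.found = none ∧ ¬st.bad

theorem SimState.noteVal_eq_none {P : 𝒢.G κ} {st : 𝒢.SimState κ} {s : 𝒢.G κ}
    (h : st.noteVal P s = none) :
    st.found = none ∧ ∀ ch, st.chal = some ch → s ≠ cdh P ch.hdr := by
  unfold SimState.noteVal at h
  rcases hc : st.chal with _ | ch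
  · simp only [hc] at h
    exact ⟨h, by simp⟩
  · simp only [hc] at h
    split_ifs at h with h'
    refine ⟨h, fun ch' e => ?_⟩
    rw [Option.some.injEq] at e
    rwa [← e]

/-- Neither a found solution nor a coincidence is ever forgotten, so a state that is not good
contributes nothing later. -/
theorem good_of_simAnswer (P X : 𝒢.G κ) (u : 𝒢.Fresh κ × List (𝒢.Fresh κ)) (st : 𝒢.SimState κ)
    (r : 𝒢.Request κ) (h : (simAnswer P X u st r).2.Good) : st.Good := by
  rcases r with _ | α | s | ⟨α, s⟩ | ⟨j, ys⟩
  · exact h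
  · exact h
  · exact ⟨(SimState.noteVal_eq_none h.1).1, h.2⟩
  · exact ⟨(SimState.noteVal_eq_none h.1).1, h.2⟩
  · simp only [simAnswer] at h
    split at h
    · exact ⟨h.1, fun hb => h.2 (.inl hb)⟩
    · exact h

open Classical in
/-- The mean over the challenger's coins, or zero if the state is not good. -/
noncomputable def goodMean (x x₂ : 𝒢.Exp κ) (st : 𝒢.SimState κ)
    (ψ : 𝒢.Coins κ × Option (𝒢.G κ) → ℝ≥0∞) : ℝ≥0∞ :=
  if st.Good then (posteriorRandom x x₂ st).mean ψ else 0

theorem goodMean_of_chal (x x₂ : 𝒢.Exp κ) (D : List (𝒢.Entry κ)) (ch : 𝒢.Chal κ)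
    {f : Option (𝒢.G κ)} {b : Prop} (hf : f = none) (hb : ¬b)
    (ψ : 𝒢.Coins κ × Option (𝒢.G κ) → ℝ≥0∞) :
    goodMean x x₂ ⟨D, some ch, f, b⟩ ψ = (uniformOfFintype (𝒢.Oracles κ)).mean fun H =>
      (uniformOfFintype (𝒢.Fresh κ)).mean fun v =>
        ψ (coinsOf x ((override D H).set ch.hdr (cdh (𝒢.pow (𝒢.gen κ) x) ch.hdr) v)
          (x₂ * ch.rho) true (ch.key, ch.bld), some ch.hdr) := by
  rw [goodMean, if_pos ⟨hf, hb⟩, mean_posteriorRandom x x₂ _ rfl]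

theorem goodMean_of_bad (x x₂ : 𝒢.Exp κ) (st : 𝒢.SimState κ) (h : st.bad)
    (ψ : 𝒢.Coins κ × Option (𝒢.G κ) → ℝ≥0∞) : goodMean x x₂ st ψ = 0 :=
  if_neg fun hg => hg.2 h

/-- One question to the oracles in the game with the random keys. -/
theorem mean_goodMean_ask_le (x x₂ : 𝒢.Exp κ) (st : 𝒢.SimState κ) (hst : st.Good)
    (α a b : 𝒢.G κ) (f : Option (𝒢.G κ))
    (ψ : 𝒢.Fresh κ → 𝒢.Coins κ × Option (𝒢.G κ) → ℝ≥0∞)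
    (h : f = none → ∀ ch, st.chal = some ch → cdh a b ≠ cdh (𝒢.pow (𝒢.gen κ) x) ch.hdr) :
    ((uniformOfFintype (𝒢.Fresh κ)).mean fun v =>
      goodMean x x₂ { st with log := (ask st.log α a b v).2, found := f }
        (ψ (ask st.log α a b v).1)) ≤
    goodMean x x₂ st fun s => ψ (s.1.oracles.eval α (cdh a b)) s := by
  rw [goodMean, if_pos hst]
  by_cases hf : f = none
  · have hg : ∀ v, ({ st with log := (ask st.log α a b v).2, found := f } : 𝒢.SimState κ).Good :=
      fun v => ⟨hf, hst.2⟩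
    simp only [goodMean, hg, if_true]
    exact (mean_posteriorRandom_ask x x₂ st α a b f ψ (h hf)).le
  -- A solution has been found: the run leaves the good states and its mass is dropped.
  · have hg : ∀ v, ¬({ st with log := (ask st.log α a b v).2, found := f } : 𝒢.SimState κ).Good :=
      fun v h => hf h.1
    simp only [goodMean, hg, if_false, mean_const]
    exact zero_le

/-- The challenge with real keys, if there is no coincidence, is a challenge with random keys. -/
theorem mean_challenge_le (x x₂ ρ : 𝒢.Exp κ) (D : List (𝒢.Entry κ)) (N j : ℕ) (ys : List (𝒢.G κ))
    (hval : Valid N j ys) (st : Option (𝒢.G κ))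
    (ψ : Val → 𝒢.Coins κ × Option (𝒢.G κ) → ℝ≥0∞) (Φ : 𝒢.Oracles κ → 𝒢.Fresh κ → ℝ≥0∞)
    (h0 : ∀ H v, Coincidence (𝒢.pow (𝒢.gen κ) x₂) D (pathLayers (𝒢.pow (𝒢.gen κ) x₂)
      (override D H) (ys.insertIdx j (𝒢.pow (𝒢.gen κ) x)) ρ) → Φ H v = 0)
    (h1 : ∀ H v l₀ l, (pathLayers (𝒢.pow (𝒢.gen κ) x₂) (override D H)
        (ys.insertIdx j (𝒢.pow (𝒢.gen κ) x)) ρ)[0]? = some l₀ →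
      (pathLayers (𝒢.pow (𝒢.gen κ) x₂) (override D H)
        (ys.insertIdx j (𝒢.pow (𝒢.gen κ) x)) ρ)[j]? = some l →
      Φ H v = ψ (chalReply (l₀.hdr (𝒢.pow (𝒢.gen κ) x₂)) (l.hdr (𝒢.pow (𝒢.gen κ) x₂))
        ((pathLayers (𝒢.pow (𝒢.gen κ) x₂) (override D H)
          (ys.insertIdx j (𝒢.pow (𝒢.gen κ) x)) ρ).map (Layer.data (𝒢.pow (𝒢.gen κ) x₂))))
        (coinsOf x ((override D H).set (l.hdr (𝒢.pow (𝒢.gen κ) x₂))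
          (cdh (𝒢.pow (𝒢.gen κ) x) (l.hdr (𝒢.pow (𝒢.gen κ) x₂))) v) (x₂ * ρ) true (l.key, l.bld),
          some (l.hdr (𝒢.pow (𝒢.gen κ) x₂))) ∨ Φ H v = 0) :
    ((uniformOfFintype (𝒢.Oracles κ)).mean fun H => (uniformOfFintype (𝒢.Fresh κ)).mean fun v =>
      Φ H v) ≤
    (uniformOfFintype (𝒢.Oracles κ)).mean fun H => (uniformOfFintype (𝒢.Fresh κ)).mean fun v =>
      ψ (answer (coinsOf x (override D H) (x₂ * ρ) true v) st (.submit j ys)).1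
        (coinsOf x (override D H) (x₂ * ρ) true v,
          (answer (coinsOf x (override D H) (x₂ * ρ) true v) st (.submit j ys)).2) := by
  set P := 𝒢.pow (𝒢.gen κ) x with hP
  set X := 𝒢.pow (𝒢.gen κ) x₂ with hX
  let L (H : 𝒢.Oracles κ) := pathLayers X (override D H) (ys.insertIdx j P) ρ
  choose l₀ l hl0 hlj hpk using fun H => exists_layers hval P X (override D H) ρ
  rw [← mean_uniform_prod, ← mean_uniform_prod fun H v =>
    ψ (answer (coinsOf x (override D H) (x₂ * ρ) true v) st (.submit j ys)).1
        (coinsOf x (override D H) (x₂ * ρ) true v,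
          (answer (coinsOf x (override D H) (x₂ * ρ) true v) st (.submit j ys)).2)]
  have hvalj : ∀ H, (l H).val X = cdh P ((l H).hdr X) := fun H => by
    rw [Layer.val, hpk H]
  have hnot : ∀ H, ¬Coincidence X D (L H) → cdh P ((l H).hdr X) ∉ D.map Entry.val := by
    intro H hc
    rw [← hvalj]
    exact (not_not.1 hc).2 _ (List.mem_map_of_mem (List.mem_of_getElem? (hlj H)))
  have hev : ∀ H, (override D H).eval ((l H).hdr X) (cdh P ((l H).hdr X)) =
      ((l H).key, (l H).bld) := by
    intro H
    rw [← hvalj]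
    exact pathLayers_eval _ _ _ _ _ (List.mem_of_getElem? (hlj H))
  -- Without a coincidence `s_j` is not logged, so this value belongs to `H` itself and not to the
  -- log.
  have hev' : ∀ H, ¬Coincidence X D (L H) →
      H.eval ((l H).hdr X) (cdh P ((l H).hdr X)) = ((l H).key, (l H).bld) := by
    intro H hc
    rw [← hev, eval_override, lookup, lookupKey_of_notMem (hnot H hc),
      lookupBld_of_notMem (.inr (hnot H hc))]
  -- The exchange: the value at `(α_j, s_j)`, disclosed by the real challenge, becomes the random
  -- pair of the challenger, and the independent `v` becomes the oracle value. The adversary's view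
  -- stays the same.
  let r (p : 𝒢.Oracles κ × 𝒢.Fresh κ) : 𝒢.Oracles κ × 𝒢.Fresh κ :=
    (p.1.set ((l p.1).hdr X) (cdh P ((l p.1).hdr X)) p.2, ((l p.1).key, (l p.1).bld))
  have hlay : ∀ H v, ¬Coincidence X D (L H) →
      (coinsOf x (override D (r (H, v)).1) (x₂ * ρ) true (r (H, v)).2).chalLayers j ys =
        (L H).map (Layer.data X) := by
    intro H v hc
    refine layers_eq x₂ _ j (override D H) _ 0 ρ fun m l' hl' => ?_
    change (L H)[m]? = some l' at hl'
    by_cases hm : m = j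
    · subst hm
      rw [show (L H)[m]? = some (l H) from hlj H, Option.some.injEq] at hl'
      rw [if_pos (by simp [coinsOf]), ← hl']
      rfl
    · rw [if_neg (by simpa using fun e => absurd e hm)]
      change (override D (H.set ((l H).hdr X) (cdh P ((l H).hdr X)) v)).eval _ _ = _
      -- The new value at the unlogged point `s_j` passes through the override. It does not affect
      -- layer `m`, because the points of the layers are distinct.
      rw [override_set _ _ _ (hnot H hc), eval_set_of_ne]
      · exact pathLayers_eval _ _ _ _ _ (List.mem_of_getElem? hl')
      · intro e
        rw [← hvalj] at e
        have hnd := (not_not.1 hc).1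
        apply hm
        have e1 : ((L H).map (Layer.val X))[m]? = some (l'.val X) := by
          rw [List.getElem?_map, hl']
          rfl
        have e2 : ((L H).map (Layer.val X))[j]? = some ((l H).val X) := by
          rw [List.getElem?_map, show (L H)[j]? = some (l H) from hlj H]
          rfl
        obtain ⟨h1, e1⟩ := List.getElem?_eq_some_iff.1 e1
        obtain ⟨h2, e2⟩ := List.getElem?_eq_some_iff.1 e2
        exact (hnd.getElem_inj_iff (hi := h1) (hj := h2)).1 (by rw [e1, e2, ← e])
  refine mean_uniform_le_of_injOn (p := fun p => ¬Coincidence X D (L p.1)) (r := r) ?_ ?_ ?_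
  -- The image determines the layers, hence the point of the exchange and the former value there,
  -- which is the key and blinding factor of layer `j`. So the exchange can be undone.
  · rintro ⟨H, v⟩ hp ⟨H', v'⟩ hp' heq
    have e1 := hlay H v hp
    rw [heq, hlay H' v' hp'] at e1
    have e2 : (l H').data X = (l H).data X := by
      have := congrArg (fun l => l[j]?) e1
      simpa only [List.getElem?_map, L, hlj, Option.map_some, Option.some.injEq] using this
    have e3 : (l H').hdr X = (l H).hdr X := congrArg Prod.fst e2
    have e4 : ((l H').key, (l H').bld) = ((l H).key, (l H).bld) := congrArg Prod.snd e2
    have e5 : H.set ((l H).hdr X) (cdh P ((l H).hdr X)) v =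
        H'.set ((l H').hdr X) (cdh P ((l H').hdr X)) v' := congrArg Prod.fst heq
    rw [e3] at e5
    have e6 := congrArg (fun K => K.eval ((l H).hdr X) (cdh P ((l H).hdr X))) e5
    simp only [eval_set] at e6
    have e7 := congrArg
      (fun K => K.set ((l H).hdr X) (cdh P ((l H).hdr X)) ((l H).key, (l H).bld)) e5
    simp only [set_set] at e7
    have e8 := hev' H' hp'
    rw [e3, e4] at e8
    rw [← e8, set_eval, e8, ← hev' H hp, set_eval] at e7
    rw [e6, e7]
  · rintro ⟨H, v⟩ hp
    exact h0 H v (not_not.1 hp)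
  · rintro ⟨H, v⟩ hp
    rcases h1 H v _ _ (hl0 H) (hlj H) with h2 | h2
    · refine (h2.trans ?_).le
      have h3 := hlay H v hp
      have h4 : (override D (r (H, v)).1) = (override D H).set ((l H).hdr X)
          (cdh P ((l H).hdr X)) v := override_set _ _ _ (hnot H hp)
      simp only [answer, h3, List.getElem?_map, L, hl0, hlj, Option.map_some]
      rw [h4]
      rfl
    · rw [h2]
      exact zero_le

/-- As long as its state is good, the simulator is a lazy version of the game with the random
keys. -/
theorem simulator_posteriorRandom_le (N : ℕ) (x x₂ : 𝒢.Exp κ) (st : 𝒢.SimState κ) (v : Val)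
    (ψ : Val → 𝒢.Coins κ × Option (𝒢.G κ) → ℝ≥0∞) :
    ((simulator N (𝒢.pow (𝒢.gen κ) x) (𝒢.pow (𝒢.gen κ) x₂) st v).mean fun r =>
      goodMean x x₂ r.2 (ψ r.1)) ≤
    goodMean x x₂ st fun s => ψ (𝒢.kemReply N s.1 s.2 v).1 (s.1, (𝒢.kemReply N s.1 s.2 v).2) := by
  simp only [simulator, mean_map, kemReply_eq]
  by_cases hst : st.Good
  swap
  · have : ∀ u, ¬(simAnswer (𝒢.pow (𝒢.gen κ) x) (𝒢.pow (𝒢.gen κ) x₂) u st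
        (parse N st.hdr v)).2.Good := fun u h => hst (good_of_simAnswer _ _ _ _ _ h)
    simp only [goodMean, this, if_false, mean_const]
    exact zero_le
  -- Only coins with challenge bit 1, together with the header of the present state, carry mass.
  have hsupp : ∀ ψ ψ' : 𝒢.Coins κ × Option (𝒢.G κ) → ℝ≥0∞,
      (∀ H x' rb, ψ (coinsOf x H x' true rb, st.hdr) = ψ' (coinsOf x H x' true rb, st.hdr)) →
      goodMean x x₂ st ψ = goodMean x x₂ st ψ' := by
    intro ψ ψ' h
    simp only [goodMean, hst, if_true]
    rcases Option.eq_none_or_eq_some st.chal with hc | ⟨ch, hc⟩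
    · simp only [posteriorRandom, hc, mean_posterior, h]
    · have hh : st.hdr = some ch.hdr := by rw [SimState.hdr, hc]; rfl
      rw [hh] at h
      simp only [mean_posteriorRandom x x₂ st hc, h]
  have hr := hsupp (fun s => ψ (answer s.1 s.2 (parse N s.2 v)).1
      (s.1, (answer s.1 s.2 (parse N s.2 v)).2)) (fun s => ψ (answer s.1 s.2 (parse N st.hdr v)).1
        (s.1, (answer s.1 s.2 (parse N st.hdr v)).2)) (fun H x' rb => rfl)
  rw [hr]
  have hspec := parse_spec N st.hdr v
  rcases hp : parse N st.hdr v with _ | α | s | ⟨α, s⟩ | ⟨j, ys⟩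
  · simp only [simAnswer, answer, mean_const]
    exact le_rfl
  · simp only [simAnswer, answer, mean_tape, mean_const]
    refine (mean_goodMean_ask_le x x₂ st hst α (𝒢.pow (𝒢.gen κ) x) α st.found
      (fun w => ψ (.pair (encKey w.1) (𝒢.encExp w.2))) fun _ ch hch => ?_).trans (hsupp _ _ ?_).le
    · rw [cdh_gen_pow, cdh_gen_pow]
      intro e
      -- Raising to the inverse of the secret key shows that a decapsulation at `s_j` would have to
      -- be that of `α_j`.
      refine hspec.2 α hp ?_
      rw [SimState.hdr, hch, Option.map_some, Option.some.injEq]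
      have := congrArg (fun a => 𝒢.pow a x⁻¹) e
      simpa only [pow_pow, mul_inv_cancel, pow_one'] using this.symm
    · intro H x' rb
      rw [cdh_gen_pow]
      rfl
  · simp only [simAnswer, answer, mean_tape, mean_const]
    refine (mean_goodMean_ask_le x x₂ st hst 1 (𝒢.gen κ) s (st.noteVal (𝒢.pow (𝒢.gen κ) x) s)
      (fun w => ψ (encKey w.1)) fun hf ch hch => ?_).trans (hsupp _ _ ?_).le
    · rw [cdh_gen]
      exact (SimState.noteVal_eq_none hf).2 ch hch
    · intro H x' rb
      rw [cdh_gen]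
  · simp only [simAnswer, answer, mean_tape, mean_const]
    refine (mean_goodMean_ask_le x x₂ st hst α (𝒢.gen κ) s (st.noteVal (𝒢.pow (𝒢.gen κ) x) s)
      (fun w => ψ (𝒢.encExp w.2)) fun hf ch hch => ?_).trans (hsupp _ _ ?_).le
    · rw [cdh_gen]
      exact (SimState.noteVal_eq_none hf).2 ch hch
    · intro H x' rb
      rw [cdh_gen]
  · obtain ⟨hnone, hval⟩ := hspec.1 j ys hp
    have hch : st.chal = none := by
      simpa [SimState.hdr] using hnone
    set P := 𝒢.pow (𝒢.gen κ) x with hP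
    set X := 𝒢.pow (𝒢.gen κ) x₂ with hX
    classical
    let Φ (ρ : 𝒢.Exp κ) (L : List (𝒢.Layer κ)) (H : 𝒢.Oracles κ) : ℝ≥0∞ :=
      match L[0]?, L[j]? with
      | some l₀, some l => (uniformOfFintype (𝒢.Fresh κ)).mean fun v =>
          if Coincidence X st.log L then 0 else
          ψ (chalReply (l₀.hdr X) (l.hdr X) (L.map (Layer.data X)))
            (coinsOf x (H.set (l.hdr X) (cdh P (l.hdr X)) v) (x₂ * ρ) true (l.key, l.bld),
              some (l.hdr X))
      | _, _ => (posteriorRandom x x₂ st).mean (ψ (.nat 0))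
    have hl := length_insertIdx_le hval P
    have hΦ : ∀ (ρ : 𝒢.Exp κ) (k : Key κ) (vs : List (𝒢.Fresh κ)),
        goodMean x x₂ (simAnswer P X ((k, ρ), vs) st (.submit j ys)).2
          (ψ (simAnswer P X ((k, ρ), vs) st (.submit j ys)).1) =
        (uniformOfFintype (𝒢.Oracles κ)).mean fun H =>
          Φ ρ (simLayers X (ys.insertIdx j P) ρ st.log vs).1
            (override (simLayers X (ys.insertIdx j P) ρ st.log vs).2 H) := by
      intro ρ k vs
      simp only [simAnswer, Φ]
      rcases (simLayers X (ys.insertIdx j P) ρ st.log vs).1[0]? with _ | l₀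
      · simp only [mean_const, goodMean, hst, if_true]
      · rcases (simLayers X (ys.insertIdx j P) ρ st.log vs).1[j]? with _ | l
        · simp only [mean_const, goodMean, hst, if_true]
        · by_cases hc : Coincidence X st.log (simLayers X (ys.insertIdx j P) ρ st.log vs).1
          · simp only [hc, if_true, mean_const]
            exact goodMean_of_bad _ _ _ (Or.inr trivial) _
          · simp only [hc, if_false]
            exact goodMean_of_chal _ _ _ _ hst.1 (fun h => h.elim hst.2 id) _
    have h1 : ((𝒢.tape κ N).mean fun u =>
        goodMean x x₂ (simAnswer P X u st (.submit j ys)).2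
          (ψ (simAnswer P X u st (.submit j ys)).1)) =
        (uniformOfFintype (𝒢.Exp κ)).mean fun ρ => (uniformOfFintype (𝒢.Oracles κ)).mean fun H =>
          Φ ρ (pathLayers X (override st.log H) (ys.insertIdx j P) ρ) (override st.log H) := by
      rw [mean_tape, ← mean_fresh_snd]
      refine mean_congr _ fun v => ?_
      rw [← mean_simLayers X (ys.insertIdx j P) v.2 st.log N hl.1 (Φ v.2)]
      exact mean_congr _ fun vs => hΦ v.2 v.1 vs
    rw [h1, goodMean, if_pos hst]
    simp only [posteriorRandom, hch, mean_posterior, SimState.headDist]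
    refine le_trans ?_ (mean_exp_mul x₂ _).le
    refine mean_mono _ fun ρ => ?_
    refine le_trans (le_of_eq ?_) (mean_challenge_le x x₂ ρ st.log N j ys hval st.hdr ψ
      (fun H v => match (pathLayers X (override st.log H) (ys.insertIdx j P) ρ)[0]?,
          (pathLayers X (override st.log H) (ys.insertIdx j P) ρ)[j]? with
        | some l₀, some l =>
          if Coincidence X st.log (pathLayers X (override st.log H) (ys.insertIdx j P) ρ) then 0 else
          ψ (chalReply (l₀.hdr X) (l.hdr X)
            ((pathLayers X (override st.log H) (ys.insertIdx j P) ρ).map (Layer.data X)))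
            (coinsOf x ((override st.log H).set (l.hdr X) (cdh P (l.hdr X)) v) (x₂ * ρ) true
              (l.key, l.bld), some (l.hdr X))
        | _, _ => 0) ?_ ?_)
    · refine mean_congr _ fun H => ?_
      obtain ⟨l₀, l, h0, hj, -⟩ := exists_layers hval P X (override st.log H) ρ
      simp only [Φ, h0, hj]
    · intro H v hc
      obtain ⟨l₀, l, h0, hj, -⟩ := exists_layers hval P X (override st.log H) ρ
      rw [h0, hj]
      exact if_pos hc
    · intro H v l₀ l h0 hj
      rw [h0, hj]
      dsimp only
      split_ifs
      · exact .inr rfl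
      · exact .inl rfl

end GroupFamily


open scoped ENNReal

namespace GroupFamily

open PMF

variable {𝒢 : GroupFamily} {κ : ℕ}

/-! ### The probability of a coincidence -/

/-- A coincidence of the points of the oracles, if all the blinding factors are fresh. -/
def FreshCollision (X : 𝒢.G κ) : List (𝒢.G κ) → 𝒢.Exp κ → List (𝒢.Fresh κ) → List (𝒢.G κ) → Prop
  | y :: ys, e, v :: vs, Q =>
      cdh y (𝒢.pow X e) ∈ Q ∨ FreshCollision X ys (e * v.2) vs (cdh y (𝒢.pow X e) :: Q)
  | _, _, _, _ => False

/-- Until the first repetition nothing is found in the log, so the blinding factors of the layers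
are the fresh ones. It therefore suffices to bound repetitions along a path with independent
blinding factors. -/
theorem Coincidence.freshCollision (X : 𝒢.G κ) (ys : List (𝒢.G κ)) (e : 𝒢.Exp κ)
    (vs : List (𝒢.Fresh κ)) (D : List (𝒢.Entry κ))
    (h : Coincidence X D (simLayers X ys e D vs).1) :
    FreshCollision X ys e vs (D.map Entry.val) := by
  induction ys generalizing e vs D with
  | nil => simp [simLayers, Coincidence] at h
  | cons y ys ih =>
    rcases vs with _ | ⟨v, vs⟩
    · simp [simLayers, Coincidence] at h
    · by_cases hs : cdh y (𝒢.pow X e) ∈ D.map Entry.val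
      · exact .inl hs
      · refine .inr ?_
        have hb : (ask D (𝒢.pow X e) y (𝒢.pow X e) v).1.2 = v.2 :=
          lookupBld_of_notMem (.inr hs) _
        have := ih (e * v.2) vs (ask D (𝒢.pow X e) y (𝒢.pow X e) v).2 ?_
        · exact this
        · simp only [simLayers, hb] at h
          intro h'
          refine h ⟨?_, ?_⟩
          · rw [List.map_cons, List.nodup_cons]
            exact ⟨fun hm => h'.2 _ hm List.mem_cons_self, h'.1⟩
          · intro s hm
            rw [List.map_cons, List.mem_cons] at hm
            rcases hm with rfl | hm
            · exact hs
            · exact fun hd => h'.2 s hm (List.mem_cons_of_mem _ hd)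

-- The point is an injective function of the exponent because `X` and `y` are nontrivial. At most
-- `Q.length` exponents can lead into `Q`.
open Classical in
theorem mean_cdh_mem_le {X y : 𝒢.G κ} (hX : X ≠ 1) (hy : y ≠ 1) (Q : List (𝒢.G κ)) :
    ((uniformOfFintype (𝒢.Exp κ)).mean fun e => if cdh y (𝒢.pow X e) ∈ Q then 1 else 0) ≤
      (Fintype.card (𝒢.Exp κ) : ℝ≥0∞)⁻¹ * Q.length := by
  rw [mean_uniform, Finset.sum_boole]
  refine mul_le_mul_right (Nat.cast_le.2 ?_) _
  refine le_trans ?_ Q.toFinset_card_le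
  refine Finset.card_le_card_of_injOn (fun e => cdh y (𝒢.pow X e)) ?_ ?_
  · intro e he
    simpa using he
  · intro e _ e' _ h
    exact pow_injective hX (pow_left_injective (dlog_ne_zero hy) h)

-- Union bound over the layers. Multiplication by a fresh blinding factor makes the next exponent
-- uniform whatever happened before, and the list of points to be avoided grows by one per layer.
open Classical in
theorem mean_freshCollision_le {X : 𝒢.G κ} (hX : X ≠ 1) (ys : List (𝒢.G κ))
    (hys : ∀ y ∈ ys, y ≠ 1) (Q : List (𝒢.G κ)) (n : ℕ) (hn : ys.length ≤ n) :
    ((uniformOfFintype (𝒢.Exp κ)).mean fun e => (𝒢.freshList κ n).mean fun vs =>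
      if FreshCollision X ys e vs Q then 1 else 0) ≤
      (Fintype.card (𝒢.Exp κ) : ℝ≥0∞)⁻¹ * ((ys.length * (Q.length + ys.length) : ℕ) : ℝ≥0∞) := by
  induction ys generalizing Q n with
  | nil => simp [FreshCollision, mean_const]
  | cons y ys ih =>
    obtain ⟨n, rfl⟩ : ∃ m, n = m + 1 := ⟨n - 1, by simp at hn; omega⟩
    have h1 : ∀ e : 𝒢.Exp κ, ((𝒢.freshList κ (n + 1)).mean fun vs =>
        if FreshCollision X (y :: ys) e vs Q then (1 : ℝ≥0∞) else 0) ≤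
        (if cdh y (𝒢.pow X e) ∈ Q then 1 else 0) +
        (Fintype.card (𝒢.Exp κ) : ℝ≥0∞)⁻¹ *
          ((ys.length * (Q.length + 1 + ys.length) : ℕ) : ℝ≥0∞) := by
      intro e
      rw [mean_freshList_succ]
      calc _ ≤ (uniformOfFintype (𝒢.Fresh κ)).mean fun v => (𝒢.freshList κ n).mean fun vs =>
            (if cdh y (𝒢.pow X e) ∈ Q then (1 : ℝ≥0∞) else 0) +
            if FreshCollision X ys (e * v.2) vs (cdh y (𝒢.pow X e) :: Q) then (1 : ℝ≥0∞) else 0 := by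
            refine mean_mono _ fun v => mean_mono _ fun vs => ?_
            by_cases ha : cdh y (𝒢.pow X e) ∈ Q
            · simp only [FreshCollision, ha, true_or, if_true]
              exact le_self_add
            · simp only [FreshCollision, ha, false_or, if_false, zero_add]
              exact le_rfl
        _ ≤ _ := by
            simp only [mean_add, mean_const]
            refine add_le_add le_rfl ?_
            rw [mean_fresh_snd fun b => (𝒢.freshList κ n).mean fun vs =>
              if FreshCollision X ys (e * b) vs (cdh y (𝒢.pow X e) :: Q) then (1 : ℝ≥0∞) else 0,
              mean_exp_mul e fun b => (𝒢.freshList κ n).mean fun vs =>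
              if FreshCollision X ys b vs (cdh y (𝒢.pow X e) :: Q) then (1 : ℝ≥0∞) else 0]
            exact ih (fun y hy => hys y (List.mem_cons_of_mem _ hy)) _ n (by simpa using hn)
    refine (mean_mono _ h1).trans ?_
    rw [mean_add, mean_const]
    refine (add_le_add (mean_cdh_mem_le hX (hys y List.mem_cons_self) Q) le_rfl).trans ?_
    rw [← mul_add, ← Nat.cast_add]
    refine mul_le_mul_right (Nat.cast_le.2 ?_) _
    simp only [List.length_cons]
    nlinarith

theorem length_simLayers_le (X : 𝒢.G κ) (ys : List (𝒢.G κ)) (e : 𝒢.Exp κ)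
    (vs : List (𝒢.Fresh κ)) (D : List (𝒢.Entry κ)) :
    (simLayers X ys e D vs).2.length ≤ D.length + ys.length := by
  induction ys generalizing e vs D with
  | nil => simp [simLayers]
  | cons y ys ih =>
    rcases vs with _ | ⟨v, vs⟩
    · simp [simLayers]
    · simp only [simLayers, List.length_cons]
      refine (ih _ _ _).trans ?_
      simp only [ask, List.length_cons]
      omega

/-- An oracle question adds one entry and a challenge at most `N`; the bound `N + 1` covers both. -/
theorem length_log_simulator_le (N : ℕ) (P X : 𝒢.G κ) (u : 𝒢.Fresh κ × List (𝒢.Fresh κ))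
    (st : 𝒢.SimState κ) (v : Val) :
    (simAnswer P X u st (parse N st.hdr v)).2.log.length ≤ st.log.length + (N + 1) := by
  have hspec := parse_spec N st.hdr v
  rcases hp : parse N st.hdr v with _ | α | s | ⟨α, s⟩ | ⟨j, ys⟩
  · simp [simAnswer]
  · simp [simAnswer, ask]
  · simp [simAnswer, ask]
  · simp [simAnswer, ask]
  · obtain ⟨-, hval⟩ := hspec.1 j ys hp
    have h1 := (length_insertIdx_le hval P).1
    have h2 := length_simLayers_le X (ys.insertIdx j P) u.1.2 u.2 st.log
    simp only [simAnswer]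
    split
    · dsimp only
      omega
    · dsimp only
      omega

variable (𝒢 κ) in
/-- The initial state of the simulator. -/
def SimState.init : 𝒢.SimState κ := ⟨[], none, none, False⟩

open Classical in
/-- A bound for the probability of a future coincidence, given the remaining budget. -/
noncomputable def badPotential (N S : ℕ) (ε : ℝ≥0∞) (l : ℕ) (st : 𝒢.SimState κ) : ℝ≥0∞ :=
  if st.log.length + (N + 1) * l ≤ S then
    if st.bad then 1 else if st.chal = none then ε else 0
  -- Outside the length invariant, which holds initially for `S = (N + 1) * T`; a value at least as
  -- large as all others keeps the potential monotone in the budget.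
  else 1 + ε

theorem badPotential_monotone (N S : ℕ) (ε : ℝ≥0∞) (st : 𝒢.SimState κ) :
    Monotone fun l => badPotential N S ε l st := by
  intro l l' hl
  simp only [badPotential]
  have := Nat.mul_le_mul_left (N + 1) hl
  split_ifs <;> first | omega | simp

theorem badPotential_le (N S : ℕ) (ε : ℝ≥0∞) (l : ℕ) (st : 𝒢.SimState κ) :
    badPotential N S ε l st ≤ 1 + ε := by
  simp only [badPotential]
  split_ifs <;> simp

/-- Only a valid submission can cause a coincidence, and it can happen only while there is no
challenge, when the potential still contains `ε`. At that time the log has length at most `S`, and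
`ε` is the collision bound for a path of length at most `N`. -/
theorem badPotential_simulator (N S : ℕ) {P X : 𝒢.G κ} (hP : P ≠ 1) (hX : X ≠ 1)
    (st : 𝒢.SimState κ) (v : Val) (l : ℕ) :
    ((simulator N P X st v).mean fun x => badPotential N S
      ((Fintype.card (𝒢.Exp κ) : ℝ≥0∞)⁻¹ * ((N * (S + N) : ℕ) : ℝ≥0∞)) l x.2) ≤
    badPotential N S
      ((Fintype.card (𝒢.Exp κ) : ℝ≥0∞)⁻¹ * ((N * (S + N) : ℕ) : ℝ≥0∞)) (l + 1) st := by
  classical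
  set ε := (Fintype.card (𝒢.Exp κ) : ℝ≥0∞)⁻¹ * ((N * (S + N) : ℕ) : ℝ≥0∞) with hε
  rw [simulator, mean_map]
  by_cases hS : st.log.length + (N + 1) * (l + 1) ≤ S
  swap
  · refine (mean_mono _ fun u => badPotential_le N S ε l _).trans ?_
    rw [mean_const]
    simp only [badPotential, if_neg hS, le_refl]
  have hS' : ∀ u, (simAnswer P X u st (parse N st.hdr v)).2.log.length + (N + 1) * l ≤ S := by
    intro u
    have := length_log_simulator_le N P X u st v
    rw [mul_add] at hS
    omega
  simp only [badPotential, if_pos hS, hS', if_true]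
  have hspec := parse_spec N st.hdr v
  rcases hp : parse N st.hdr v with _ | α | s | ⟨α, s⟩ | ⟨j, ys⟩
  · exact (mean_const _ _).le
  · exact (mean_const _ _).le
  · exact (mean_const _ _).le
  · exact (mean_const _ _).le
  · obtain ⟨hnone, hval⟩ := hspec.1 j ys hp
    have hch : st.chal = none := by simpa [SimState.hdr] using hnone
    by_cases hb : st.bad
    · rw [if_pos hb]
      refine (mean_mono _ fun u => ?_).trans (mean_const _ 1).le
      rw [if_pos]
      simp only [simAnswer]
      split
      · exact .inl hb
      · exact hb
    rw [if_neg hb, if_pos hch]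
    have hl := length_insertIdx_le hval P
    have hys : ∀ y ∈ ys.insertIdx j P, y ≠ 1 := by
      intro y hy
      rcases List.eq_or_mem_of_mem_insertIdx hy with rfl | hy
      · exact hP
      · exact hval.2.1 y hy
    -- The branch of `simAnswer` for missing layers. It has probability zero, as is seen by passing
    -- to path layers with `mean_simLayers`.
    let Fail (L : List (𝒢.Layer κ)) : Prop := ¬∃ l₀ l, L[0]? = some l₀ ∧ L[j]? = some l
    calc _ ≤ (𝒢.tape κ N).mean fun u =>
          (if FreshCollision X (ys.insertIdx j P) u.1.2 u.2 (st.log.map Entry.val) then 1 else 0) +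
          if Fail (simLayers X (ys.insertIdx j P) u.1.2 st.log u.2).1 then ε else 0 := by
          refine mean_mono _ fun u => ?_
          by_cases hf : Fail (simLayers X (ys.insertIdx j P) u.1.2 st.log u.2).1
          · rw [if_pos hf]
            refine le_add_left ?_
            have h : (simAnswer P X u st (.submit j ys)).2 = st := by
              simp only [simAnswer]
              split
              · rename_i l₀ l h0 h1
                exact (hf ⟨l₀, l, h0, h1⟩).elim
              · rfl
            simp only [h, hb, hch, if_false, if_true, le_refl]
          · rw [if_neg hf, add_zero]
            obtain ⟨l₀, l, h0, h1⟩ := not_not.1 hf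
            simp only [simAnswer, h0, h1, hb, false_or, reduceCtorEq, if_false]
            split_ifs with h2 h3
            · exact le_rfl
            · exact (h3 (Coincidence.freshCollision _ _ _ _ _ h2)).elim
            · exact zero_le
            · exact le_rfl
      _ ≤ ε := by
          rw [mean_add, mean_tape, mean_tape]
          refine (add_le_add (d := 0) ?_ (le_of_eq ?_)).trans (add_zero ε).le
          · have h := mean_freshCollision_le hX _ hys (st.log.map Entry.val) N hl.1
            refine (mean_fresh_snd fun e => (𝒢.freshList κ N).mean fun vs =>
              if FreshCollision X (ys.insertIdx j P) e vs (st.log.map Entry.val)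
              then (1 : ℝ≥0∞) else 0).le.trans ?_
            refine h.trans (mul_le_mul_right (Nat.cast_le.2 ?_) _)
            rw [List.length_map]
            have := hl.1
            rw [mul_add] at hS
            exact Nat.mul_le_mul hl.1 (by omega)
          · refine (mean_congr _ fun w => ?_).trans (mean_const _ 0)
            have h := mean_simLayers X (ys.insertIdx j P) w.2 st.log N hl.1
              fun L _ => if Fail L then ε else 0
            simp only [mean_const] at h
            rw [h]
            refine (mean_congr _ fun H => ?_).trans (mean_const _ 0)
            obtain ⟨l₀, l, h0, h1, -⟩ := exists_layers hval P X (override st.log H) w.2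
            exact if_neg (not_not.2 ⟨l₀, l, h0, h1⟩)

open Classical in
/-- The probability of a coincidence in a run of the simulator. -/
theorem wp_bad_le (N : ℕ) {P X : 𝒢.G κ} (hP : P ≠ 1) (hX : X ≠ 1) (p : Prog) (v : Val) (T : ℕ) :
    Exec.wp (p.run (simulator N P X) v) T (.init 𝒢 κ) (fun _ _ st => if st.bad then 1 else 0) ≤
      (Fintype.card (𝒢.Exp κ) : ℝ≥0∞)⁻¹ * ((N * ((N + 1) * T + N) : ℕ) : ℝ≥0∞) := by
  have h := Prog.wp_run_potential (simulator N P X) (fun l st => badPotential N ((N + 1) * T)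
    ((Fintype.card (𝒢.Exp κ) : ℝ≥0∞)⁻¹ * ((N * ((N + 1) * T + N) : ℕ) : ℝ≥0∞)) l st)
    (fun st => badPotential_monotone _ _ _ st)
    (fun st v l => badPotential_simulator N _ hP hX st v l) p v T (.init 𝒢 κ)
  refine (Exec.wp_mono' _ _ _ fun _ l st => ?_).trans (h.trans (le_of_eq ?_))
  · simp only [badPotential]
    split_ifs <;> simp
  · simp [badPotential, SimState.init]

end GroupFamily


open scoped ENNReal

namespace PMF

theorem apply_true_eq_mean (d : PMF Bool) : d true = d.mean fun b => if b = true then 1 else 0 := by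
  rw [mean, tsum_bool]
  simp

theorem apply_eq_mean {α : Type} [DecidableEq α] (d : PMF α) (a : α) :
    d a = d.mean fun b => if b = a then 1 else 0 := by
  rw [mean, tsum_eq_single a]
  · simp
  · intro b hb
    simp [hb]

theorem mean_bool (φ : Bool → ℝ≥0∞) :
    (uniformOfFintype Bool).mean φ = 2⁻¹ * (φ false + φ true) := by
  rw [mean_uniform, Fintype.sum_bool, add_comm]
  simp

end PMF

namespace GroupFamily

open PMF

variable {𝒢 : GroupFamily} {κ : ℕ}

/-! ### The experiments as expected values -/

open Classical in
theorem gdhExperiment_apply (B : PPT) :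
    𝒢.gdhExperiment κ B true = (uniformOfFintype (𝒢.Exp κ)).mean fun x₁ =>
      (uniformOfFintype (𝒢.Exp κ)).mean fun x₂ =>
        Exec.wp (B.prog.run (𝒢.ddhOracle κ) (.pair (𝒢.pub κ) (.pair
          (𝒢.enc κ (𝒢.pow (𝒢.gen κ) x₁)) (𝒢.enc κ (𝒢.pow (𝒢.gen κ) x₂))))) (B.clock.eval κ) ()
          fun a _ _ => if a = 𝒢.enc κ (𝒢.pow (𝒢.pow (𝒢.gen κ) x₁) x₂) then 1 else 0 := by
  rw [apply_true_eq_mean]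
  refine (mean_bind _ _ _).trans (mean_congr _ fun x₁ => ?_)
  refine (mean_bind _ _ _).trans (mean_congr _ fun x₂ => ?_)
  refine (mean_bind _ _ _).trans ?_
  rw [← Prog.output_apply, apply_eq_mean]
  refine mean_congr _ fun out => (mean_pure _ _).trans ?_
  simp

open Classical in
/-- The probability of the output `v` in the KEM game with a fixed challenge bit. -/
noncomputable def gameOutput (𝒢 : GroupFamily) (κ N : ℕ) (A : PPT) (bit : Bool) (v : Val) : ℝ≥0∞ :=
  (uniformOfFintype (𝒢.Exp κ)).mean fun x => (uniformOfFintype (𝒢.Oracles κ)).mean fun H =>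
    (uniformOfFintype (𝒢.Exp κ)).mean fun x' => (uniformOfFintype (𝒢.Fresh κ)).mean fun rb =>
      Exec.wp (A.prog.run (𝒢.kemChallenger N (coinsOf x H x' bit rb))
        (.pair (𝒢.pub κ) (𝒢.enc κ (𝒢.pow (𝒢.gen κ) x)))) (A.clock.eval κ) none
        fun a _ _ => if a = v then 1 else 0

theorem kemExperiment_apply (N : ℕ) (A : PPT) :
    𝒢.kemExperiment κ N A true =
      2⁻¹ * (gameOutput 𝒢 κ N A false (.nat 0) + gameOutput 𝒢 κ N A true (.nat 1)) := by
  classical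
  rw [apply_true_eq_mean]
  refine Eq.trans ?_ (mean_bool fun b => gameOutput 𝒢 κ N A b (.nat b.toNat))
  simp only [gameOutput]
  rw [mean_comm]
  refine (mean_bind _ _ _).trans ?_
  refine (mean_bind _ _ _).trans (mean_congr _ fun x => ?_)
  rw [mean_comm]
  have h1 := mean_uniform_prod fun (hs : 𝒢.HStar κ) (hb : 𝒢.HBlind κ) =>
    (uniformOfFintype Bool).mean fun bit => (uniformOfFintype (𝒢.Exp κ)).mean fun x' =>
      (uniformOfFintype (𝒢.Fresh κ)).mean fun rb =>
      Exec.wp (A.prog.run (𝒢.kemChallenger N (coinsOf x (hs, hb) x' bit rb))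
        (.pair (𝒢.pub κ) (𝒢.enc κ (𝒢.pow (𝒢.gen κ) x)))) (A.clock.eval κ) none
        fun a _ _ => if a = .nat bit.toNat then 1 else 0
  refine Eq.trans ?_ h1.symm
  refine (mean_bind _ _ _).trans (mean_congr _ fun hs => ?_)
  refine (mean_bind _ _ _).trans (mean_congr _ fun hb => ?_)
  rw [mean_comm]
  refine (mean_bind _ _ _).trans (mean_congr _ fun x' => ?_)
  refine (mean_bind _ _ _).trans (mean_congr _ fun bit => ?_)
  have h2 := mean_uniform_prod fun (k : Key κ) (b : 𝒢.Exp κ) =>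
      Exec.wp (A.prog.run (𝒢.kemChallenger N (coinsOf x (hs, hb) x' bit (k, b)))
        (.pair (𝒢.pub κ) (𝒢.enc κ (𝒢.pow (𝒢.gen κ) x)))) (A.clock.eval κ) none
        fun a _ _ => if a = .nat bit.toNat then 1 else 0
  refine Eq.trans ?_ h2.symm
  refine (mean_bind _ _ _).trans (mean_congr _ fun k => ?_)
  refine (mean_bind _ _ _).trans (mean_congr _ fun b => ?_)
  refine (mean_pure _ _).trans ?_
  refine (mean_bind _ _ _).trans ?_
  rw [← Prog.output_apply, apply_eq_mean]
  refine mean_congr _ fun out => (mean_pure _ _).trans ?_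
  simp only [decide_eq_true_eq]

/-- The probability of an event at the end of a run of the simulator. -/
noncomputable def simProb (𝒢 : GroupFamily) (κ N : ℕ) (A : PPT)
    (φ : Val → 𝒢.SimState κ → ℝ≥0∞) : ℝ≥0∞ :=
  (uniformOfFintype (𝒢.Exp κ)).mean fun x₁ => (uniformOfFintype (𝒢.Exp κ)).mean fun x₂ =>
    Exec.wp (A.prog.run (simulator N (𝒢.pow (𝒢.gen κ) x₁) (𝒢.pow (𝒢.gen κ) x₂))
      (.pair (𝒢.pub κ) (𝒢.enc κ (𝒢.pow (𝒢.gen κ) x₁)))) (A.clock.eval κ) (.init 𝒢 κ)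
      fun a _ st => φ a st

theorem tsum_challenger (N : ℕ) (s : 𝒢.Coins κ × Option (𝒢.G κ)) (v : Val)
    (ψ : Val × 𝒢.Coins κ × Option (𝒢.G κ) → ℝ≥0∞) :
    ∑' y, 𝒢.challenger κ N s v y * ψ y =
      ψ ((𝒢.kemReply N s.1 s.2 v).1, s.1, (𝒢.kemReply N s.1 s.2 v).2) :=
  Exec.tsum_pure_mul _ ψ

theorem mean_posterior_init (x x₂ : 𝒢.Exp κ) (bit : Bool)
    (ψ : 𝒢.Coins κ × Option (𝒢.G κ) → ℝ≥0∞) :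
    (posterior x x₂ bit (.init 𝒢 κ)).mean ψ = (uniformOfFintype (𝒢.Oracles κ)).mean fun H =>
      (uniformOfFintype (𝒢.Exp κ)).mean fun x' => (uniformOfFintype (𝒢.Fresh κ)).mean fun rb =>
        ψ (coinsOf x H x' bit rb, none) := by
  rw [mean_posterior, mean_comm]
  rfl

-- The game contains no `x₂`. Before the challenge the conditional distribution of the coins does
-- not depend on it, so it may be chosen freely and averaged over later.
open Classical in
theorem gameOutput_eq (N : ℕ) (A : PPT) (bit : Bool) (v : Val) (x₂ : 𝒢.Exp κ → 𝒢.Exp κ) :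
    gameOutput 𝒢 κ N A bit v = (uniformOfFintype (𝒢.Exp κ)).mean fun x =>
      (posterior x (x₂ x) bit (.init 𝒢 κ)).mean fun s =>
        Exec.wp (A.prog.run (𝒢.challenger κ N)
          (.pair (𝒢.pub κ) (𝒢.enc κ (𝒢.pow (𝒢.gen κ) x)))) (A.clock.eval κ) s
          fun a _ _ => if a = v then 1 else 0 := by
  refine mean_congr _ fun x => ?_
  rw [mean_posterior_init]
  simp only [wp_challenger N _ none _ _ _ fun a => if a = v then (1 : ℝ≥0∞) else 0]

-- The simulation of the real game is perfect: `posterior` is a kernel compatible with every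
-- message, starts as the distribution of the game, and has total mass 1 at the end.
open Classical in
theorem gameOutput_false (N : ℕ) (A : PPT) (v : Val) :
    gameOutput 𝒢 κ N A false v = simProb 𝒢 κ N A fun a _ => if a = v then 1 else 0 := by
  have h : ∀ x₂ : 𝒢.Exp κ, gameOutput 𝒢 κ N A false v = _ :=
    fun x₂ => gameOutput_eq N A false v fun _ => x₂
  rw [simProb, mean_comm, ← mean_const (uniformOfFintype (𝒢.Exp κ)) (gameOutput 𝒢 κ N A false v)]
  refine mean_congr _ fun x₂ => (h x₂).trans (mean_congr _ fun x => ?_)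
  have hk := Prog.wp_run_kernel_eq (𝒢.challenger κ N)
    (simulator N (𝒢.pow (𝒢.gen κ) x) (𝒢.pow (𝒢.gen κ) x₂))
    (fun st s => posterior x x₂ false st s) (fun st w ψ => ?_) A.prog
    (.pair (𝒢.pub κ) (𝒢.enc κ (𝒢.pow (𝒢.gen κ) x))) (A.clock.eval κ) (.init 𝒢 κ)
    fun a _ _ => if a = v then 1 else 0
  · refine hk.symm.trans (Exec.wp_congr_post fun a l st => ?_)
    exact mean_const _ _
  · refine (simulator_posterior N x x₂ st w ψ).trans (mean_congr _ fun s => ?_)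
    exact (tsum_challenger N s w fun y => ψ y.1 y.2).symm

-- The kernel is `posteriorRandom`, set to zero outside the good states; its final mass is the
-- indicator of being good.
open Classical in
theorem simProb_good_le (N : ℕ) (A : PPT) (v : Val) :
    (simProb 𝒢 κ N A fun a st => if a = v ∧ st.Good then 1 else 0) ≤
      gameOutput 𝒢 κ N A true v := by
  have h : ∀ x₂ : 𝒢.Exp κ, gameOutput 𝒢 κ N A true v = _ :=
    fun x₂ => gameOutput_eq N A true v fun _ => x₂
  rw [simProb, mean_comm, ← mean_const (uniformOfFintype (𝒢.Exp κ)) (gameOutput 𝒢 κ N A true v)]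
  refine mean_mono _ fun x₂ => le_trans ?_ (h x₂).ge
  refine mean_mono _ fun x => ?_
  have hk := Prog.wp_run_kernel_le (𝒢.challenger κ N)
    (simulator N (𝒢.pow (𝒢.gen κ) x) (𝒢.pow (𝒢.gen κ) x₂))
    (fun st s => if st.Good then posteriorRandom x x₂ st s else 0) (fun st w ψ => ?_) A.prog
    (.pair (𝒢.pub κ) (𝒢.enc κ (𝒢.pow (𝒢.gen κ) x))) (A.clock.eval κ) (.init 𝒢 κ)
    fun a _ _ => if a = v then 1 else 0
  · refine le_trans (Exec.wp_mono' _ _ _ fun a l st => ?_) (hk.trans (le_of_eq ?_))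
    · by_cases hg : st.Good
      · simp only [hg, and_true, if_true]
        exact (mean_const (posteriorRandom x x₂ st) _).ge
      · simp only [hg, and_false, if_false]
        exact zero_le
    · refine tsum_congr fun s => ?_
      rw [if_pos ⟨rfl, not_false⟩]
      rfl
  · have hW : ∀ (st : 𝒢.SimState κ) (ψ : 𝒢.Coins κ × Option (𝒢.G κ) → ℝ≥0∞),
        ∑' s, (if st.Good then posteriorRandom x x₂ st s else 0) * ψ s = goodMean x x₂ st ψ := by
      intro st ψ
      by_cases hg : st.Good <;> simp [goodMean, hg, mean]
    simp only [hW]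
    refine (simulator_posteriorRandom_le N x x₂ st w ψ).trans (le_of_eq ?_)
    congr 1
    funext s
    exact (tsum_challenger N s w fun y => ψ y.1 y.2).symm

theorem gameOutput_add_le (N : ℕ) (A : PPT) (bit : Bool) {v w : Val} (h : v ≠ w) :
    gameOutput 𝒢 κ N A bit v + gameOutput 𝒢 κ N A bit w ≤ 1 := by
  simp only [gameOutput, ← mean_add, ← Exec.wp_add]
  refine (mean_mono _ fun x => (mean_mono _ fun H => (mean_mono _ fun x' => (mean_mono _ fun rb =>
    Exec.wp_le_one _ _ _ (fun a _ _ => ?_)).trans (mean_const _ 1).le).trans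
      (mean_const _ 1).le).trans (mean_const _ 1).le).trans (mean_const _ 1).le
  split_ifs with h1 h2
  · exact (h (h1.symm.trans h2)).elim
  · simp
  · simp
  · simp

open Classical in
/-- The advantage is bounded by the probability of finding a Diffie-Hellman element and the
probability of a coincidence. -/
theorem kemExperiment_le (N : ℕ) (A : PPT) :
    𝒢.kemExperiment κ N A true ≤ 2⁻¹ * (1 +
      ((simProb 𝒢 κ N A fun _ st => if st.found = none then 0 else 1) +
        (Fintype.card (𝒢.Exp κ) : ℝ≥0∞)⁻¹ *
          ((N * ((N + 1) * A.clock.eval κ + N) : ℕ) : ℝ≥0∞))) := by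
  rw [kemExperiment_apply]
  refine mul_le_mul_right ?_ _
  have h1 : gameOutput 𝒢 κ N A false (.nat 0) ≤
      (simProb 𝒢 κ N A fun a st => if a = .nat 0 ∧ st.Good then 1 else 0) +
      ((simProb 𝒢 κ N A fun _ st => if st.found = none then 0 else 1) +
        simProb 𝒢 κ N A fun _ st => if st.bad then 1 else 0) := by
    rw [gameOutput_false]
    simp only [simProb, ← mean_add, ← Exec.wp_add]
    refine mean_mono _ fun x₁ => mean_mono _ fun x₂ => Exec.wp_mono' _ _ _ fun a l st => ?_
    by_cases ha : a = .nat 0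
    · by_cases hf : st.found = none
      · by_cases hb : st.bad
        · simp [hb, ha, hf, SimState.Good]
        · simp [hb, ha, hf, SimState.Good]
      · simp [ha, hf, SimState.Good]
    · simp [ha]
  have h2 := simProb_good_le (𝒢 := 𝒢) (κ := κ) N A (.nat 0)
  have h3 := gameOutput_add_le (𝒢 := 𝒢) (κ := κ) N A true (v := .nat 0) (w := .nat 1) (by simp)
  have h4 : (simProb 𝒢 κ N A fun _ st => if st.bad then 1 else 0) ≤
      (Fintype.card (𝒢.Exp κ) : ℝ≥0∞)⁻¹ *
        ((N * ((N + 1) * A.clock.eval κ + N) : ℕ) : ℝ≥0∞) := by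
    refine (mean_mono _ fun x₁ => (mean_mono _ fun x₂ => ?_).trans (mean_const _ _).le).trans
      (mean_const _ _).le
    exact wp_bad_le N (pow_ne_one gen_ne_one x₁) (pow_ne_one gen_ne_one x₂) _ _ _
  -- Real output 0 is bounded by random output 0 plus the two error terms, and the two outputs of
  -- the random game sum to at most 1. A one-sided comparison of the games is therefore enough.
  calc _ ≤ _ := add_le_add (h1.trans (add_le_add h2 (add_le_add le_rfl h4))) le_rfl
    _ ≤ _ := by
      rw [add_right_comm]
      exact add_le_add h3 le_rfl

end GroupFamily


open scoped ENNReal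

namespace Prog

open Exec

/-! ### Running a program against a simulated environment -/

/-- Evaluate the condition `c'` of a simulated loop on `(v, s)`, with the result `(t, (v, s'))`. -/
def evalCond (c' : Prog) : Prog :=
  .comp (.both (.op .fst) c')
    (.both (.comp (.op .snd) (.op .fst)) (.both (.op .fst) (.comp (.op .snd) (.op .snd))))

/-- The program `p` with its queries answered by the program `H`, acting on pairs of a value and a
state of the simulated environment. -/
def simulate (H : Prog) : Prog → Prog
  | op f => .both (.comp (.op .fst) (.op f)) (.op .snd)
  | comp p q => .comp (simulate H p) (simulate H q)
  | both p q =>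
      .comp (.both (.op .fst) (simulate H p)) (.comp
        (.both (.comp (.op .snd) (.op .fst))
          (.comp (.both (.op .fst) (.comp (.op .snd) (.op .snd))) (simulate H q)))
        (.both (.both (.op .fst) (.comp (.op .snd) (.op .fst))) (.comp (.op .snd) (.op .snd))))
  | ite c p q =>
      .comp (.both (.op .fst) (simulate H c)) (.ite (.comp (.op .snd) (.op .fst))
        (.comp (.both (.op .fst) (.comp (.op .snd) (.op .snd))) (simulate H p))
        (.comp (.both (.op .fst) (.comp (.op .snd) (.op .snd))) (simulate H q)))
  | loop c p =>
      .comp (evalCond (simulate H c)) (.comp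
        (.loop (.op .fst) (.comp (.op .snd) (.comp (simulate H p) (evalCond (simulate H c)))))
        (.op .snd))
  | rand => .both (.comp (.op .fst) .rand) (.op .snd)
  | query => H

section Wp

variable {τ : Type} {F : Env τ} {t : τ} {p q : Prog} {v w : Val} {C n m : ℕ}
  {φ : Val → ℕ → τ → ℝ≥0∞}

theorem Runs.wp_le (h : Runs F t p v w C) (hφ : ∀ a t, Monotone fun l => φ a l t)
    (hm : n + C ≤ m) : φ w n t ≤ wp (p.run F v) m t φ :=
  (h.2 φ hφ n).trans (wp_run_monotone F p v t hφ hm)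

theorem wp_comp (hm : n + (1 + v.size) ≤ m) (hφ : ∀ a t, Monotone fun l => φ a l t) :
    wp (p.run F v) n t (fun a l t => wp (q.run F a) l t φ) ≤ wp ((Prog.comp p q).run F v) m t φ := by
  simp only [run, wp_bind, wp_tick]
  rw [if_pos (by omega)]
  exact wp_run_monotone F p v t (fun a t => wp_run_monotone F q a t hφ) (by omega)

theorem wp_comp_runs (h : Runs F t p v w C) (hm : n + (1 + v.size + C) ≤ m)
    (hφ : ∀ a t, Monotone fun l => φ a l t) :
    wp (q.run F w) n t φ ≤ wp ((Prog.comp p q).run F v) m t φ := by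
  refine (h.wp_le (n := n) (φ := fun a l t => wp (q.run F a) l t φ)
    (fun a t => wp_run_monotone F q a t hφ) le_rfl).trans ?_
  exact wp_comp (by omega) hφ

theorem wp_both_runs_left (h : Runs F t p v w C) (hm : n + (1 + v.size + C) ≤ m)
    (hφ : ∀ a t, Monotone fun l => φ a l t) :
    wp (q.run F v) n t (fun a l t => φ (.pair w a) l t) ≤
      wp ((Prog.both p q).run F v) m t φ := by
  simp only [run, wp_bind, wp_tick, wp_pure]
  rw [if_pos (by omega)]
  exact h.wp_le (φ := fun a l t => wp (q.run F v) l t fun b l t => φ (.pair a b) l t)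
    (fun a t => wp_run_monotone F q v t fun b t => hφ _ t) (by omega)

theorem wp_ite_runs (c : Prog) (h : Runs F t c v w C) (hm : n + (1 + v.size + C) ≤ m)
    (hφ : ∀ a t, Monotone fun l => φ a l t) :
    wp ((if w = .nat 0 then q.run F v else p.run F v)) n t φ ≤
      wp ((Prog.ite c p q).run F v) m t φ := by
  simp only [run, wp_bind, wp_tick]
  rw [if_pos (show 1 + v.size ≤ m by omega)]
  have h1 := h.wp_le (n := n) (m := m - (1 + v.size))
    (φ := fun a l t => wp (if a = .nat 0 then q.run F v else p.run F v) l t φ)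
    (fun a t => ?_) (by omega)
  · exact h1
  split_ifs
  · exact wp_run_monotone F q v t hφ
  · exact wp_run_monotone F p v t hφ

theorem wp_both : wp ((Prog.both p q).run F v) m t φ = if 1 + v.size ≤ m then
    wp (p.run F v) (m - (1 + v.size)) t fun a l t => wp (q.run F v) l t fun b l t =>
      φ (.pair a b) l t else 0 := by
  simp only [run, wp_bind, wp_tick, wp_pure]

theorem wp_rand_nat (k : ℕ) : wp (Prog.rand.run F (.nat k)) m t φ =
    if 1 + (Val.nat k).size ≤ m then
      ∑' i, PMF.uniformOfFintype (Fin (k + 1)) i * if (Val.nat i).size ≤ m - (1 + (Val.nat k).size)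
        then φ (.nat i) (m - (1 + (Val.nat k).size) - (Val.nat i).size) t else 0 else 0 := by
  simp only [run, wp_bind, wp_tick, wp_sample, wp_pure]

theorem wp_rand_pair (a b : Val) : wp (Prog.rand.run F (.pair a b)) m t φ =
    if 1 + (Val.pair a b).size ≤ m then φ (.nat 0) (m - (1 + (Val.pair a b).size)) t else 0 := by
  simp only [run, wp_bind, wp_tick, wp_pure]

theorem wp_whileLoop_le_add (c p : Prog) (k d : ℕ) : ∀ (a : Val) (l : ℕ) (t : τ),
    wp (whileLoop (c.run F) (p.run F) k a) l t φ ≤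
      wp (whileLoop (c.run F) (p.run F) (k + d) a) l t φ := by
  induction k with
  | zero =>
    intro a l t
    simp only [whileLoop, wp_timeout]
    exact zero_le
  | succ k ih =>
    intro a l t
    rw [Nat.add_right_comm]
    simp only [whileLoop, wp_bind, wp_tick]
    split_ifs
    · refine wp_mono' _ _ _ fun x e t' => ?_
      split_ifs
      · exact le_rfl
      · simp only [wp_bind]
        exact wp_mono' _ _ _ fun w e t' => ih w e t'
    · exact le_rfl

theorem wp_whileLoop_monotone {c p : Prog} (hφ : ∀ a t, Monotone fun l => φ a l t) (k : ℕ) :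
    ∀ (a : Val) (t : τ), Monotone fun l => wp (whileLoop (c.run F) (p.run F) k a) l t φ := by
  induction k with
  | zero =>
    intro a t l l' _
    simp only [whileLoop, wp_timeout, le_refl]
  | succ k ih =>
    intro a t l l' hl
    simp only [whileLoop, wp_bind, wp_tick]
    split_ifs with h1 h2
    · refine wp_run_monotone F c a t (fun x t' => ?_) (Nat.sub_le_sub_right hl _)
      split_ifs
      · simpa only [wp_pure] using hφ _ _
      · simp only [wp_bind]
        exact wp_run_monotone F p a t' fun x t' => ih x t'
    · omega
    · exact zero_le
    · exact zero_le

theorem wp_whileLoop_le {c p : Prog} (hφ : ∀ a t, Monotone fun l => φ a l t) {k k' l l' : ℕ}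
    (hk : k ≤ k') (hl : l ≤ l') (a : Val) (t : τ) :
    wp (whileLoop (c.run F) (p.run F) k a) l t φ ≤
      wp (whileLoop (c.run F) (p.run F) k' a) l' t φ := by
  obtain ⟨d, rfl⟩ := Nat.exists_eq_add_of_le hk
  exact (wp_whileLoop_le_add c p k d a l t).trans (wp_whileLoop_monotone hφ _ a t hl)

theorem runs_fst (a b : Val) : Runs F t (.op .fst) (.pair a b) a (3 * (Val.pair a b).size) :=
  (Runs.op .fst).mono (by simp only [Op.eval, Val.size]; omega)

theorem runs_snd (a b : Val) : Runs F t (.op .snd) (.pair a b) b (3 * (Val.pair a b).size) :=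
  (Runs.op .snd).mono (by simp only [Op.eval, Val.size]; omega)

theorem runs_snd_fst (a b c : Val) : Runs F t (.comp (.op .snd) (.op .fst))
    (.pair a (.pair b c)) b (8 * (Val.pair a (.pair b c)).size) :=
  ((runs_snd _ _).comp (runs_fst _ _)).mono (by simp only [Val.size]; omega)

theorem runs_snd_snd (a b c : Val) : Runs F t (.comp (.op .snd) (.op .snd))
    (.pair a (.pair b c)) c (8 * (Val.pair a (.pair b c)).size) :=
  ((runs_snd _ _).comp (runs_snd _ _)).mono (by simp only [Val.size]; omega)

theorem runs_drop (a b c : Val) : Runs F t (.both (.op .fst) (.comp (.op .snd) (.op .snd)))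
    (.pair a (.pair b c)) (.pair a c) (13 * (Val.pair a (.pair b c)).size) :=
  ((runs_fst _ _).both (runs_snd_snd _ _ _)).mono (by simp only [Val.size]; omega)

end Wp

section Simulation

variable {σ : Type}

/-- The program `H` answers queries like the environment `E`, within a cost bound, as long as the
state satisfies the invariant `J` (depending on the remaining budget). -/
structure Handles (E : Env σ) (F : Env Unit) (enc : σ → Val) (J : ℕ → σ → Prop) (B D : ℕ)
    (H : Prog) : Prop where
  anti : ∀ s l l', l ≤ l' → J l' s → J l s
  step : ∀ s v l, J (l + 1) s → ∀ x, E s v x ≠ 0 → J l x.2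
  size : ∀ l s, J l s → (enc s).size ≤ D
  handle : ∀ s v l, J (l + 1) s → v.size ≤ B → ∀ φ : Val → ℕ → Unit → ℝ≥0∞,
    (∀ a t, Monotone fun l => φ a l t) → ∀ n,
      ∑' x, E s v x * φ (.pair x.1 (enc x.2)) n () ≤ wp (H.run F (.pair v (enc s))) (n + D) () φ

/-- The simulated program does what the program does with the original environment. -/
def Simulates (E : Env σ) (F : Env Unit) (enc : σ → Val) (J : ℕ → σ → Prop) (B M : ℕ)
    (p p' : Prog) : Prop :=
  -- One step of the original program is worth `M` steps of the simulated one; `K` is a reserve for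
  -- whatever is executed afterwards.
  ∀ v T s, J T s → T ≤ B → ∀ K m, M * T + K ≤ m → ∀ (χ : Val → ℕ → σ → ℝ≥0∞)
    (φ : Val → ℕ → Unit → ℝ≥0∞), (∀ a t, Monotone fun l => φ a l t) →
    (∀ w l s', l + w.size ≤ T → J l s' → χ w l s' ≤ φ (.pair w (enc s')) (M * l + K) ()) →
    wp (p.run E v) T s χ ≤ wp (p'.run F (.pair v (enc s))) m () φ

variable {E : Env σ} {F : Env Unit} {enc : σ → Val} {J : ℕ → σ → Prop} {B D M : ℕ} {H : Prog}

/-- Every node of the original program pays at least one step, which releases `M` steps for the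
additional work of the simulation at that node. -/
theorem mul_sub_add_le {M T c : ℕ} (h1 : 1 ≤ c) (h2 : c ≤ T) : M * (T - c) + M ≤ M * T := by
  obtain ⟨e, rfl⟩ := Nat.exists_eq_add_of_le h2
  rw [Nat.add_sub_cancel_left, mul_add]
  have := Nat.mul_le_mul_left M h1
  omega

/-- Values that occur have size at most `B`, since they were paid for, and encoded states have size
at most `D`. The constant 1000 is a generous bound for the data movement around any one construct.
-/
theorem Handles.op (h : Handles E F enc J B D H) (hM : 1000 * (1 + B + D) ≤ M) (f : Op) :
    Simulates E F enc J B M (.op f) (simulate H (.op f)) := by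
  intro v T s hs hT K m hm χ φ hφ hχ
  have hD := h.size _ _ hs
  simp only [run, wp_bind, wp_tick, wp_pure]
  split_ifs with h1
  · refine (hχ _ _ _ (by omega) (h.anti _ _ _ (Nat.sub_le _ _) hs)).trans ?_
    have h2 := mul_sub_add_le (M := M) (by omega) h1
    refine (((runs_fst v (enc s)).comp (Runs.op f)).both (runs_snd v (enc s))).wp_le hφ ?_
    simp only [Val.size]
    omega
  · exact zero_le

theorem Handles.comp (h : Handles E F enc J B D H) (hM : 1000 * (1 + B + D) ≤ M) {p q p' q' : Prog}
    (hp : Simulates E F enc J B M p p') (hq : Simulates E F enc J B M q q') :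
    Simulates E F enc J B M (.comp p q) (.comp p' q') := by
  intro v T s hs hT K m hm χ φ hφ hχ
  have hD := h.size _ _ hs
  rw [run]
  simp only [wp_bind, wp_tick]
  split_ifs with h1
  · have h2 := mul_sub_add_le (M := M) (by omega) h1
    refine le_trans ?_ (wp_comp (n := M * (T - (1 + v.size)) + K) ?_ hφ)
    · refine hp v _ s (h.anti _ _ _ (Nat.sub_le _ _) hs) (by omega) K _ le_rfl _ _
        (fun a t => wp_run_monotone F q' a t hφ) fun w l s' hl hs' => ?_
      refine hq w l s' hs' (by omega) K _ le_rfl _ _ hφ fun w' l' s'' hl' hs'' => ?_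
      exact hχ _ _ _ (by omega) hs''
    · simp only [Val.size]
      omega
  · exact zero_le

theorem Handles.both (h : Handles E F enc J B D H) (hM : 1000 * (1 + B + D) ≤ M) {p q : Prog}
    (hp : Simulates E F enc J B M p (simulate H p))
    (hq : Simulates E F enc J B M q (simulate H q)) :
    Simulates E F enc J B M (.both p q) (simulate H (.both p q)) := by
  intro v T s hs hT K m hm χ φ hφ hχ
  have hD := h.size _ _ hs
  rw [run]
  simp only [wp_bind, wp_tick, wp_pure]
  split_ifs with h1
  swap
  · exact zero_le
  have h2 := mul_sub_add_le (M := M) (by omega) h1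
  set T' := T - (1 + v.size) with hT'
  rw [simulate]
  -- The decreasing constants are what remains, after each rearrangement of the data, of the `M`
  -- steps released at this node.
  refine le_trans ?_ (wp_comp (n := M * T' + K + 500 * (1 + B + D)) ?_ hφ)
  · refine le_trans ?_ (wp_both_runs_left (n := M * T' + (K + 300 * (1 + B + D)))
      (runs_fst v (enc s)) ?_ fun a t => wp_run_monotone F _ a t hφ)
    · refine hp v _ s (h.anti _ _ _ (Nat.sub_le _ _) hs) (by omega) _ _ le_rfl _ _
        (fun a t => wp_run_monotone F _ _ t hφ) fun a l s' hl hs' => ?_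
      have hD' := h.size _ _ hs'
      refine le_trans ?_ (wp_comp (n := M * l + K + 290 * (1 + B + D)) ?_ hφ)
      · refine le_trans ?_ (wp_both_runs_left (n := M * l + K + 250 * (1 + B + D))
          (runs_snd_fst v a (enc s')) ?_ fun a t => wp_run_monotone F _ a t hφ)
        · refine le_trans ?_ (wp_comp_runs (n := M * l + (K + 200 * (1 + B + D)))
            (runs_drop v a (enc s')) ?_ fun a t => wp_run_monotone F _ _ t hφ)
          · refine hq v l s' hs' (by omega) _ _ le_rfl _ _
              (fun a t => wp_run_monotone F _ _ t hφ) fun b l' s'' hl' hs'' => ?_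
            have hD'' := h.size _ _ hs''
            refine (hχ (.pair a b) l' s'' ?_ hs'').trans ?_
            · simp only [Val.size]
              omega
            · refine (((runs_fst a _).both (runs_snd_fst a b (enc s''))).both
                (runs_snd_snd a b (enc s''))).wp_le hφ ?_
              simp only [Val.size]
              omega
          · simp only [Val.size]
            omega
        · simp only [Val.size]
          omega
      · simp only [Val.size]
        omega
    · simp only [Val.size]
      omega
  · simp only [Val.size]
    omega

theorem Handles.ite (h : Handles E F enc J B D H) (hM : 1000 * (1 + B + D) ≤ M) {c p q : Prog}
    (hc : Simulates E F enc J B M c (simulate H c))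
    (hp : Simulates E F enc J B M p (simulate H p))
    (hq : Simulates E F enc J B M q (simulate H q)) :
    Simulates E F enc J B M (.ite c p q) (simulate H (.ite c p q)) := by
  intro v T s hs hT K m hm χ φ hφ hχ
  have hD := h.size _ _ hs
  rw [run]
  simp only [wp_bind, wp_tick]
  split_ifs with h1
  swap
  · exact zero_le
  have h2 := mul_sub_add_le (M := M) (by omega) h1
  set T' := T - (1 + v.size) with hT'
  rw [simulate]
  refine le_trans ?_ (wp_comp (n := M * T' + K + 500 * (1 + B + D)) ?_ hφ)
  · refine le_trans ?_ (wp_both_runs_left (n := M * T' + (K + 300 * (1 + B + D)))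
      (runs_fst v (enc s)) ?_ fun a t => wp_run_monotone F _ a t hφ)
    · refine hc v _ s (h.anti _ _ _ (Nat.sub_le _ _) hs) (by omega) _ _ le_rfl _ _
        (fun a t => wp_run_monotone F _ _ t hφ) fun a l s' hl hs' => ?_
      have hD' := h.size _ _ hs'
      refine le_trans ?_ (wp_ite_runs (n := M * l + K + 200 * (1 + B + D)) _
        (runs_snd_fst v a (enc s')) ?_ hφ)
      · split_ifs with ha
        · refine le_trans ?_ (wp_comp_runs (n := M * l + K)
            (runs_drop v a (enc s')) ?_ hφ)
          · exact hq v l s' hs' (by omega) _ _ le_rfl _ _ hφ fun b l' s'' hl' hs'' =>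
              hχ b l' s'' (by omega) hs''
          · simp only [Val.size]
            omega
        · refine le_trans ?_ (wp_comp_runs (n := M * l + K)
            (runs_drop v a (enc s')) ?_ hφ)
          · exact hp v l s' hs' (by omega) _ _ le_rfl _ _ hφ fun b l' s'' hl' hs'' =>
              hχ b l' s'' (by omega) hs''
          · simp only [Val.size]
            omega
      · simp only [Val.size]
        omega
    · simp only [Val.size]
      omega
  · simp only [Val.size]
    omega

theorem Handles.rand (h : Handles E F enc J B D H) (hM : 1000 * (1 + B + D) ≤ M) :
    Simulates E F enc J B M .rand (simulate H .rand) := by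
  intro v T s hs hT K m hm χ φ hφ hχ
  have hD := h.size _ _ hs
  have hpost : ∀ (w : Val) (l : ℕ), v.size ≤ T → l + w.size ≤ T →
      χ w l s ≤ wp ((Prog.op .snd).run F (.pair v (enc s))) (M * l + K + 200 * (1 + B + D)) ()
        fun b l t => φ (.pair w b) l t := by
    intro w l hv hl
    refine (hχ w l s (by omega) (h.anti _ _ _ (by omega) hs)).trans ?_
    refine (runs_snd v (enc s)).wp_le (φ := fun b l t => φ (.pair w b) l t) (fun a t => hφ _ t) ?_
    simp only [Val.size]
    omega
  have hmono : ∀ (w : Val) (t : Unit), Monotone fun l => wp ((Prog.op .snd).run F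
      (.pair v (enc s))) l t fun b l t => φ (.pair w b) l t :=
    fun w t => wp_run_monotone F _ _ t fun a t => hφ _ t
  rw [simulate, wp_both]
  rcases v with k | ⟨a, b⟩
  · rw [wp_rand_nat]
    split_ifs with h1 h2
    · have h3 := mul_sub_add_le (M := M) (by omega) h1
      refine le_trans ?_ (wp_comp_runs (n := M * (T - (1 + (Val.nat k).size)) + K +
        500 * (1 + B + D)) (runs_fst (.nat k) (enc s)) ?_ hmono)
      · rw [wp_rand_nat, if_pos (by omega)]
        refine ENNReal.tsum_le_tsum fun i => mul_le_mul_right ?_ _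
        have h6 : (Val.nat i).size ≤ (Val.nat k).size := by
          have := Nat.size_le_size (Nat.le_of_lt_succ i.2)
          simp only [Val.size]
          omega
        split_ifs with h4 h5
        · refine (hpost (.nat i) _ (by omega) (by omega)).trans (hmono _ _ ?_)
          have h7 := mul_sub_add_le (M := M) (Val.one_le_size _) h4
          omega
        · omega
        · exact zero_le
        · exact zero_le
      · simp only [Val.size] at *
        omega
    · have h3 := mul_sub_add_le (M := M) (by omega) h1
      simp only [Val.size] at *
      omega
    · exact zero_le
    · exact zero_le
  · rw [wp_rand_pair]
    split_ifs with h1 h2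
    · have h3 := mul_sub_add_le (M := M) (by omega) h1
      refine le_trans ?_ (wp_comp_runs (n := M * (T - (1 + (Val.pair a b).size)) + K +
        500 * (1 + B + D)) (runs_fst (.pair a b) (enc s)) ?_ hmono)
      · rw [wp_rand_pair, if_pos (by omega)]
        refine (hpost (.nat 0) _ (by omega) ?_).trans (hmono _ _ ?_)
        · have h4 : (Val.nat 0).size = 1 := rfl
          omega
        · simp only [Val.size] at *
          omega
      · simp only [Val.size] at *
        omega
    · have h3 := mul_sub_add_le (M := M) (by omega) h1
      simp only [Val.size] at *
      omega
    · exact zero_le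
    · exact zero_le

theorem Handles.query (h : Handles E F enc J B D H) (hM : 1000 * (1 + B + D) ≤ M) :
    Simulates E F enc J B M .query (simulate H .query) := by
  intro v T s hs hT K m hm χ φ hφ hχ
  rw [run, simulate]
  simp only [wp_bind, wp_tick, wp_send, wp_pure]
  split_ifs with h1
  swap
  · exact zero_le
  have h2 := mul_sub_add_le (M := M) (by omega) h1
  have hs' : J (T - (1 + v.size) + 1) s := h.anti _ _ _ (by omega) hs
  refine le_trans ?_ ((h.handle s v _ hs' (by omega) φ hφ (M * (T - (1 + v.size)) + K)).trans
    (wp_run_monotone F H _ () hφ (by omega)))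
  refine ENNReal.tsum_le_tsum fun x => ?_
  by_cases hx : E s v x = 0
  · simp [hx]
  refine mul_le_mul_right ?_ _
  split_ifs with h3
  · refine (hχ _ _ _ (by omega) (h.anti _ _ _ (Nat.sub_le _ _) (h.step s v _ hs' x hx))).trans
      (hφ _ _ ?_)
    have := Nat.mul_le_mul_left M (Nat.sub_le (T - (1 + v.size)) x.1.size)
    omega
  · exact zero_le

theorem wp_loop {τ : Type} {F : Env τ} {t : τ} {c p : Prog} {v : Val} {m : ℕ}
    {φ : Val → ℕ → τ → ℝ≥0∞} : wp ((Prog.loop c p).run F v) m t φ = if 1 + v.size ≤ m then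
      wp (whileLoop (c.run F) (p.run F) (m - (1 + v.size)) v) (m - (1 + v.size)) t φ else 0 := by
  simp only [run, wp_bind, wp_tick, wp_budget]

theorem wp_whileLoop_succ {τ : Type} {t : τ} {c p : Val → Exec τ Val} {v : Val} {m n : ℕ}
    {φ : Val → ℕ → τ → ℝ≥0∞} : wp (whileLoop c p (n + 1) v) m t φ = if 1 + v.size ≤ m then
      wp (c v) (m - (1 + v.size)) t (fun a l t => if a = .nat 0 then φ v l t else
        wp (p v) l t fun w l t => wp (whileLoop c p n w) l t φ) else 0 := by
  simp only [whileLoop, wp_bind, wp_tick]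
  congr 1
  refine wp_congr_post fun a l t => ?_
  split_ifs
  · rw [wp_pure]
  · rw [wp_bind]

/-- Evaluating the condition of a simulated loop. -/
theorem Handles.evalCond (h : Handles E F enc J B D H) {c c' : Prog}
    (hc : Simulates E F enc J B M c c') {v : Val} {T : ℕ} {s : σ} (hs : J T s) (hv : v.size ≤ B)
    (hT : T ≤ B) {K m : ℕ} (hm : M * T + K + 500 * (1 + B + D) ≤ m) {χ : Val → ℕ → σ → ℝ≥0∞}
    {φ : Val → ℕ → Unit → ℝ≥0∞} (hφ : ∀ a t, Monotone fun l => φ a l t)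
    (hχ : ∀ a l s', l + a.size ≤ T → J l s' →
      χ a l s' ≤ φ (.pair a (.pair v (enc s'))) (M * l + K) ()) :
    wp (c.run E v) T s χ ≤ wp ((Prog.evalCond c').run F (.pair v (enc s))) m () φ := by
  have hD := h.size _ _ hs
  rw [Prog.evalCond]
  refine le_trans ?_ (wp_comp (n := M * T + K + 400 * (1 + B + D)) ?_ hφ)
  · refine le_trans ?_ (wp_both_runs_left (n := M * T + (K + 300 * (1 + B + D)))
      (runs_fst v (enc s)) ?_ fun a t => wp_run_monotone F _ a t hφ)
    · refine hc v _ s hs hT _ _ le_rfl _ _ (fun a t => wp_run_monotone F _ _ t hφ)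
        fun a l s' hl hs' => ?_
      have hD' := h.size _ _ hs'
      refine (hχ a l s' hl hs').trans ?_
      refine ((runs_snd_fst v a (enc s')).both (runs_drop v a (enc s'))).wp_le hφ ?_
      simp only [Val.size]
      omega
    · simp only [Val.size]
      omega
  · simp only [Val.size]
    omega

/-- The condition may change the state of the environment, so the simulated loop carries the value
of the condition along with the loop variable and the state, and only tests it. The condition is
evaluated once before the loop and again at the end of each round. -/
theorem Handles.loop (h : Handles E F enc J B D H) (hM : 1000 * (1 + B + D) ≤ M) {c p : Prog}
    (hc : Simulates E F enc J B M c (simulate H c))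
    (hp : Simulates E F enc J B M p (simulate H p)) :
    Simulates E F enc J B M (.loop c p) (simulate H (.loop c p)) := by
  intro v T s hs hT K m hm χ φ hφ hχ
  have hD := h.size _ _ hs
  set body := Prog.comp (.op .snd) (.comp (simulate H p) (Prog.evalCond (simulate H c))) with hbody
  let Ω (n : ℕ) (a : Val) (l : ℕ) : ℝ≥0∞ :=
    wp (whileLoop ((Prog.op .fst).run F) (body.run F) n a) l () fun a l t =>
      wp ((Prog.op .snd).run F a) l t φ
  have hΦ : ∀ (a : Val) (t : Unit), Monotone fun l => wp ((Prog.op .snd).run F a) l t φ :=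
    fun a t => wp_run_monotone F _ a t hφ
  have hΩ : ∀ {n n' l l' : ℕ}, n ≤ n' → l ≤ l' → ∀ a, Ω n a l ≤ Ω n' a l' :=
    fun hn hl a => wp_whileLoop_le hΦ hn hl a ()
  -- The claim starts at an evaluation of the condition, and `Ψ` is the continuation, either the
  -- entry of the loop or its next round. Fuel exceeding the remaining original budget by one is
  -- enough, as each further round costs the original a step.
  have key : ∀ (n : ℕ) (v : Val) (T' : ℕ) (s : σ), T' ≤ T → v.size ≤ B → J T' s → ∀ m,
      M * T' + K ≤ m → ∀ Ψ : Val → ℕ → Unit → ℝ≥0∞, (∀ a t, Monotone fun l => Ψ a l t) →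
      (∀ a l e, a.size ≤ 2 + 2 * B + D → e < T' → Ω (e + 1) a l ≤ Ψ a (l + 100 * (1 + B + D)) ()) →
      wp (whileLoop (c.run E) (p.run E) n v) T' s χ ≤
        wp ((Prog.evalCond (simulate H c)).run F (.pair v (enc s))) m () Ψ := by
    intro n
    induction n with
    | zero =>
      intro v T' s _ _ _ m _ Ψ _ _
      simp only [whileLoop, wp_timeout]
      exact zero_le
    | succ n ih =>
      intro v T' s hT' hv hs m hm Ψ hΨ hΩΨ
      rw [wp_whileLoop_succ]
      split_ifs with h1
      swap
      · exact zero_le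
      have h2 := mul_sub_add_le (M := M) (by omega) h1
      refine h.evalCond hc (h.anti _ _ _ (Nat.sub_le _ _) hs) hv (by omega)
        (K := K + 400 * (1 + B + D)) (by omega) hΨ fun a l s' hl hs' => ?_
      have hD' := h.size _ _ hs'
      have hsz : (Val.pair a (.pair v (enc s'))).size ≤ 2 + 2 * B + D := by
        simp only [Val.size]
        omega
      refine le_trans ?_ ((hΩΨ _ (M * l + K + 300 * (1 + B + D)) l hsz (by omega)).trans
        (hΨ _ _ (by omega)))
      simp only [Ω]
      rw [wp_whileLoop_succ, if_pos (show 1 + (Val.pair a (.pair v (enc s'))).size ≤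
        M * l + K + 300 * (1 + B + D) by omega)]
      refine le_trans ?_ ((runs_fst a (.pair v (enc s'))).wp_le
        (n := M * l + K + 200 * (1 + B + D))
        (φ := fun b l' t => if b = .nat 0 then
          wp ((Prog.op .snd).run F (.pair a (.pair v (enc s')))) l' t φ
          else wp (body.run F (.pair a (.pair v (enc s')))) l' t fun w l' t =>
            wp (whileLoop ((Prog.op .fst).run F) (body.run F) l w) l' t fun a l t =>
              wp ((Prog.op .snd).run F a) l t φ) (fun b t => ?_) ?_)
      · split_ifs with ha
        · refine (hχ v l s' (by omega) hs').trans ?_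
          exact (runs_snd a (.pair v (enc s'))).wp_le hφ (by omega)
        · refine le_trans ?_ (wp_comp_runs (n := M * l + K + 150 * (1 + B + D))
            (runs_snd a (.pair v (enc s'))) (by omega) fun a t => wp_whileLoop_monotone hΦ _ a t)
          refine le_trans ?_ (wp_comp (n := M * l + K)
            (by simp only [Val.size] at *; omega) fun a t => wp_whileLoop_monotone hΦ _ a t)
          refine hp v l s' hs' (by omega) K _ le_rfl _ _
            (fun a t => wp_run_monotone F _ _ t fun a t => wp_whileLoop_monotone hΦ _ a t)
            fun w l' s'' hl' hs'' => ?_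
          refine ih w l' s'' (by omega) (by omega) hs'' _ le_rfl _
            (fun a t => wp_whileLoop_monotone hΦ _ a t) fun a' L e _ he => ?_
          exact hΩ (by omega) (by omega) a'
      · split_ifs
        · exact wp_run_monotone F _ _ t hφ
        · exact wp_run_monotone F _ _ t fun a t => wp_whileLoop_monotone hΦ _ a t
      · omega
  rw [wp_loop]
  split_ifs with h1
  swap
  · exact zero_le
  have h2 := mul_sub_add_le (M := M) (by omega) h1
  rw [simulate]
  refine le_trans ?_ (wp_comp (n := M * (T - (1 + v.size)) + (K + 500 * (1 + B + D))) ?_ hφ)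
  · refine key _ v _ s (Nat.sub_le _ _) (by omega) (h.anti _ _ _ (Nat.sub_le _ _) hs) _ ?_ _
      (fun a t => wp_run_monotone F _ a t hφ) ?_
    · omega
    · intro a l e ha he
      refine le_trans ?_ (wp_comp (n := l + 50 * (1 + B + D)) (by omega) hφ)
      rw [wp_loop, if_pos (by omega)]
      exact hΩ (by omega) (by omega) a
  · simp only [Val.size]
    omega

theorem Handles.simulates (h : Handles E F enc J B D H) (hM : 1000 * (1 + B + D) ≤ M) (p : Prog) :
    Simulates E F enc J B M p (simulate H p) := by
  induction p with
  | op f => exact h.op hM f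
  | comp p q hp hq => exact h.comp hM hp hq
  | both p q hp hq => exact h.both hM hp hq
  | ite c p q hc hp hq => exact h.ite hM hc hp hq
  | loop c p hc hp => exact h.loop hM hc hp
  | rand => exact h.rand hM
  | query => exact h.query hM

end Simulation

end Prog


namespace GroupFamily

open Prog Val

variable {𝒢 : GroupFamily} {ι : Type} {κ : ι → ℕ}

/-! ### Computations with short lists -/

/-- Lists as data. -/
def encList {A : Type} (e : A → Val) (l : List A) : Val := ofList (l.map e)

theorem length_le_size_encList {A : Type} (e : A → Val) (l : List A) :
    l.length ≤ (encList e l).size := by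
  induction l with
  | nil => exact Nat.zero_le _
  | cons a l ih =>
    have : (encList e (a :: l)).size = 1 + (e a).size + (encList e l).size := rfl
    simp only [List.length_cons]
    omega

theorem size_encList_drop_le {A : Type} (e : A → Val) (l : List A) (k : ℕ) :
    (encList e (l.drop k)).size ≤ (encList e l).size := by
  induction l generalizing k with
  | nil => simp
  | cons a l ih =>
    rcases k with _ | k
    · simp
    · have : (encList e (a :: l)).size = 1 + (e a).size + (encList e l).size := rfl
      have := ih k
      simp only [List.drop_succ_cons]
      omega

theorem size_encList_le {A : Type} (e : A → Val) (l : List A) {C : ℕ} (h : ∀ a, (e a).size ≤ C) :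
    (encList e l).size ≤ l.length * (1 + C) + 1 := by
  induction l with
  | nil => exact le_of_eq (by simp [encList, ofList, Val.size])
  | cons a l ih =>
    have h1 : (encList e (a :: l)).size = 1 + (e a).size + (encList e l).size := rfl
    have := h a
    rw [List.length_cons, add_mul]
    omega

theorem encList_eq_zero_iff {A : Type} {e : A → Val} {l : List A} :
    encList e l = .nat 0 ↔ l = [] := by
  cases l <;> simp [encList, ofList]

namespace PolyTime

variable {f g : ι → Val}

theorem of_false (h : ι → False) : 𝒢.PolyTime κ f g :=
  (const (.nat 0)).congr fun i => (h i).elim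

theorem iff {p p' : ι → Prop} (hp : 𝒢.PolyTime κ f (fun i => ofProp (p i)))
    (h : ∀ i, p i ↔ p' i) : 𝒢.PolyTime κ f (fun i => ofProp (p' i)) :=
  hp.congr fun i => congrArg ofProp (propext (h i))

theorem or {p p' : ι → Prop} (hp : 𝒢.PolyTime κ f (fun i => ofProp (p i)))
    (hp' : 𝒢.PolyTime κ f (fun i => ofProp (p' i))) :
    𝒢.PolyTime κ f (fun i => ofProp (p i ∨ p' i)) :=
  iff (not (and (not hp) (not hp'))) fun i => by tauto

theorem enc_eq {a b : ∀ i, 𝒢.G (κ i)} (ha : 𝒢.PolyTime κ f (fun i => 𝒢.enc _ (a i)))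
    (hb : 𝒢.PolyTime κ f (fun i => 𝒢.enc _ (b i))) :
    𝒢.PolyTime κ f (fun i => ofProp (a i = b i)) :=
  iff (prop_eq ha hb) fun i => (𝒢.enc (κ i)).injective.eq_iff

theorem nat_eq {m n : ι → ℕ} (hm : 𝒢.PolyTime κ f (fun i => .nat (m i)))
    (hn : 𝒢.PolyTime κ f (fun i => .nat (n i))) :
    𝒢.PolyTime κ f (fun i => ofProp (m i = n i)) :=
  iff (prop_eq hm hn) fun i => by simp

theorem nat_lt {m n : ι → ℕ} (hm : 𝒢.PolyTime κ f (fun i => .nat (m i)))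
    (hn : 𝒢.PolyTime κ f (fun i => .nat (n i))) :
    𝒢.PolyTime κ f (fun i => ofProp (m i < n i)) :=
  iff (not (nat_eq (nat_sub hn hm) (const (.nat 0)))) fun i => by omega

section Lists

variable {α : ι → Type} {e : ∀ i, α i → Val} {l : ∀ i, List (α i)}

/-- The index set for nonempty lists with given head and tail. -/
abbrev Cons {ι : Type} {α : ι → Type} (l : ∀ i, List (α i)) : Type :=
  Σ i, {p : α i × List (α i) // l i = p.1 :: p.2}

/-- Paths have length bounded by a constant. Recursion along them is therefore unrolled by induction
on the bound, with one such distinction per level and no loop. -/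
theorem list_cases (G : ∀ i, List (α i) → Val)
    (hl : 𝒢.PolyTime κ f (fun i => encList (e i) (l i)))
    (hnil : 𝒢.PolyTime (fun i : {i // l i = []} => κ i) (fun i => f i) (fun i => G i []))
    (hcons : 𝒢.PolyTime (fun x : Cons l => κ x.1) (fun x => f x.1)
      (fun x => G x.1 (x.2.1.1 :: x.2.1.2))) :
    𝒢.PolyTime κ f (fun i => G i (l i)) := by
  refine cases (fun i => l i = []) (iff (prop_eq hl (const (.nat 0))) fun i =>
    encList_eq_zero_iff) (hnil.congr fun i => by rw [i.2]) ?_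
  exact (hcons.comap fun i : {i // ¬l i = []} =>
    ⟨i.1, ((l i).head i.2, (l i).tail), (List.cons_head_tail i.2).symm⟩).congr fun i =>
      congrArg (G i) (List.cons_head_tail i.2)

theorem list_cons (hl : 𝒢.PolyTime κ f (fun i => encList (e i) (l i))) :
    𝒢.PolyTime (fun x : Cons l => κ x.1) (fun x => f x.1)
      (fun x => .pair (e _ x.2.1.1) (encList (e _) x.2.1.2)) :=
  (hl.comap Sigma.fst).congr fun x => congrArg (encList (e x.1)) x.2.2

theorem list_head (hl : 𝒢.PolyTime κ f (fun i => encList (e i) (l i))) :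
    𝒢.PolyTime (fun x : Cons l => κ x.1) (fun x => f x.1) (fun x => e _ x.2.1.1) :=
  (list_cons hl).fst

theorem list_tail (hl : 𝒢.PolyTime κ f (fun i => encList (e i) (l i))) :
    𝒢.PolyTime (fun x : Cons l => κ x.1) (fun x => f x.1) (fun x => encList (e _) x.2.1.2) :=
  (list_cons hl).snd

theorem cons {a : ∀ i, α i} (ha : 𝒢.PolyTime κ f (fun i => e i (a i)))
    (hl : 𝒢.PolyTime κ f (fun i => encList (e i) (l i))) :
    𝒢.PolyTime κ f (fun i => encList (e i) (a i :: l i)) := ha.pair hl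

theorem length_tail_le {n : ℕ} (hn : ∀ i, (l i).length ≤ n + 1) (x : Cons l) :
    x.2.1.2.length ≤ n := by
  have := hn x.1
  rw [x.2.2, List.length_cons] at this
  omega

theorem eq_nil_of_length_le (hn : ∀ i, (l i).length ≤ 0) (i : ι) : l i = [] :=
  List.eq_nil_of_length_eq_zero (Nat.le_zero.1 (hn i))

theorem list_length (n : ℕ) (hn : ∀ i, (l i).length ≤ n)
    (hl : 𝒢.PolyTime κ f (fun i => encList (e i) (l i))) :
    𝒢.PolyTime κ f (fun i => .nat (l i).length) := by
  induction n generalizing ι with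
  | zero => exact (const (.nat 0)).congr fun i => by rw [eq_nil_of_length_le hn i]; rfl
  | succ n ih =>
    refine list_cases (fun i l => .nat l.length) hl (const (.nat 0)) ?_
    exact nat_add (ih (length_tail_le hn) (list_tail hl)) (const (.nat 1))

theorem getElem? (n : ℕ) (hn : ∀ i, (l i).length ≤ n)
    (hl : 𝒢.PolyTime κ f (fun i => encList (e i) (l i))) {j : ι → ℕ}
    (hj : 𝒢.PolyTime κ f (fun i => .nat (j i))) {a : ∀ i, α i}
    (ha : ∀ i, (l i)[j i]? = some (a i)) : 𝒢.PolyTime κ f (fun i => e i (a i)) := by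
  induction n generalizing ι with
  | zero =>
    refine of_false fun i => ?_
    have := ha i
    rw [eq_nil_of_length_le hn i] at this
    simp at this
  | succ n ih =>
    refine list_cases (fun i _ => e i (a i)) hl (of_false fun i => ?_) ?_
    · have := ha i
      rw [i.2] at this
      simp at this
    · have hj' : 𝒢.PolyTime (fun x : Cons l => κ x.1) (fun x => f x.1) (fun x => .nat (j x.1)) :=
        hj.comap Sigma.fst
      refine cases _ (nat_eq hj' (const (.nat 0))) ?_ ?_
      · refine ((list_head hl).comap Subtype.val).congr fun x => ?_
        have h1 := (congrArg (·[j x.1.1]?) x.1.2.2).symm.trans (ha x.1.1)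
        have h2 : j x.1.1 = 0 := x.2
        simp only [h2, List.getElem?_cons_zero, Option.some.injEq] at h1
        rw [h1]
      · refine ih (l := fun x : {x : Cons l // ¬j x.1 = 0} => x.1.2.1.2)
          (fun x => length_tail_le hn x.1) ((list_tail hl).comap Subtype.val)
          (j := fun x => j x.1.1 - 1) (nat_sub (hj'.comap Subtype.val) (const (.nat 1)))
          fun x => ?_
        have h1 := (congrArg (·[j x.1.1]?) x.1.2.2).symm.trans (ha x.1.1)
        have h2 : j x.1.1 = j x.1.1 - 1 + 1 := (Nat.sub_add_cancel (Nat.pos_of_ne_zero x.2)).symm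
        rw [← h1, h2, List.getElem?_cons_succ]
        rfl

theorem insertIdx (n : ℕ) (hn : ∀ i, (l i).length ≤ n)
    (hl : 𝒢.PolyTime κ f (fun i => encList (e i) (l i))) {j : ι → ℕ}
    (hj : 𝒢.PolyTime κ f (fun i => .nat (j i))) {a : ∀ i, α i}
    (ha : 𝒢.PolyTime κ f (fun i => e i (a i))) :
    𝒢.PolyTime κ f (fun i => encList (e i) ((l i).insertIdx (j i) (a i))) := by
  induction n generalizing ι with
  | zero =>
    refine cases _ (nat_eq hj (const (.nat 0))) ?_ ?_
    · refine ((cons ha hl).comap Subtype.val).congr fun i => ?_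
      have h1 : j i = 0 := i.2
      rw [h1]
      rfl
    · refine (const (.nat 0)).congr fun i => ?_
      rw [eq_nil_of_length_le hn i,
        show j i = j i - 1 + 1 from (Nat.sub_add_cancel (Nat.pos_of_ne_zero i.2)).symm]
      rfl
  | succ n ih =>
    refine cases _ (nat_eq hj (const (.nat 0))) ?_ ?_
    · refine ((cons ha hl).comap Subtype.val).congr fun i => ?_
      have h1 : j i = 0 := i.2
      rw [h1]
      rfl
    · have hl' : 𝒢.PolyTime (fun i : {i // ¬j i = 0} => κ i) (fun i => f i)
        (fun i => encList (e i) (l i)) := hl.comap Subtype.val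
      refine list_cases (fun (i : {i // ¬j i = 0}) l => encList (e i) (l.insertIdx (j i) (a i))) hl' ?_ ?_
      · refine (const (.nat 0)).congr fun i => ?_
        rw [show j i.1 = j i.1 - 1 + 1 from
          (Nat.sub_add_cancel (Nat.pos_of_ne_zero i.1.2)).symm]
        rfl
      · refine (cons (list_head hl') (ih (j := fun x => j x.1 - 1) (a := fun x => a x.1)
          (length_tail_le fun i => hn i.1) (list_tail hl')
          (nat_sub (hj.comap fun x : Cons (fun i : {i // ¬j i = 0} => l i) => x.1.1) (const (.nat 1)))
          (ha.comap fun x : Cons (fun i : {i // ¬j i = 0} => l i) => x.1.1))).congr fun x => ?_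
        have h2 : j x.1 = j x.1 - 1 + 1 := (Nat.sub_add_cancel (Nat.pos_of_ne_zero x.1.2)).symm
        conv_rhs => rw [h2, List.insertIdx_succ_cons]

/-- Turns the stored layers into the list in the challenge message, dropping headers and exponents.
-/
theorem map_snd_snd (n : ℕ) (hn : ∀ i, (l i).length ≤ n)
    (hl : 𝒢.PolyTime κ f (fun i => encList (e i) (l i))) {e' : ∀ i, α i → Val}
    (he : ∀ i a, Op.snd.eval (Op.snd.eval (e i a)) = e' i a) :
    𝒢.PolyTime κ f (fun i => encList (e' i) (l i)) := by
  induction n generalizing ι with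
  | zero =>
    exact (const (.nat 0)).congr fun i => by
      rw [eq_nil_of_length_le hn i]
      rfl
  | succ n ih =>
    refine list_cases (fun i l => encList (e' i) l) hl (const (.nat 0)) ?_
    exact ((((list_head hl).op .snd).op .snd).congr fun x => he _ _).pair
      (ih (length_tail_le hn) (list_tail hl) fun x => he x.1)

end Lists

/-! ### Lists of group elements -/

variable {ys : ∀ i, List (𝒢.G (κ i))}

theorem mem_list (n : ℕ) (hn : ∀ i, (ys i).length ≤ n)
    (hl : 𝒢.PolyTime κ f (fun i => encList (𝒢.enc _) (ys i))) {a : ∀ i, 𝒢.G (κ i)}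
    (ha : 𝒢.PolyTime κ f (fun i => 𝒢.enc _ (a i))) :
    𝒢.PolyTime κ f (fun i => ofProp (a i ∈ ys i)) := by
  induction n generalizing ι with
  | zero =>
    exact (const (.nat 0)).congr fun i => by
      rw [eq_nil_of_length_le hn i, ofProp_false (by simp)]
  | succ n ih =>
    refine list_cases (fun i l => ofProp (a i ∈ l)) hl
      ((const (.nat 0)).congr fun i => by rw [ofProp_false (by simp)]) ?_
    have ha' := ha.comap (Sigma.fst : Cons ys → ι)
    exact iff (or (enc_eq ha' (list_head hl)) (ih (length_tail_le (l := ys) hn) (list_tail hl) ha'))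
      fun x => List.mem_cons.symm

theorem nodup (n : ℕ) (hn : ∀ i, (ys i).length ≤ n)
    (hl : 𝒢.PolyTime κ f (fun i => encList (𝒢.enc _) (ys i))) :
    𝒢.PolyTime κ f (fun i => ofProp (ys i).Nodup) := by
  induction n generalizing ι with
  | zero =>
    exact (const (.nat 1)).congr fun i => by
      rw [eq_nil_of_length_le hn i, ofProp_true (by simp)]
  | succ n ih =>
    refine list_cases (fun i l => ofProp l.Nodup) hl
      ((const (.nat 1)).congr fun i => by rw [ofProp_true (by simp)]) ?_
    exact iff (and (not (mem_list n (length_tail_le (l := ys) hn) (list_tail hl) (list_head hl)))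
      (ih (length_tail_le (l := ys) hn) (list_tail hl))) fun x => List.nodup_cons.symm

theorem valid (h : 𝒢.Efficient) (n N : ℕ) (hn : ∀ i, (ys i).length ≤ n)
    (hp : 𝒢.PolyTime κ f (fun i => 𝒢.pub (κ i)))
    (hl : 𝒢.PolyTime κ f (fun i => encList (𝒢.enc _) (ys i))) {j : ι → ℕ}
    (hj : 𝒢.PolyTime κ f (fun i => .nat (j i))) :
    𝒢.PolyTime κ f (fun i => ofProp (Valid N (j i) (ys i))) := by
  have h1 := nat_add (list_length n hn hl) (const (.nat 1))
  exact iff (and (nodup n hn hl) (and (not (mem_list n hn hl (one h hp)))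
    (and (nat_lt hj h1) (nat_lt h1 (const (.nat N)))))) fun i =>
    and_congr Iff.rfl (and_congr_left' ⟨fun h y hy e => h (e ▸ hy), fun h h' => h 1 h' rfl⟩)

/-- Longer submissions are refused anyway, so decoding may stop after a constant number of elements.
-/
theorem exists_list (h : 𝒢.Efficient) (n : ℕ) {v : ι → Val}
    (hp : 𝒢.PolyTime κ f (fun i => 𝒢.pub (κ i))) (hv : 𝒢.PolyTime κ f v) :
    𝒢.PolyTime κ f (fun i => ofProp (∃ ys : List (𝒢.G (κ i)),
      ys.length ≤ n ∧ v i = encList (𝒢.enc _) ys)) := by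
  induction n generalizing v with
  | zero =>
    refine iff (prop_eq hv (const (.nat 0))) fun i => ⟨fun h => ⟨[], le_rfl, h⟩, ?_⟩
    rintro ⟨ys, hy, e⟩
    rw [e, List.eq_nil_of_length_eq_zero (Nat.le_zero.1 hy)]
    rfl
  | succ n ih =>
    refine iff (or (prop_eq hv (const (.nat 0))) (and (isPair hv) (and (mem h hp (hv.op .fst))
      (ih (hv.op .snd))))) fun i => ⟨?_, ?_⟩
    · rintro (h | ⟨⟨a, b, e⟩, ⟨c, hc⟩, ys, hy, e'⟩)
      · exact ⟨[], Nat.zero_le _, h⟩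
      · refine ⟨c :: ys, Nat.succ_le_succ hy, ?_⟩
        rw [e] at hc e' ⊢
        exact congrArg₂ Val.pair hc.symm e'
    · rintro ⟨_ | ⟨c, ys⟩, hy, e⟩
      · exact .inl e
      · refine .inr ⟨⟨_, _, e⟩, ⟨c, ?_⟩, ys, Nat.le_of_succ_le_succ hy, ?_⟩ <;> rw [e] <;> rfl

end PolyTime

end GroupFamily


namespace GroupFamily

open Prog Val

variable {𝒢 : GroupFamily} {ι : Type} {κ : ι → ℕ}

/-! ### The simulator's computations -/

/-- Oracle values as data. -/
def encFresh {κ : ℕ} (v : 𝒢.Fresh κ) : Val := .pair (encKey v.1) (𝒢.encExp v.2)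

/-- A log entry as data. -/
def Entry.enc {κ : ℕ} (en : 𝒢.Entry κ) : Val :=
  .pair (𝒢.enc κ en.hdr) (.pair (.pair (𝒢.enc κ en.left) (𝒢.enc κ en.right))
    (encFresh (en.key, en.bld)))

/-- A layer as data. -/
def Layer.enc {κ : ℕ} (X : 𝒢.G κ) (l : 𝒢.Layer κ) : Val :=
  .pair (𝒢.enc κ (l.hdr X)) (.pair (𝒢.encExp l.exp) (encFresh (l.key, l.bld)))

/-- Because `lookup` is a left fold, reading one more entry of the log is one conditional update;
this is the body of the loop that searches the log. -/
theorem lookup_append {κ : ℕ} (D : List (𝒢.Entry κ)) (en : 𝒢.Entry κ) (α s : 𝒢.G κ)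
    (v : 𝒢.Fresh κ) [Decidable (s = en.val)] [Decidable (s = en.val ∧ α = en.hdr)] :
    lookup (D ++ [en]) α s v =
      (if s = en.val then en.key else (lookup D α s v).1,
        if s = en.val ∧ α = en.hdr then en.bld else (lookup D α s v).2) := by
  simp only [lookup, lookupKey, lookupBld, List.foldl_append, List.foldl_cons, List.foldl_nil]
  congr

namespace PolyTime

variable {f g : ι → Val}

/-- The only use of the decision oracle in the reduction. -/
theorem cdh_eq_cdh {a₁ a₂ b₂ b₁ : ∀ i, 𝒢.G (κ i)} (hne : ∀ i, a₁ i ≠ 1)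
    (ha₁ : 𝒢.PolyTime κ f (fun i => 𝒢.enc _ (a₁ i))) (ha₂ : 𝒢.PolyTime κ f (fun i => 𝒢.enc _ (a₂ i)))
    (hb₂ : 𝒢.PolyTime κ f (fun i => 𝒢.enc _ (b₂ i)))
    (hb₁ : 𝒢.PolyTime κ f (fun i => 𝒢.enc _ (b₁ i))) :
    𝒢.PolyTime κ f (fun i => ofProp (cdh (a₁ i) (b₁ i) = cdh (a₂ i) (b₂ i))) :=
  (query (ha₁.pair (ha₂.pair (hb₂.pair hb₁)))).congr fun i => ddhReply_eq (hne i) _ _ _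

theorem lookup (h : 𝒢.Efficient) {D : ∀ i, List (𝒢.Entry (κ i))} {α a b : ∀ i, 𝒢.G (κ i)}
    {v : ∀ i, 𝒢.Fresh (κ i)} (hne : ∀ i, a i ≠ 1)
    (hD : 𝒢.PolyTime κ f (fun i => encList Entry.enc (D i)))
    (hα : 𝒢.PolyTime κ f (fun i => 𝒢.enc _ (α i))) (ha : 𝒢.PolyTime κ f (fun i => 𝒢.enc _ (a i)))
    (hb : 𝒢.PolyTime κ f (fun i => 𝒢.enc _ (b i))) (hv : 𝒢.PolyTime κ f (fun i => encFresh (v i))) :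
    𝒢.PolyTime κ f (fun i => encFresh (GroupFamily.lookup (D i) (α i) (cdh (a i) (b i)) (v i))) := by
  classical
  obtain ⟨t, ht⟩ := h.exists_size_bound
  let y : ι → ℕ → Val := fun i k => .pair (.pair (𝒢.enc _ (α i)) (.pair (𝒢.enc _ (a i))
    (𝒢.enc _ (b i)))) (.pair (encList Entry.enc ((D i).drop k))
      (encFresh (GroupFamily.lookup ((D i).take k) (α i) (cdh (a i) (b i)) (v i))))
  have hy : 𝒢.PolyTime κ f (fun i => y i (D i).length) := by
    refine loop y (fun i => (D i).length) ?_ (.X + 2 * t + 1) ?_ ?_ ?_ ?_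
    · exact (hα.pair (ha.pair hb)).pair (hD.pair hv)
    · intro i
      have h1 := length_le_size_encList Entry.enc (D i)
      simp only [y, Polynomial.eval_add, Polynomial.eval_X, Val.size, List.drop_zero]
      omega
    · intro i k _
      have h1 := t.eval_nat_mono (Nat.le_add_right (κ i) (y i 0).size)
      have h2 := size_encList_drop_le Entry.enc (D i) k
      have h3 : ∀ w : 𝒢.Fresh (κ i), (encFresh w).size ≤ 1 + 2 * t.eval (κ i) := by
        intro w
        have h4 := (ht (κ i)).2.2.1 w.2
        have h5 := (ht (κ i)).2.2.2 w.1
        simp only [encFresh, Val.size]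
        omega
      have h4 := h3 (GroupFamily.lookup ((D i).take k) (α i) (cdh (a i) (b i)) (v i))
      have h5 : (y i k).size ≤ (y i 0).size + 1 + 2 * t.eval (κ i) := by
        simp only [y, Val.size, List.drop_zero]
        omega
      simp only [Polynomial.eval_add, Polynomial.eval_X, Polynomial.eval_mul,
        Polynomial.eval_ofNat, Polynomial.eval_one]
      dsimp only at h1
      omega
    · refine iff (not (prop_eq refl.snd.fst (const (.nat 0)))) fun x => ?_
      rw [encList_eq_zero_iff, List.drop_eq_nil_iff, not_le]
    · have hr : 𝒢.PolyTime (fun x : {x : ι × ℕ // x.2 < (D x.1).length} => κ x.1.1)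
          (fun x => y x.1.1 x.1.2) (fun x => y x.1.1 x.1.2) := refl
      have hα' := hr.fst.fst
      have ha' := hr.fst.snd.fst
      have hb' := hr.fst.snd.snd
      have hlog : 𝒢.PolyTime (fun x : {x : ι × ℕ // x.2 < (D x.1).length} => κ x.1.1)
          (fun x => y x.1.1 x.1.2) (fun x => .pair (Entry.enc ((D x.1.1)[x.1.2]'x.2))
            (encList Entry.enc ((D x.1.1).drop (x.1.2 + 1)))) :=
        hr.snd.fst.congr fun x => by
          rw [List.drop_eq_getElem_cons x.2]
          rfl
      have hen := hlog.fst
      -- The element `a` asked about is nontrivial and serves as base of the quadruple; logged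
      -- entries need no such condition.
      have ht := cdh_eq_cdh (fun x => hne x.1.1) ha' hen.snd.fst.fst hen.snd.fst.snd hb'
      have hk := ite ht hen.snd.snd.fst hr.snd.snd.fst
      have hbl := ite (and ht (enc_eq hα' hen.fst)) hen.snd.snd.snd hr.snd.snd.snd
      refine (hr.fst.pair (hlog.snd.pair (hk.pair hbl))).congr fun x => ?_
      simp only [y]
      rw [List.take_succ_eq_append_getElem x.2, lookup_append]
      simp only [encFresh, Entry.val]
      congr 3 <;> split_ifs with hx <;> simp only [hx, and_self, if_true, if_false]
  refine hy.snd.snd.congr fun i => ?_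
  rw [List.take_length]

theorem ask (h : 𝒢.Efficient) {D : ∀ i, List (𝒢.Entry (κ i))} {α a b : ∀ i, 𝒢.G (κ i)}
    {v : ∀ i, 𝒢.Fresh (κ i)} (hne : ∀ i, a i ≠ 1)
    (hD : 𝒢.PolyTime κ f (fun i => encList Entry.enc (D i)))
    (hα : 𝒢.PolyTime κ f (fun i => 𝒢.enc _ (α i))) (ha : 𝒢.PolyTime κ f (fun i => 𝒢.enc _ (a i)))
    (hb : 𝒢.PolyTime κ f (fun i => 𝒢.enc _ (b i))) (hv : 𝒢.PolyTime κ f (fun i => encFresh (v i))) :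
    𝒢.PolyTime κ f (fun i => .pair (encFresh (GroupFamily.ask (D i) (α i) (a i) (b i) (v i)).1)
      (encList Entry.enc (GroupFamily.ask (D i) (α i) (a i) (b i) (v i)).2)) :=
  have hl := lookup h hne hD hα ha hb hv
  hl.pair (cons (hα.pair ((ha.pair hb).pair hl)) hD)

theorem simLayers (h : 𝒢.Efficient) (n : ℕ) {ys : ∀ i, List (𝒢.G (κ i))}
    (hn : ∀ i, (ys i).length ≤ n) {X : ∀ i, 𝒢.G (κ i)} {c : ∀ i, 𝒢.Exp (κ i)}
    {D : ∀ i, List (𝒢.Entry (κ i))} {vs : ∀ i, List (𝒢.Fresh (κ i))}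
    (hne : ∀ i, ∀ y ∈ ys i, y ≠ 1) (hp : 𝒢.PolyTime κ f (fun i => 𝒢.pub (κ i)))
    (hX : 𝒢.PolyTime κ f (fun i => 𝒢.enc _ (X i)))
    (hys : 𝒢.PolyTime κ f (fun i => encList (𝒢.enc _) (ys i)))
    (hc : 𝒢.PolyTime κ f (fun i => 𝒢.encExp (c i)))
    (hD : 𝒢.PolyTime κ f (fun i => encList Entry.enc (D i)))
    (hvs : 𝒢.PolyTime κ f (fun i => encList encFresh (vs i))) :
    𝒢.PolyTime κ f (fun i => .pair
      (encList (Layer.enc (X i)) (GroupFamily.simLayers (X i) (ys i) (c i) (D i) (vs i)).1)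
      (encList Entry.enc (GroupFamily.simLayers (X i) (ys i) (c i) (D i) (vs i)).2)) := by
  induction n generalizing ι with
  | zero =>
    refine ((const (.nat 0)).pair hD).congr fun i => ?_
    rw [eq_nil_of_length_le hn i]
    rfl
  | succ n ih =>
    refine list_cases (fun i ys => .pair
      (encList (Layer.enc (X i)) (GroupFamily.simLayers (X i) ys (c i) (D i) (vs i)).1)
      (encList Entry.enc (GroupFamily.simLayers (X i) ys (c i) (D i) (vs i)).2)) hys
      (((const (.nat 0)).pair hD).comap Subtype.val) ?_
    have hvs' := hvs.comap (Sigma.fst : Cons ys → ι)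
    refine list_cases (fun x vs => .pair
      (encList (Layer.enc (X x.1)) (GroupFamily.simLayers (X x.1) (x.2.1.1 :: x.2.1.2) (c x.1)
        (D x.1) vs).1)
      (encList Entry.enc (GroupFamily.simLayers (X x.1) (x.2.1.1 :: x.2.1.2) (c x.1)
        (D x.1) vs).2)) hvs' ?_ ?_
    · exact ((const (.nat 0)).pair hD).comap fun x : {x : Cons ys // vs x.1 = []} => x.1.1
    · let r : Cons (fun x : Cons ys => vs x.1) → Cons ys := Sigma.fst
      have hp' := hp.comap fun x => (r x).1
      have hX' := hX.comap fun x => (r x).1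
      have hc' := hc.comap fun x => (r x).1
      have hD' := hD.comap fun x => (r x).1
      have hy := (list_head hys).comap r
      have hα := PolyTime.pow h hp' hX' hc'
      have hask := ask h (fun x => hne (r x).1 _
        ((congrArg (fun l => (r x).2.1.1 ∈ l) (r x).2.2).mpr List.mem_cons_self))
        hD' hα hy hα (list_head hvs')
      have ih' := ih (fun x => length_tail_le hn (r x)) (X := fun x => X (r x).1)
        (fun x y hy => hne (r x).1 y
          ((congrArg (fun l => y ∈ l) (r x).2.2).mpr (List.mem_cons_of_mem _ hy)))
        hp' hX' ((list_tail hys).comap r) (exp_mul hp' hc' hask.fst.snd) hask.snd (list_tail hvs')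
      exact (cons (e := fun i => Layer.enc (X (r i).1))
        (a := fun i => (⟨c (r i).1, (r i).2.1.1, _, _⟩ : 𝒢.Layer (κ (r i).1)))
        (hα.pair (hc'.pair hask.fst)) ih'.fst).pair ih'.snd

end PolyTime

end GroupFamily


namespace GroupFamily

open Prog Val

/-! ### Messages and requests -/

section Requests

variable {𝒢 : GroupFamily} {κ : ℕ}

theorem toList_bind_mapM_eq_some {w : Val} {ys : List (𝒢.G κ)} :
    ((Val.toList w).bind fun vs => vs.mapM (𝒢.dec κ)) = some ys ↔ w = encList (𝒢.enc κ) ys := by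
  induction w generalizing ys with
  | nat n =>
    rw [toList]
    split_ifs with h
    · rcases ys with _ | ⟨y, ys⟩ <;> simp [encList, ofList, h]
    · rcases ys with _ | ⟨y, ys⟩ <;> simp [encList, ofList, h]
  | pair a b _ ih =>
    have h1 : ((Val.toList (.pair a b)).bind fun vs => vs.mapM (𝒢.dec κ)) =
        (𝒢.dec κ a).bind fun c =>
          ((Val.toList b).bind fun vs => vs.mapM (𝒢.dec κ)).map fun l => c :: l := by
      rw [toList]
      rcases Val.toList b with _ | l
      · cases 𝒢.dec κ a <;> rfl
      · simp only [Option.map_some, Option.bind_some, List.mapM_cons]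
        rcases 𝒢.dec κ a with _ | c
        · rfl
        · cases l.mapM (𝒢.dec κ) <;> rfl
    rw [h1]
    rcases ys with _ | ⟨y, ys⟩
    · simp [encList, ofList, Option.bind_eq_some_iff]
    · simp only [Option.bind_eq_some_iff, Option.map_eq_some_iff, ih, dec_eq_some, List.cons.injEq]
      constructor
      · rintro ⟨c, hc, l, hl, rfl, rfl⟩
        rw [← hc, hl]
        rfl
      · intro h
        have h2 : a = 𝒢.enc κ y ∧ b = encList (𝒢.enc κ) ys := Val.pair.inj h
        exact ⟨y, h2.1.symm, ys, h2.2, rfl, rfl⟩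

/-- The message for a request. -/
def Request.msg : 𝒢.Request κ → Val
  | .refuse => .nat 0
  | .decap α => .pair (.nat 0) (𝒢.enc κ α)
  | .hstar s => .pair (.nat 1) (𝒢.enc κ s)
  | .hblind α s => .pair (.nat 2) (.pair (𝒢.enc κ α) (𝒢.enc κ s))
  | .submit j ys => .pair (.nat 3) (.pair (.nat j) (encList (𝒢.enc κ) ys))

/-- The requests that are not refused. -/
def Request.Allowed (N : ℕ) (st : Option (𝒢.G κ)) : 𝒢.Request κ → Prop
  | .refuse => False
  | .decap α => st ≠ some α
  | .hstar _ => True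
  | .hblind _ _ => True
  | .submit j ys => st = none ∧ Valid N j ys

/-- Together with `allowed_parse`, messages that are not refused correspond exactly to allowed
requests. A machine can thus proceed by the shape of the message. -/
theorem parse_msg {N : ℕ} {st : Option (𝒢.G κ)} {r : 𝒢.Request κ} (h : r.Allowed N st) :
    parse N st r.msg = r := by
  cases r with
  | refuse => exact h.elim
  | decap α =>
    simp only [Request.msg, parse, if_true, dec_enc]
    exact if_neg h
  | hstar s => simp only [Request.msg, parse, if_true, if_false, one_ne_zero, dec_enc]
  | hblind α s =>
    simp only [Request.msg, parse, if_true, if_false, OfNat.ofNat_ne_zero, OfNat.ofNat_ne_one,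
      dec_enc]
  | submit j ys =>
    simp only [Request.msg, parse, if_true, if_false, OfNat.ofNat_ne_zero, OfNat.ofNat_ne_one,
      toList_bind_mapM_eq_some.2 (Eq.refl (encList (𝒢.enc κ) ys)), Nat.reduceEqDiff, h.1, h.2]

theorem allowed_parse {N : ℕ} {st : Option (𝒢.G κ)} {v : Val} (h : parse N st v ≠ .refuse) :
    (parse N st v).Allowed N st ∧ v = (parse N st v).msg := by
  unfold parse at h ⊢
  split at h
  · rename_i t m
    split_ifs at h ⊢ with h0 h1 h2 h3
    · split at h
      · rename_i α hα
        split_ifs at h ⊢ with hs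
        · exact (h rfl).elim
        · exact ⟨hs, by rw [h0, Request.msg, dec_eq_some.1 hα]⟩
      · exact (h rfl).elim
    · split at h
      · rename_i α hα
        exact ⟨trivial, by rw [h1, Request.msg, dec_eq_some.1 hα]⟩
      · exact (h rfl).elim
    · split at h
      · split at h
        · rename_i hα hs
          exact ⟨trivial, by rw [h2, Request.msg, dec_eq_some.1 hα, dec_eq_some.1 hs]⟩
        · exact (h rfl).elim
      · exact (h rfl).elim
    · split at h
      · split at h
        · rename_i ys hys
          split_ifs at h with hv
          · simp only [if_pos hv]
            exact ⟨⟨rfl, hv⟩, by rw [h3, Request.msg, toList_bind_mapM_eq_some.1 hys]⟩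
          · exact (h rfl).elim
        · exact (h rfl).elim
      · exact (h rfl).elim
    · exact (h rfl).elim
  · exact (h rfl).elim

theorem length_simLayers (X : 𝒢.G κ) (ys : List (𝒢.G κ)) (e : 𝒢.Exp κ) (vs : List (𝒢.Fresh κ))
    (D : List (𝒢.Entry κ)) (h : ys.length ≤ vs.length) :
    (simLayers X ys e D vs).1.length = ys.length := by
  induction ys generalizing e vs D with
  | nil => simp [simLayers]
  | cons y ys ih =>
    rcases vs with _ | ⟨v, vs⟩
    · simp at h
    · simp only [simLayers, List.length_cons]
      rw [ih _ _ _ (by simpa using h)]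

end Requests

/-! ### The simulator's reply to a message -/

variable {𝒢 : GroupFamily} {N : ℕ} {ι : Type}

/-- The challenge as data. -/
def encChal {κ : ℕ} : Option (𝒢.Chal κ) → Val
  | none => .nat 0
  -- The other components of the challenge, like the flag `bad` of the state, occur in the analysis
  -- only and need not be computed.
  | some ch => .pair (𝒢.enc κ ch.hdr) (𝒢.encExp ch.exp)

/-- The solution as data. -/
def encFound {κ : ℕ} : Option (𝒢.G κ) → Val
  | none => .nat 0
  | some s => .pair (𝒢.enc κ s) (.nat 0)

/-- The simulator's state as data. -/
def encState {κ : ℕ} (P X : 𝒢.G κ) (st : 𝒢.SimState κ) : Val :=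
  .pair (.pair (𝒢.pub κ) (.pair (𝒢.enc κ P) (𝒢.enc κ X)))
    (.pair (encList Entry.enc st.log) (.pair (encChal st.chal) (encFound st.found)))

/-- The simulator's random choices as data. -/
def encTape {κ : ℕ} (u : 𝒢.Fresh κ × List (𝒢.Fresh κ)) : Val :=
  .pair (encFresh u.1) (encList encFresh u.2)

variable (𝒢 N) in
/-- What the reply of the simulator depends on. -/
structure SimInput where
  κ : ℕ
  P : 𝒢.G κ
  X : 𝒢.G κ
  u : 𝒢.Fresh κ × List (𝒢.Fresh κ)
  st : 𝒢.SimState κ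
  v : Val
  P_ne_one : P ≠ 1
  length_eq : u.2.length = N

namespace SimInput

/-- The input as data. -/
def enc (x : 𝒢.SimInput N) : Val := .pair (encTape x.u) (.pair x.v (encState x.P x.X x.st))

/-- A reply and the new state as data. -/
def encAnswer (x : 𝒢.SimInput N) (w : Val × 𝒢.SimState x.κ) : Val :=
  .pair w.1 (encState x.P x.X w.2)

/-- Data that can be computed from the input. -/
abbrev Poly (r : ι → 𝒢.SimInput N) (g : ι → Val) : Prop :=
  𝒢.PolyTime (fun i => (r i).κ) (fun i => (r i).enc) g

open PolyTime

variable (r : ι → 𝒢.SimInput N)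

theorem poly_enc : Poly r fun i => .pair (encTape (r i).u) (.pair (r i).v
    (encState (r i).P (r i).X (r i).st)) := refl

theorem poly_v : Poly r fun i => (r i).v := (poly_enc r).snd.fst

theorem poly_state : Poly r fun i => encState (r i).P (r i).X (r i).st := (poly_enc r).snd.snd

theorem poly_fresh : Poly r fun i => encFresh (r i).u.1 := (poly_enc r).fst.fst

theorem poly_freshList : Poly r fun i => encList encFresh (r i).u.2 := (poly_enc r).fst.snd

theorem poly_params : Poly r fun i =>
    .pair (𝒢.pub (r i).κ) (.pair (𝒢.enc _ (r i).P) (𝒢.enc _ (r i).X)) := (poly_state r).fst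

theorem poly_pub : Poly r fun i => 𝒢.pub (r i).κ := (poly_params r).fst

theorem poly_P : Poly r fun i => 𝒢.enc _ (r i).P := (poly_params r).snd.fst

theorem poly_X : Poly r fun i => 𝒢.enc _ (r i).X := (poly_params r).snd.snd

theorem poly_log : Poly r fun i => encList Entry.enc (r i).st.log := (poly_state r).snd.fst

theorem poly_chal : Poly r fun i => encChal (r i).st.chal := (poly_state r).snd.snd.fst

theorem poly_found : Poly r fun i => encFound (r i).st.found := (poly_state r).snd.snd.snd

theorem poly_gen : Poly r fun i => 𝒢.enc _ (𝒢.gen (r i).κ) :=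
  PolyTime.gen (poly_pub r)

variable {r}

theorem poly_encAnswer {w : ∀ i, Val × 𝒢.SimState (r i).κ} (h1 : Poly r fun i => (w i).1)
    (h2 : Poly r fun i => encList Entry.enc (w i).2.log)
    (h3 : Poly r fun i => encChal (w i).2.chal) (h4 : Poly r fun i => encFound (w i).2.found) :
    Poly r fun i => (r i).encAnswer (w i) :=
  h1.pair ((poly_params r).pair (h2.pair (h3.pair h4)))

variable (r) in
theorem poly_chal_eq_none : Poly r fun i => ofProp ((r i).st.chal = none) :=
  iff (prop_eq (poly_chal r) (const (.nat 0))) fun i => by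
    rcases (r i).st.chal with _ | ch <;> simp [encChal]

/-- The index set for the case that there is a challenge. -/
abbrev Challenged (r : ι → 𝒢.SimInput N) : Type :=
  Σ i, {ch : 𝒢.Chal (r i).κ // (r i).st.chal = some ch}

theorem chal_cases {g : ι → Val}
    (h0 : Poly (fun i : {i // (r i).st.chal = none} => r i.1) fun i => g i)
    (h1 : Poly (fun x : Challenged r => r x.1) fun x => g x.1) : Poly r g := by
  refine cases _ (poly_chal_eq_none r) h0 ?_
  exact h1.comap fun i : {i // ¬(r i).st.chal = none} =>
    ⟨i.1, ((r i.1).st.chal).get (Option.ne_none_iff_isSome.1 i.2), by simp⟩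

theorem poly_chal_some : Poly (fun x : Challenged r => r x.1) fun x =>
    .pair (𝒢.enc _ x.2.1.hdr) (𝒢.encExp x.2.1.exp) :=
  (poly_chal _).congr fun x => congrArg encChal x.2.2

theorem poly_noteVal {s : ∀ i, 𝒢.G (r i).κ} (hs : Poly r fun i => 𝒢.enc _ (s i)) :
    Poly r fun i => encFound ((r i).st.noteVal (r i).P (s i)) := by
  classical
  refine chal_cases ?_ ?_
  · refine (poly_found _).congr fun i => ?_
    simp only [SimState.noteVal, i.2]
  · have hs' := hs.comap (Sigma.fst : Challenged r → ι)
    have h1 := cdh_eq_cdh (a₁ := fun x : Challenged r => 𝒢.gen (r x.1).κ) (fun x => gen_ne_one)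
      (poly_gen _) (poly_P _) poly_chal_some.fst hs'
    refine (ite h1 (hs'.pair (const (.nat 0))) (poly_found _)).congr fun x => ?_
    simp only [SimState.noteVal, x.2.2, cdh_gen]
    split_ifs <;> rfl

theorem poly_decap (h : 𝒢.Efficient) {α : ∀ i, 𝒢.G (r i).κ} (hα : Poly r fun i => 𝒢.enc _ (α i)) :
    Poly r fun i => (r i).encAnswer
      (simAnswer (r i).P (r i).X (r i).u (r i).st (.decap (α i))) := by
  have hr := PolyTime.ask h (fun i => (r i).P_ne_one) (poly_log r) hα (poly_P r) hα (poly_fresh r)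
  exact poly_encAnswer hr.fst hr.snd (poly_chal r) (poly_found r)

theorem poly_hstar (h : 𝒢.Efficient) {s : ∀ i, 𝒢.G (r i).κ} (hs : Poly r fun i => 𝒢.enc _ (s i)) :
    Poly r fun i => (r i).encAnswer
      (simAnswer (r i).P (r i).X (r i).u (r i).st (.hstar (s i))) := by
  have hr := PolyTime.ask h (fun i => gen_ne_one) (poly_log r) (one h (poly_pub r)) (poly_gen r) hs
    (poly_fresh r)
  exact poly_encAnswer hr.fst.fst hr.snd (poly_chal r) (poly_noteVal hs)

theorem poly_hblind (h : 𝒢.Efficient) {α s : ∀ i, 𝒢.G (r i).κ} (hα : Poly r fun i => 𝒢.enc _ (α i))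
    (hs : Poly r fun i => 𝒢.enc _ (s i)) :
    Poly r fun i => (r i).encAnswer
      (simAnswer (r i).P (r i).X (r i).u (r i).st (.hblind (α i) (s i))) := by
  have hr := PolyTime.ask h (fun i => gen_ne_one) (poly_log r) hα (poly_gen r) hs (poly_fresh r)
  exact poly_encAnswer hr.fst.snd hr.snd (poly_chal r) (poly_noteVal hs)

theorem poly_submit (h : 𝒢.Efficient) {j : ι → ℕ} {ys : ∀ i, List (𝒢.G (r i).κ)}
    (hv : ∀ i, Valid N (j i) (ys i))
    (hj : Poly r fun i => .nat (j i)) (hys : Poly r fun i => encList (𝒢.enc _) (ys i)) :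
    Poly r fun i => (r i).encAnswer
      (simAnswer (r i).P (r i).X (r i).u (r i).st (.submit (j i) (ys i))) := by
  let path : ∀ i, List (𝒢.G (r i).κ) := fun i => (ys i).insertIdx (j i) (r i).P
  have hpath : Poly r fun i => encList (𝒢.enc _) (path i) :=
    insertIdx N (fun i => (Nat.le_succ _).trans (hv i).2.2.2.le) hys hj (poly_P r)
  have hlen : ∀ i, (path i).length ≤ N ∧ j i < (path i).length :=
    fun i => length_insertIdx_le (hv i) _
  have hne : ∀ i, ∀ y ∈ path i, y ≠ 1 := by
    intro i y hy
    rcases List.eq_or_mem_of_mem_insertIdx hy with rfl | hy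
    · exact (r i).P_ne_one
    · exact (hv i).2.1 y hy
  let R : ∀ i, List (𝒢.Layer (r i).κ) × List (𝒢.Entry (r i).κ) := fun i =>
    GroupFamily.simLayers (r i).X (path i) (r i).u.1.2 (r i).st.log (r i).u.2
  have hR : Poly r fun i => .pair (encList (Layer.enc (r i).X) (R i).1)
      (encList Entry.enc (R i).2) :=
    PolyTime.simLayers h N (fun i => (hlen i).1) hne (poly_pub r) (poly_X r) hpath (poly_fresh r).snd
      (poly_log r) (poly_freshList r)
  -- The tape holds `N` values, enough for the whole path, so no layer is missing.
  have hRlen : ∀ i, (R i).1.length = (path i).length := fun i =>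
    length_simLayers _ _ _ _ _ ((hlen i).1.trans (r i).length_eq.ge)
  have hRN : ∀ i, (R i).1.length ≤ N := fun i => (hRlen i).trans_le (hlen i).1
  have e0 : ∀ i, (R i).1[0]? = some ((R i).1[0]'(by have := hRlen i; have := hlen i; omega)) :=
    fun i => List.getElem?_eq_getElem _
  have ej : ∀ i, (R i).1[j i]? = some ((R i).1[j i]'(by have := hRlen i; have := hlen i; omega)) :=
    fun i => List.getElem?_eq_getElem _
  have h0 := getElem? N hRN hR.fst (j := fun _ => 0) (const (.nat 0)) e0
  have h1 := getElem? N hRN hR.fst hj ej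
  have h2 := map_snd_snd N hRN hR.fst (e' := fun i l => .pair (encKey l.key) (𝒢.encExp l.bld))
    fun i l => rfl
  have h3 := (h0.fst.pair (h1.fst.pair h2)).pair ((poly_params r).pair
    (hR.snd.pair ((h1.fst.pair h1.snd.fst).pair (poly_found r))))
  refine h3.congr fun i => ?_
  simp only [simAnswer]
  rw [show GroupFamily.simLayers (r i).X ((ys i).insertIdx (j i) (r i).P) (r i).u.1.2 (r i).st.log
    (r i).u.2 = R i from rfl, e0 i, ej i]
  simp only [encAnswer, chalReply, List.map_map]
  rfl

end SimInput

end GroupFamily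


/-! ### Recognising requests and assembling the reply -/

namespace GroupFamily

open Prog Val

variable {𝒢 : GroupFamily} {N : ℕ} {ι : Type}

/-- The witness is chosen in the index and not by the program, which only decides existence; within
the branch its encoding has to be recovered from the data. -/
theorem PolyTime.cases_exists {κ : ι → ℕ} {f g : ι → Val} {A : ι → Type} (p : ∀ i, A i → Prop)
    (hp : 𝒢.PolyTime κ f (fun i => ofProp (∃ a, p i a)))
    (h1 : 𝒢.PolyTime (fun x : Σ i, {a // p i a} => κ x.1) (fun x => f x.1) (fun x => g x.1))
    (h0 : 𝒢.PolyTime (fun i : {i // ¬∃ a, p i a} => κ i) (fun i => f i) (fun i => g i)) :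
    𝒢.PolyTime κ f g :=
  cases _ hp (h1.comap fun i : {i // ∃ a, p i a} => ⟨i.1, i.2.choose, i.2.choose_spec⟩) h0

namespace SimInput

open PolyTime

variable {r : ι → 𝒢.SimInput N}

/-- The message of the input is the given request. -/
def Asks (x : 𝒢.SimInput N) (q : 𝒢.Request x.κ) : Prop :=
  x.v = q.msg ∧ q.Allowed N x.st.hdr

theorem Asks.parse_eq {x : 𝒢.SimInput N} {q : 𝒢.Request x.κ} (h : x.Asks q) :
    parse N x.st.hdr x.v = q := by
  rw [h.1, parse_msg h.2]

theorem asks_parse {x : 𝒢.SimInput N} (h : parse N x.st.hdr x.v ≠ .refuse) :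
    x.Asks (parse N x.st.hdr x.v) :=
  ⟨(allowed_parse h).2, (allowed_parse h).1⟩

theorem hdr_eq_none {κ : ℕ} {st : 𝒢.SimState κ} : st.hdr = none ↔ st.chal = none := by
  simp [SimState.hdr]

theorem poly_tag (n : ℕ) :
    Poly r fun i => ofProp ((∃ a b, (r i).v = .pair a b) ∧ Op.fst.eval (r i).v = .nat n) :=
  and (isPair (poly_v r)) (prop_eq ((poly_v r).op .fst) (const (.nat n)))

theorem eq_pair_iff {v c : Val} {p : Val → Prop} :
    ((∃ a b, v = .pair a b) ∧ Op.fst.eval v = c) ∧ p (Op.snd.eval v) ↔ ∃ m, v = .pair c m ∧ p m := by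
  constructor
  · rintro ⟨⟨⟨a, b, rfl⟩, rfl⟩, h⟩
    exact ⟨b, rfl, h⟩
  · rintro ⟨m, rfl, h⟩
    exact ⟨⟨⟨c, m, rfl⟩, rfl⟩, h⟩

theorem poly_asks_decap (h : 𝒢.Efficient) :
    Poly r fun i => ofProp (∃ α, (r i).Asks (.decap α)) := by
  have hm := (poly_v r).op .snd
  -- Without a challenge `Op.fst` returns the default `nat 0`, which might encode a group element.
  -- Hence the separate disjunct.
  have h1 : Poly r fun i => ofProp ((r i).st.chal = none ∨
      Op.fst.eval (encChal (r i).st.chal) ≠ Op.snd.eval (r i).v) :=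
    or (poly_chal_eq_none r) (not (prop_eq ((poly_chal r).op .fst) hm))
  refine iff (and (and (poly_tag 0) (mem h (poly_pub r) hm)) h1) fun i => ?_
  rw [eq_pair_iff (p := fun m => ∃ a, 𝒢.enc _ a = m)]
  constructor
  · rintro ⟨⟨m, hv, α, rfl⟩, h2⟩
    refine ⟨α, hv, fun hα => ?_⟩
    rw [SimState.hdr, Option.map_eq_some_iff] at hα
    obtain ⟨ch, hch, rfl⟩ := hα
    rw [hch, hv] at h2
    exact h2.elim (by simp) fun h => h rfl
  · rintro ⟨α, hv, hα⟩
    refine ⟨⟨_, hv, α, rfl⟩, ?_⟩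
    rcases hc : (r i).st.chal with _ | ch
    · exact .inl rfl
    · refine .inr fun e => hα ?_
      rw [hv] at e
      rw [SimState.hdr, hc]
      exact congrArg some ((𝒢.enc _).injective e)

theorem poly_asks_hstar (h : 𝒢.Efficient) :
    Poly r fun i => ofProp (∃ s, (r i).Asks (.hstar s)) := by
  refine iff (and (poly_tag 1) (mem h (poly_pub r) ((poly_v r).op .snd))) fun i => ?_
  rw [eq_pair_iff (p := fun m => ∃ a, 𝒢.enc _ a = m)]
  constructor
  · rintro ⟨m, hv, α, rfl⟩
    exact ⟨α, hv, trivial⟩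
  · rintro ⟨α, hv, -⟩
    exact ⟨_, hv, α, rfl⟩

theorem poly_asks_hblind (h : 𝒢.Efficient) :
    Poly r fun i => ofProp (∃ a : 𝒢.G (r i).κ × 𝒢.G (r i).κ, (r i).Asks (.hblind a.1 a.2)) := by
  have hm := (poly_v r).op .snd
  refine iff (and (poly_tag 2) (and (isPair hm) (and (mem h (poly_pub r) (hm.op .fst))
    (mem h (poly_pub r) (hm.op .snd))))) fun i => ?_
  rw [eq_pair_iff (p := fun m => (∃ a b, m = .pair a b) ∧ (∃ a, 𝒢.enc _ a = Op.fst.eval m) ∧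
    ∃ a, 𝒢.enc _ a = Op.snd.eval m)]
  constructor
  · rintro ⟨m, hv, ⟨a, b, rfl⟩, ⟨α, rfl⟩, ⟨s, rfl⟩⟩
    exact ⟨(α, s), hv, trivial⟩
  · rintro ⟨⟨α, s⟩, hv, -⟩
    exact ⟨_, hv, ⟨_, _, rfl⟩, ⟨α, rfl⟩, ⟨s, rfl⟩⟩

theorem poly_isNat {v : ι → Val} (hv : Poly r v) : Poly r fun i => ofProp (∃ n, v i = .nat n) :=
  iff (not (isPair hv)) fun i => by cases v i <;> simp

theorem poly_asks_submit (h : 𝒢.Efficient) :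
    Poly r fun i => ofProp (∃ a : ℕ × List (𝒢.G (r i).κ), (r i).Asks (.submit a.1 a.2)) := by
  have hm := (poly_v r).op .snd
  have h1 := iff (and (poly_tag 3) (and (isPair hm) (and (poly_isNat (hm.op .fst))
    (exists_list h N (poly_pub r) (hm.op .snd))))) fun i =>
    eq_pair_iff (v := (r i).v) (c := .nat 3) (p := fun m => (∃ a b, m = .pair a b) ∧
      (∃ n, Op.fst.eval m = .nat n) ∧
      ∃ ys : List (𝒢.G (r i).κ), ys.length ≤ N ∧ Op.snd.eval m = encList (𝒢.enc _) ys)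
  have h2 : Poly r fun i => ofProp (∃ a : ℕ × List (𝒢.G (r i).κ),
      (r i).v = Request.msg (.submit a.1 a.2) ∧ a.2.length ≤ N) := by
    refine iff h1 fun i => ⟨?_, ?_⟩
    · rintro ⟨m, hv, ⟨a, b, rfl⟩, ⟨n, rfl⟩, ys, hys, rfl⟩
      exact ⟨(n, ys), hv, hys⟩
    · rintro ⟨⟨n, ys⟩, hv, hys⟩
      exact ⟨_, hv, ⟨_, _, rfl⟩, ⟨n, rfl⟩, ys, hys, rfl⟩
  -- Validity can be tested only once the message is known to contain a list of group elements of
  -- bounded length.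
  refine cases_exists _ h2 ?_ ?_
  · have hv := (poly_v (fun x : Σ i, {a : ℕ × List (𝒢.G (r i).κ) //
      (r i).v = Request.msg (.submit a.1 a.2) ∧ a.2.length ≤ N} => r x.1)).congr fun x => x.2.2.1
    refine iff (and (poly_chal_eq_none _)
      (valid h N N (fun x => x.2.2.2) (poly_pub _) hv.snd.snd hv.snd.fst)) fun x => ?_
    constructor
    · rintro ⟨h3, h4⟩
      exact ⟨x.2.1, x.2.2.1, hdr_eq_none.2 h3, h4⟩
    · rintro ⟨a, h3, h4, h5⟩
      have h6 : Request.submit a.1 a.2 = Request.submit x.2.1.1 x.2.1.2 := by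
        have e := h3.symm.trans x.2.2.1
        have e1 := Val.pair.inj (Val.pair.inj e).2
        have e2 := Val.nat.inj e1.1
        rw [e2, Request.submit.injEq]
        exact ⟨rfl, Option.some.inj ((toList_bind_mapM_eq_some.2 rfl).symm.trans
          (toList_bind_mapM_eq_some.2 e1.2))⟩
      rw [Request.submit.injEq] at h6
      rw [h6.1, h6.2] at h5
      exact ⟨hdr_eq_none.1 h4, h5⟩
  · refine (const (.nat 0)).congr fun i => (ofProp_false ?_).symm
    rintro ⟨a, ha⟩
    exact i.2 ⟨a, ha.1, (Nat.le_succ _).trans ha.2.2.2.2.2.le⟩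

/-- The simulator's reply is computable in polynomial time. -/
theorem poly_simAnswer (h : 𝒢.Efficient) :
    Poly r fun i => (r i).encAnswer (simAnswer (r i).P (r i).X (r i).u (r i).st
      (parse N (r i).st.hdr (r i).v)) := by
  refine cases_exists _ (poly_asks_decap h) ?_ ?_
  · have hv := (poly_v (fun x : Σ i, {α // (r i).Asks (.decap α)} => r x.1)).congr
      fun x => x.2.2.1
    exact (poly_decap h hv.snd).congr fun x => by rw [x.2.2.parse_eq]
  refine cases_exists _ (poly_asks_hstar h) ?_ ?_
  · have hv := (poly_v (fun x : Σ i : {i // ¬∃ α, (r i).Asks (.decap α)},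
      {s // (r i).Asks (.hstar s)} => r x.1)).congr fun x => x.2.2.1
    exact (poly_hstar h hv.snd).congr fun x => by rw [x.2.2.parse_eq]
  refine cases_exists _ (poly_asks_hblind h) ?_ ?_
  · have hv := (poly_v (fun x : Σ i : {i : {i // ¬∃ α, (r i).Asks (.decap α)} //
      ¬∃ s, (r i).Asks (.hstar s)}, {a : 𝒢.G (r i).κ × 𝒢.G (r i).κ //
        (r i).Asks (.hblind a.1 a.2)} => r x.1)).congr fun x => x.2.2.1
    exact (poly_hblind h hv.snd.fst hv.snd.snd).congr fun x => by rw [x.2.2.parse_eq]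
  refine cases_exists _ (poly_asks_submit h) ?_ ?_
  · have hv := (poly_v (fun x : Σ i : {i : {i : {i // ¬∃ α, (r i).Asks (.decap α)} //
      ¬∃ s, (r i).Asks (.hstar s)} // ¬∃ a : 𝒢.G (r i).κ × 𝒢.G (r i).κ,
        (r i).Asks (.hblind a.1 a.2)}, {a : ℕ × List (𝒢.G (r i).κ) //
        (r i).Asks (.submit a.1 a.2)} => r x.1)).congr fun x => x.2.2.1
    exact (poly_submit h (fun x => x.2.2.2.2) hv.snd.fst hv.snd.snd).congr
      fun x => by rw [x.2.2.parse_eq]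
  · refine ((const (.nat 0)).pair (poly_state _)).congr fun i => ?_
    have hi : parse N (r i.1.1.1.1).st.hdr (r i.1.1.1.1).v = .refuse := by
      by_contra hne
      have ha := asks_parse hne
      generalize parse N (r i.1.1.1.1).st.hdr (r i.1.1.1.1).v = q at ha hne
      cases q with
      | refuse => exact hne rfl
      | decap α => exact i.1.1.1.2 ⟨α, ha⟩
      | hstar s => exact i.1.1.2 ⟨s, ha⟩
      | hblind α s => exact i.1.2 ⟨(α, s), ha⟩
      | submit j ys => exact i.2 ⟨(j, ys), ha⟩
    rw [hi]
    rfl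

end SimInput

end GroupFamily


open scoped ENNReal

namespace GroupFamily

open Prog Val PMF Exec

variable {𝒢 : GroupFamily} {ι : Type} {κ : ι → ℕ}

/-! ### Randomized computations -/

/-- The distribution `D i` on data can be sampled from `f i` in polynomial time. -/
def PolyRand (𝒢 : GroupFamily) (κ : ι → ℕ) (f : ι → Val) (D : ι → PMF Val) : Prop :=
  ∃ (P : Prog) (t : Polynomial ℕ), ∀ i (φ : Val → ℕ → Unit → ℝ≥0∞),
    (∀ a u, Monotone fun l => φ a l u) → ∀ n,
    ((D i).mean fun a => φ a n ()) ≤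
      wp (P.run (𝒢.ddhOracle (κ i)) (f i)) (n + t.eval (κ i + (f i).size)) () φ

namespace PolyRand

variable {f : ι → Val} {D D' : ι → PMF Val}

/-- Test the definition on the indicator of too large outputs: the program has paid for the size of
every output, so its expectation is zero. -/
theorem size_le (h : 𝒢.PolyRand κ f D) :
    ∃ t : Polynomial ℕ, ∀ i a, D i a ≠ 0 → a.size ≤ t.eval (κ i + (f i).size) := by
  obtain ⟨P, t, H⟩ := h
  refine ⟨t, fun i a ha => ?_⟩
  have h1 := H i (fun a _ _ => if a.size ≤ t.eval (κ i + (f i).size) then 0 else 1)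
    (fun a u => monotone_const) 0
  rw [zero_add, (wp_eq_zero_iff _ _ _ _).2 fun w l u hw => if_pos
    ((Nat.le_add_left _ _).trans (run_size_le _ P _ _ _ w l u hw)), nonpos_iff_eq_zero, mean,
    ENNReal.tsum_eq_zero] at h1
  by_contra hc
  simpa [ha, hc] using h1 a

theorem congr (h : 𝒢.PolyRand κ f D)
    (e : ∀ i (φ : Val → ℝ≥0∞), (D' i).mean φ = (D i).mean φ) : 𝒢.PolyRand κ f D' := by
  obtain ⟨P, t, H⟩ := h
  exact ⟨P, t, fun i φ hφ n => (e i _).trans_le (H i φ hφ n)⟩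

theorem of_polyTime {g : ι → Val} (h : 𝒢.PolyTime κ f g) :
    𝒢.PolyRand κ f (fun i => PMF.pure (g i)) := by
  obtain ⟨P, t, H⟩ := h
  exact ⟨P, t, fun i φ hφ n => (mean_pure _ _).trans_le ((H i).wp_le hφ le_rfl)⟩

theorem pair (h : 𝒢.PolyRand κ f D) (h' : 𝒢.PolyRand κ f D') :
    𝒢.PolyRand κ f (fun i => (D i).bind fun a => (D' i).map fun b => .pair a b) := by
  obtain ⟨P, t, H⟩ := h
  obtain ⟨P', t', H'⟩ := h'
  refine ⟨P.both P', 1 + .X + t + t', fun i φ hφ n => ?_⟩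
  rw [wp_both, if_pos (by simp; omega), mean_bind]
  refine le_trans ?_ ((H i (fun a l u => wp (P'.run (𝒢.ddhOracle (κ i)) (f i)) l u fun b l u =>
    φ (.pair a b) l u) (fun a u => wp_run_monotone _ P' _ _ fun b u => hφ _ _)
    (n + t'.eval (κ i + (f i).size))).trans (wp_run_monotone _ P _ _
      (fun a u => wp_run_monotone _ P' _ _ fun b u => hφ _ _) ?_))
  · refine mean_mono _ fun a => ?_
    rw [mean_map]
    exact H' i _ (fun b u => hφ _ _) n
  · simp only [Polynomial.eval_add, Polynomial.eval_one, Polynomial.eval_X]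
    omega

/-- The second program has to be correct only on values that occur with positive probability, which
makes facts such as the length of a tape available. The size bound for these values keeps its
running time polynomial. -/
theorem map {A : ι → Type} {D : ∀ i, PMF (A i)} {e e' : ∀ i, A i → Val}
    (h : 𝒢.PolyRand κ f (fun i => (D i).map (e i)))
    (h' : 𝒢.PolyTime (fun x : Σ i, {a // D i a ≠ 0} => κ x.1) (fun x => e x.1 x.2.1)
      (fun x => e' x.1 x.2.1)) : 𝒢.PolyRand κ f (fun i => (D i).map (e' i)) := by
  obtain ⟨u, hu⟩ := h.size_le
  obtain ⟨P, t, H⟩ := h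
  obtain ⟨P', t', H'⟩ := h'
  refine ⟨P.comp P', 1 + .X + t + t'.comp (.X + u), fun i φ hφ n => ?_⟩
  set T := t'.eval (κ i + (f i).size + u.eval (κ i + (f i).size)) with hT
  have hmono : ∀ (a : Val) (s : Unit),
      Monotone fun l => wp (P'.run (𝒢.ddhOracle (κ i)) a) l s φ :=
    fun a s => wp_run_monotone _ P' _ _ hφ
  refine le_trans ?_ ((H i (fun a l u => wp (P'.run (𝒢.ddhOracle (κ i)) a) l u φ) hmono
    (n + T)).trans (wp_comp ?_ hφ))
  · rw [mean_map, mean_map]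
    refine ENNReal.tsum_le_tsum fun a => ?_
    by_cases ha : D i a = 0
    · simp [ha]
    · refine mul_le_mul_right ((H' ⟨i, a, ha⟩).wp_le hφ (Nat.add_le_add_left ?_ n)) _
      have h1 : (e i a).size ≤ u.eval (κ i + (f i).size) := by
        refine hu i _ ?_
        rw [← PMF.mem_support_iff, PMF.support_map]
        exact ⟨a, ha, rfl⟩
      exact t'.eval_nat_mono (by dsimp only; omega)
  · simp only [Polynomial.eval_add, Polynomial.eval_one, Polynomial.eval_X, Polynomial.eval_comp]
    omega

theorem rand {m : ι → ℕ} (hm : 𝒢.PolyTime κ f (fun i => .nat (m i))) :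
    𝒢.PolyRand κ f (fun i => (uniformOfFintype (Fin (m i + 1))).map fun x => .nat x.1) := by
  obtain ⟨u, hu⟩ := hm.size_le
  obtain ⟨P, t, H⟩ := hm
  refine ⟨P.comp .rand, 2 + .X + t + u + u, fun i φ hφ n => ?_⟩
  have h1 := hu i
  refine le_trans ?_ (wp_comp_runs (n := n + (1 + u.eval (κ i + (f i).size) +
    u.eval (κ i + (f i).size))) (H i) ?_ hφ)
  · rw [wp_rand_nat, if_pos (by omega), mean_map]
    refine ENNReal.tsum_le_tsum fun x => mul_le_mul_right ?_ _
    have h2 : (Val.nat x).size ≤ (Val.nat (m i)).size := by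
      have := Nat.size_le_size (Nat.le_of_lt_succ x.2)
      simp only [Val.size]
      omega
    dsimp only
    rw [if_pos (by omega)]
    exact hφ _ _ (by omega)
  · simp only [Polynomial.eval_add, Polynomial.eval_ofNat, Polynomial.eval_X]
    omega

theorem uniform_key (hp : 𝒢.PolyTime κ f (fun i => 𝒢.pub (κ i))) :
    𝒢.PolyRand κ f (fun i => (uniformOfFintype (Key (κ i))).map encKey) := by
  refine (rand (PolyTime.nat_sub (PolyTime.key_card hp) (.const (.nat 1)))).congr fun i φ => ?_
  have h1 : 2 ^ (3 * κ i) - 1 + 1 = 2 ^ (3 * κ i) := Nat.sub_add_cancel Nat.one_le_two_pow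
  rw [mean_map, mean_map, ← mean_uniform_equiv (finCongr h1)]
  rfl

/-- Shifting a uniform element of `Fin (q - 1)` by one gives exactly the residues from 1 to `q - 1`,
so no rejection or statistical error occurs. -/
theorem uniform_exp (hp : 𝒢.PolyTime κ f (fun i => 𝒢.pub (κ i))) :
    𝒢.PolyRand κ f (fun i => (uniformOfFintype (𝒢.Exp (κ i))).map 𝒢.encExp) := by
  have h1 := map (e' := fun i (x : Fin (𝒢.q (κ i) - 2 + 1)) => .nat (x.1 + 1))
    (rand (PolyTime.nat_sub (PolyTime.order hp) (.const (.nat 2))))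
    (PolyTime.nat_add (m := fun x : Σ i, {a : Fin (𝒢.q (κ i) - 2 + 1) //
      uniformOfFintype (Fin (𝒢.q (κ i) - 2 + 1)) a ≠ 0} => x.2.1.1) .refl (.const (.nat 1)))
  refine h1.congr fun i φ => ?_
  have h2 : 2 ≤ 𝒢.q (κ i) := (𝒢.prime_card (κ i)).two_le
  have hlt : ∀ x : Fin (𝒢.q (κ i) - 2 + 1), x.1 + 1 < 𝒢.q (κ i) := fun x => by omega
  have hval : ∀ x : Fin (𝒢.q (κ i) - 2 + 1),
      ((x.1 + 1 : ℕ) : ZMod (𝒢.q (κ i))).val = x.1 + 1 := fun x => ZMod.val_cast_of_lt (hlt x)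
  let e : Fin (𝒢.q (κ i) - 2 + 1) → 𝒢.Exp (κ i) := fun x =>
    Units.mk0 ((x.1 + 1 : ℕ) : ZMod (𝒢.q (κ i))) fun h => by
      have := hval x
      rw [h, ZMod.val_zero] at this
      omega
  have he : Function.Bijective e := by
    rw [Fintype.bijective_iff_injective_and_card]
    refine ⟨fun x y h => ?_, ?_⟩
    · have h3 := congrArg (fun u : 𝒢.Exp (κ i) => (u : ZMod (𝒢.q (κ i))).val) h
      simp only [e, Units.val_mk0, hval] at h3
      exact Fin.ext (by omega)
    · rw [Fintype.card_fin, ZMod.card_units]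
      omega
  rw [mean_map, mean_map, ← mean_uniform_equiv (Equiv.ofBijective e he)]
  refine mean_congr _ fun x => ?_
  simp only [Equiv.ofBijective_apply, encExp, e, Units.val_mk0, hval]

theorem uniform_fresh (hp : 𝒢.PolyTime κ f (fun i => 𝒢.pub (κ i))) :
    𝒢.PolyRand κ f (fun i => (uniformOfFintype (𝒢.Fresh (κ i))).map encFresh) := by
  refine ((uniform_key hp).pair (uniform_exp hp)).congr fun i φ => ?_
  simp only [mean_map, mean_bind]
  exact mean_uniform_prod fun k b => φ (.pair (encKey k) (𝒢.encExp b))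

theorem freshList (n : ℕ) (hp : 𝒢.PolyTime κ f (fun i => 𝒢.pub (κ i))) :
    𝒢.PolyRand κ f (fun i => (𝒢.freshList (κ i) n).map (encList encFresh)) := by
  induction n with
  | zero =>
    refine (of_polyTime (.const (.nat 0))).congr fun i φ => ?_
    rw [GroupFamily.freshList, mean_map, mean_pure, mean_pure]
    rfl
  | succ n ih =>
    refine ((uniform_fresh hp).pair ih).congr fun i φ => ?_
    simp only [mean_map, mean_bind]
    exact mean_freshList_succ _ _

theorem tape (n : ℕ) (hp : 𝒢.PolyTime κ f (fun i => 𝒢.pub (κ i))) :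
    𝒢.PolyRand κ f (fun i => (𝒢.tape (κ i) n).map encTape) := by
  refine ((uniform_fresh hp).pair (freshList n hp)).congr fun i φ => ?_
  simp only [mean_map, mean_bind]
  exact mean_tape _ _

end PolyRand

theorem length_of_mem_freshList {κ n : ℕ} {l : List (𝒢.Fresh κ)}
    (h : 𝒢.freshList κ n l ≠ 0) : l.length = n := by
  induction n generalizing l with
  | zero =>
    rw [freshList, PMF.pure_apply] at h
    simp_all
  | succ n ih =>
    rw [freshList, ← PMF.mem_support_iff, PMF.mem_support_bind_iff] at h
    obtain ⟨v, -, h⟩ := h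
    rw [PMF.mem_support_map_iff] at h
    obtain ⟨l', h, rfl⟩ := h
    rw [List.length_cons, ih h]

theorem length_of_mem_tape {κ n : ℕ} {u : 𝒢.Fresh κ × List (𝒢.Fresh κ)}
    (h : 𝒢.tape κ n u ≠ 0) : u.2.length = n := by
  rw [tape, ← PMF.mem_support_iff, PMF.mem_support_bind_iff] at h
  obtain ⟨v, -, h⟩ := h
  rw [PMF.mem_support_map_iff] at h
  obtain ⟨l, h, rfl⟩ := h
  exact length_of_mem_freshList h

variable (𝒢) in
/-- A message and a state of the simulator. -/
structure SimQuery where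
  κ : ℕ
  P : 𝒢.G κ
  X : 𝒢.G κ
  st : 𝒢.SimState κ
  v : Val
  P_ne_one : P ≠ 1

/-- The simulator is a probabilistic polynomial-time algorithm. -/
theorem PolyRand.simulator (h : 𝒢.Efficient) (N : ℕ) :
    𝒢.PolyRand (fun x : 𝒢.SimQuery => x.κ) (fun x => .pair x.v (encState x.P x.X x.st))
      (fun x => (GroupFamily.simulator N x.P x.X x.st x.v).map fun w =>
        .pair w.1 (encState x.P x.X w.2)) := by
  have hf : 𝒢.PolyTime (fun x : 𝒢.SimQuery => x.κ)
    (fun x => .pair x.v (encState x.P x.X x.st))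
    (fun x => .pair x.v (encState x.P x.X x.st)) := .refl
  have h1 : 𝒢.PolyRand (fun x : 𝒢.SimQuery => x.κ) (fun x => .pair x.v (encState x.P x.X x.st))
      (fun x => (𝒢.tape x.κ N).map fun u =>
        .pair (encTape u) (.pair x.v (encState x.P x.X x.st))) := by
    refine ((tape N hf.snd.fst.fst).pair (of_polyTime hf)).congr fun x φ => ?_
    simp only [mean_map, mean_bind, mean_pure]
  have h2 := h1.map (e' := fun (x : 𝒢.SimQuery) u => .pair
    (simAnswer x.P x.X u x.st (parse N x.st.hdr x.v)).1
    (encState x.P x.X (simAnswer x.P x.X u x.st (parse N x.st.hdr x.v)).2)) (SimInput.poly_simAnswer (N := N)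
    (r := fun x : Σ x : 𝒢.SimQuery, {u // 𝒢.tape x.κ N u ≠ 0} =>
      ⟨x.1.κ, x.1.P, x.1.X, x.2.1, x.1.st, x.1.v, x.1.P_ne_one, length_of_mem_tape x.2.2⟩) h)
  refine h2.congr fun x φ => ?_
  simp only [mean_map, GroupFamily.simulator]

end GroupFamily


open scoped ENNReal

namespace GroupFamily

open Prog Val PMF Exec

/-! ### The reduction to the Diffie-Hellman problem -/

section Invariant

variable {𝒢 : GroupFamily} {κ : ℕ}

/-- What is known about the simulator's state, given the remaining budget and a bound for the length
of the log. -/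
structure SimState.Consistent (N S : ℕ) (P X : 𝒢.G κ) (l : ℕ) (st : 𝒢.SimState κ) : Prop where
  length_le : st.log.length + (N + 1) * l ≤ S
  chal_eq : ∀ ch, st.chal = some ch → ch.hdr = 𝒢.pow X ch.exp
  found_eq : ∀ s, st.found = some s → ∃ ch, st.chal = some ch ∧ s = cdh P ch.hdr

variable {N S l : ℕ} {P X : 𝒢.G κ} {st : 𝒢.SimState κ}

theorem SimState.Consistent.noteVal (h : st.Consistent N S P X l) (s : 𝒢.G κ) :
    ∀ a, st.noteVal P s = some a → ∃ ch, st.chal = some ch ∧ a = cdh P ch.hdr := by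
  intro a ha
  unfold SimState.noteVal at ha
  split at ha
  · rename_i ch hch
    split_ifs at ha with hs
    · exact ⟨ch, hch, by rw [← Option.some.inj ha, hs]⟩
    · exact h.found_eq a ha
  · exact h.found_eq a ha

theorem SimState.Consistent.simAnswer (h : st.Consistent N S P X (l + 1))
    (u : 𝒢.Fresh κ × List (𝒢.Fresh κ)) (v : Val) :
    (simAnswer P X u st (parse N st.hdr v)).2.Consistent N S P X l := by
  have hlen : (GroupFamily.simAnswer P X u st (parse N st.hdr v)).2.log.length + (N + 1) * l ≤ S := by
    have h1 := length_log_simulator_le N P X u st v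
    have h2 := h.length_le
    rw [mul_add] at h2
    omega
  have hspec := parse_spec N st.hdr v
  generalize parse N st.hdr v = q at hlen hspec ⊢
  cases q with
  | refuse => exact ⟨hlen, h.chal_eq, h.found_eq⟩
  | decap α => exact ⟨hlen, h.chal_eq, h.found_eq⟩
  | hstar s => exact ⟨hlen, h.chal_eq, h.noteVal s⟩
  | hblind α s => exact ⟨hlen, h.chal_eq, h.noteVal s⟩
  | submit j ys =>
    have hc : st.chal = none := by
      have := (hspec.1 j ys rfl).1
      rwa [SimState.hdr, Option.map_eq_none_iff] at this
    -- Nothing is found before the challenge, so recording the challenge invalidates no solution.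
    have hf : ∀ s, st.found ≠ some s := by
      intro s hs
      obtain ⟨ch, hch, -⟩ := h.found_eq s hs
      rw [hc] at hch
      simp at hch
    simp only [GroupFamily.simAnswer] at hlen ⊢
    split at hlen
    · refine ⟨hlen, ?_, fun s hs => (hf s hs).elim⟩
      intro ch hch
      rw [← Option.some.inj hch]
      rfl
    · exact ⟨hlen, h.chal_eq, h.found_eq⟩

theorem SimState.Consistent.size_le {e : ℕ} (h : st.Consistent N S P X l)
    (hp : (𝒢.pub κ).size ≤ e) (ha : ∀ a : 𝒢.G κ, (𝒢.enc κ a).size ≤ e)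
    (hx : ∀ x : 𝒢.Exp κ, (𝒢.encExp x).size ≤ e) (hk : ∀ k : Key κ, (encKey k).size ≤ e) :
    (encState P X st).size ≤ S * (5 + 5 * e) + 20 + 10 * e := by
  have h1 : (encList Entry.enc st.log).size ≤ st.log.length * (1 + (4 + 5 * e)) + 1 := by
    refine size_encList_le _ _ fun en => ?_
    have h1 := ha en.hdr
    have h2 := ha en.left
    have h3 := ha en.right
    have h4 := hx en.bld
    have h5 := hk en.key
    simp only [Entry.enc, encFresh, Val.size]
    omega
  have h2 : st.log.length * (1 + (4 + 5 * e)) ≤ S * (5 + 5 * e) := by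
    rw [← add_assoc]
    exact Nat.mul_le_mul_right _ ((Nat.le_add_right _ _).trans h.length_le)
  have h3 : (encChal st.chal).size ≤ 1 + 2 * e := by
    rcases st.chal with _ | ch
    · simp only [encChal, Val.size, Nat.size_zero]
      omega
    · have := ha ch.hdr
      have := hx ch.exp
      simp only [encChal, Val.size]
      omega
  have h4 : (encFound st.found).size ≤ 2 + e := by
    rcases st.found with _ | s
    · simp only [encFound, Val.size, Nat.size_zero]
      omega
    · have := ha s
      simp only [encFound, Val.size, Nat.size_zero]
      omega
  have := ha P
  have := ha X
  simp only [encState, Val.size]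
  omega

end Invariant

variable {𝒢 : GroupFamily}

variable (𝒢) in
/-- Final states of the simulator with a solution. -/
abbrev Solved : Type :=
  Σ x : 𝒢.SimQuery, {p : 𝒢.G x.κ × 𝒢.Chal x.κ // x.st.found = some p.1 ∧ x.st.chal = some p.2}

/-- The solution of the Diffie-Hellman problem can be computed from the final state of the
simulator. -/
theorem polyTime_extract (h : 𝒢.Efficient) :
    𝒢.PolyTime (fun x : 𝒢.Solved => x.1.κ) (fun x => .pair x.1.v (encState x.1.P x.1.X x.1.st))
      (fun x => 𝒢.enc _ (𝒢.pow x.2.1.1 x.2.1.2.exp⁻¹)) := by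
  have hs : 𝒢.PolyTime (fun x : 𝒢.Solved => x.1.κ)
    (fun x => .pair x.1.v (encState x.1.P x.1.X x.1.st))
    (fun x => encState x.1.P x.1.X x.1.st) := PolyTime.refl.snd
  have hp := hs.fst.fst
  have hc := hs.snd.snd.fst.congr fun x => congrArg encChal x.2.2.2
  have hf := hs.snd.snd.snd.congr fun x => congrArg encFound x.2.2.1
  exact PolyTime.pow h hp hf.fst (PolyTime.exp_inv h hp hc.snd)

/-- The simulator's initial state can be computed from the Diffie-Hellman problem. -/
theorem polyTime_init :
    𝒢.PolyTime (fun x : Σ κ, 𝒢.G κ × 𝒢.G κ => x.1)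
      (fun x => .pair (𝒢.pub x.1) (.pair (𝒢.enc _ x.2.1) (𝒢.enc _ x.2.2)))
      (fun x => .pair (.pair (𝒢.pub x.1) (𝒢.enc _ x.2.1))
        (encState x.2.1 x.2.2 (.init 𝒢 x.1))) := by
  have hr : 𝒢.PolyTime (fun x : Σ κ, 𝒢.G κ × 𝒢.G κ => x.1)
      (fun x => .pair (𝒢.pub x.1) (.pair (𝒢.enc _ x.2.1) (𝒢.enc _ x.2.2)))
      (fun x => .pair (𝒢.pub x.1) (.pair (𝒢.enc _ x.2.1) (𝒢.enc _ x.2.2))) := .refl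
  exact (hr.fst.pair hr.snd.fst).pair (hr.pair ((PolyTime.const (.nat 0)).pair
    ((PolyTime.const (.nat 0)).pair (PolyTime.const (.nat 0)))))

/-- An adversary that asks for the element `s_j` yields a Diffie-Hellman solver. -/
theorem exists_gdh_adversary (h : 𝒢.Efficient) (N : ℕ) (A : PPT) : ∃ B : PPT, ∀ κ,
    (simProb 𝒢 κ N A fun _ st => if st.found = none then 0 else 1) ≤
      𝒢.gdhExperiment κ B true := by
  classical
  obtain ⟨t, ht⟩ := h.exists_size_bound
  obtain ⟨H, u, hH⟩ := PolyRand.simulator h N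
  obtain ⟨Q, a, hQ⟩ := polyTime_init (𝒢 := 𝒢)
  obtain ⟨R, b, hR⟩ := polyTime_extract h
  -- Bounds as functions of `κ`: `S` for the size of an encoded state, `W` for `κ` plus the size of
  -- a message with a state, `D` for state size and cost of a reply, `M` for the price of one
  -- simulated step, `I` for the input size, `Z` for the simulated run and the extraction, `O` for
  -- the initialisation.
  let S : Polynomial ℕ := .C (N + 1) * A.clock * (5 + 5 * t) + 20 + 10 * t
  let W : Polynomial ℕ := .X + 1 + A.clock + S
  let D : Polynomial ℕ := S + u.comp W
  let M : Polynomial ℕ := 1000 * (1 + A.clock + D)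
  let I : Polynomial ℕ := 3 * t + 2
  let Z : Polynomial ℕ := M * A.clock + b.comp W
  let O : Polynomial ℕ := a.comp (.X + I)
  refine ⟨⟨.comp Q (.comp (simulate H A.prog) R), Z + (1 + O) + (1 + I + O)⟩, fun κ => ?_⟩
  rw [gdhExperiment_apply, simProb]
  refine mean_mono _ fun x₁ => mean_mono _ fun x₂ => ?_
  set P := 𝒢.pow (𝒢.gen κ) x₁ with hP
  set X := 𝒢.pow (𝒢.gen κ) x₂ with hX
  obtain ⟨hpub, henc, hexp, hkey⟩ := ht κ
  have hS : S.eval κ = (N + 1) * A.clock.eval κ * (5 + 5 * t.eval κ) + 20 + 10 * t.eval κ := by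
    simp [S]
  have hW : W.eval κ = κ + 1 + A.clock.eval κ + S.eval κ := by simp [W]
  have hD : D.eval κ = S.eval κ + u.eval (W.eval κ) := by simp [D]
  have hM : M.eval κ = 1000 * (1 + A.clock.eval κ + D.eval κ) := by simp [M]
  have hI : I.eval κ = 3 * t.eval κ + 2 := by simp [I]
  have hZ : Z.eval κ = M.eval κ * A.clock.eval κ + b.eval (W.eval κ) := by simp [Z]
  have hO : O.eval κ = a.eval (κ + I.eval κ) := by simp [O]
  have hsize : ∀ (v : Val) (l : ℕ) (st : 𝒢.SimState κ), v.size ≤ A.clock.eval κ →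
      st.Consistent N ((N + 1) * A.clock.eval κ) P X l →
      κ + (Val.pair v (encState P X st)).size ≤ W.eval κ := by
    intro v l st hv hst
    have := hst.size_le hpub henc hexp hkey
    rw [hW, hS, Val.size]
    omega
  have hP1 : P ≠ 1 := pow_ne_one gen_ne_one x₁
  have hh : Handles (simulator N P X) (𝒢.ddhOracle κ) (encState P X)
      (SimState.Consistent N ((N + 1) * A.clock.eval κ) P X) (A.clock.eval κ) (D.eval κ) H := by
    refine ⟨fun st l l' hl hst => ⟨?_, hst.chal_eq, hst.found_eq⟩, ?_, ?_, ?_⟩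
    · have := hst.length_le
      have := Nat.mul_le_mul_left (N + 1) hl
      omega
    · intro st v l hst x hx
      rw [simulator, ← PMF.mem_support_iff, PMF.mem_support_map_iff] at hx
      obtain ⟨u, -, rfl⟩ := hx
      exact hst.simAnswer u v
    · intro l st hst
      have := hst.size_le hpub henc hexp hkey
      rw [hD, hS]
      omega
    · intro st v l hst hv φ hφ n
      have h1 := hH ⟨κ, P, X, st, v, hP1⟩ φ hφ n
      rw [mean_map] at h1
      refine h1.trans (wp_run_monotone _ H _ _ hφ (Nat.add_le_add_left ?_ n))
      have := u.eval_nat_mono (hsize v _ st hv hst)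
      dsimp only at this ⊢
      omega
  have hin : (Val.pair (𝒢.pub κ) (.pair (𝒢.enc κ P) (𝒢.enc κ X))).size ≤ I.eval κ := by
    have := henc P
    have := henc X
    simp only [Val.size]
    omega
  have hQ' := hQ ⟨κ, P, X⟩
  dsimp only at hQ'
  have hcost := a.eval_nat_mono (Nat.add_le_add_left hin κ)
  dsimp only at hcost
  have hmono : ∀ (w : Val) (s : Unit), Monotone fun _ : ℕ =>
      if w = 𝒢.enc κ (𝒢.pow P x₂) then (1 : ℝ≥0∞) else 0 := fun w s => monotone_const
  refine le_trans ?_ (wp_comp_runs (n := Z.eval κ + (1 + O.eval κ)) hQ' ?_ hmono)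
  · refine le_trans ?_ (wp_comp (n := Z.eval κ) ?_ hmono)
    · refine hh.simulates hM.ge A.prog _ _ _ ⟨?_, by simp [SimState.init], by simp [SimState.init]⟩
        le_rfl (b.eval (W.eval κ)) _ hZ.ge _ _ (fun w s => wp_run_monotone _ R _ _ hmono) ?_
      · simp [SimState.init]
      · intro w l st hl hst
        rcases hf : st.found with _ | s
        · simp
        · obtain ⟨ch, hch, hs⟩ := hst.found_eq s hf
          have hr := hR ⟨⟨κ, P, X, st, w, hP1⟩, (s, ch), hf, hch⟩
          have h1 := b.eval_nat_mono (hsize w l st (by omega) hst)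
          refine le_trans ?_ (hr.wp_le (n := 0) hmono (by dsimp only at h1 ⊢; omega))
          -- Here `s = cdh P (X ^ c)` with `c = ch.exp`, which is the `c`-th power of the solution.
          have h2 : 𝒢.pow s ch.exp⁻¹ = 𝒢.pow P x₂ := by
            rw [hs, hst.chal_eq ch hch, hP, cdh_gen_pow, pow_comm _ _ x₁, pow_pow, mul_inv_cancel,
              pow_one', hX, pow_comm]
          simp [h2]
    · have := hQ'.1
      omega
  · simp only [Polynomial.eval_add, Polynomial.eval_one]
    omega

/-- The group order is superpolynomial, since one can guess the solution of the Diffie-Hellman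
problem. -/
theorem exists_gdh_guesser (h : 𝒢.Efficient) : ∃ B : PPT, ∀ κ,
    (Fintype.card (𝒢.Exp κ) : ℝ≥0∞)⁻¹ ≤ 𝒢.gdhExperiment κ B true := by
  classical
  obtain ⟨t, ht⟩ := h.exists_size_bound
  -- The program returns `g ^ x₁`, which is the right answer when `x₂ = 1`.
  refine ⟨⟨.comp (.op .snd) (.op .fst), 8 * (3 * t + 2)⟩, fun κ => ?_⟩
  rw [gdhExperiment_apply, ← mean_const (uniformOfFintype (𝒢.Exp κ)) (Fintype.card (𝒢.Exp κ))⁻¹]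
  refine mean_mono _ fun x₁ => ?_
  rw [mean_uniform]
  refine le_mul_of_one_le_right' (le_trans ?_ (Finset.single_le_sum_of_canonicallyOrdered
    (Finset.mem_univ (1 : 𝒢.Exp κ))))
  refine le_trans ?_ ((runs_snd_fst _ _ _).wp_le (n := 0) (fun w s => monotone_const) ?_)
  · simp [pow_one']
  · have h1 := (ht κ).1
    have h2 := (ht κ).2.1 (𝒢.pow (𝒢.gen κ) x₁)
    have h3 := (ht κ).2.1 (𝒢.pow (𝒢.gen κ) 1)
    simp only [Val.size, Polynomial.eval_mul, Polynomial.eval_add, Polynomial.eval_ofNat]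
    omega

end GroupFamily

/-! ### The asymptotic conclusion -/

theorem mainTheorem3 (𝒢 : GroupFamily) (h_eff : 𝒢.Efficient) (h_gdh : 𝒢.GDH) (N : ℕ) :
    𝒢.SphinxKemIndCca N := by
  intro A
  obtain ⟨B, hB⟩ := GroupFamily.exists_gdh_adversary h_eff N A
  obtain ⟨C, hC⟩ := GroupFamily.exists_gdh_guesser h_eff
  let t : Polynomial ℕ := .C N * (.C (N + 1) * A.clock + .C N)
  have ht : ∀ κ, N * ((N + 1) * A.clock.eval κ + N) = t.eval κ := fun κ => by simp [t]
  -- The solver `B` accounts for a found `s_j`. The guesser `C` bounds `1 / (q - 1)`, which a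
  -- polynomial factor keeps negligible. The factor `1 / 2` in front of the error is dropped.
  refine ⟨fun κ => (𝒢.gdhExperiment κ B true).toReal +
    (𝒢.gdhExperiment κ C true).toReal * ((t.map (Nat.castRingHom ℝ)).eval (κ : ℝ)),
    (h_gdh B).add ((h_gdh C).mul_polynomial _), fun κ => ?_⟩
  have h0 : ∀ D : PPT, 𝒢.gdhExperiment κ D true ≠ ⊤ := fun D => PMF.apply_ne_top _ _
  have h1 : 𝒢.kemExperiment κ N A true ≤ 2⁻¹ * (1 + (𝒢.gdhExperiment κ B true +
      𝒢.gdhExperiment κ C true * (t.eval κ : ℕ))) := by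
    rw [← ht]
    refine (GroupFamily.kemExperiment_le N A).trans ?_
    gcongr
    · exact hB κ
    · exact hC κ
  have h2 := ENNReal.toReal_mono (by simp [ENNReal.mul_eq_top, h0]) h1
  have h3 : (t.map (Nat.castRingHom ℝ)).eval (κ : ℝ) = (t.eval κ : ℕ) := by
    simp
  rw [ENNReal.toReal_mul, ENNReal.toReal_add (by simp) (by simp [ENNReal.mul_eq_top, h0]),
    ENNReal.toReal_add (h0 B) (by simp [ENNReal.mul_eq_top, h0]), ENNReal.toReal_mul] at h2
  simp only [ENNReal.toReal_inv, ENNReal.toReal_ofNat, ENNReal.toReal_one,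
    ENNReal.toReal_natCast] at h2
  dsimp only
  rw [h3]
  have h4 : 0 ≤ (𝒢.gdhExperiment κ B true).toReal +
    (𝒢.gdhExperiment κ C true).toReal * ((t.eval κ : ℕ) : ℝ) := by positivity
  linarith
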